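/- **Definitions.** A lattice polytope in $\mathbb{R}^m$ is the convex hull of finitely many points of $\mathbb{Z}^m$; its dimension is that of its affine span $\mathrm{Aff}(P)$. Two polytopes $P\subset\mathbb{R}^m$, $P'\subset\mathbb{R}^{k}$ are *equivalent*, $P\cong P'$, if some affine isomorphism $\mathrm{Aff}(P)\to\mathrm{Aff}(P')$ maps $\mathrm{Aff}(P)\cap\mathbb{Z}^m$ onto $\mathrm{Aff}(P')\cap\mathbb{Z}^{k}$ and $P$ onto $P'$. A positive dimensional lattice polytope is *prime* if it is not equivalent to a product of two lattice polytopes of strictly smaller dimension. A lattice polytope $P$ is *compressed* if it has width $1$ with respect to each of its facets $F$: it lies between the hyperplane of $\mathrm{Aff}(P)$ spanned by $F$ and one of the two neighbouring parallel lattice hyperplanes. A quiver $Q$ is a finite directed graph without loops (multiple arrows allowed), with vertex set $Q_0$ and arrow set $Q_1$. For a weight $\theta\in\mathbb{Z}^{Q_0}$ let $\mathcal{A}(Q,\theta)\subset\mathbb{R}^{Q_1}$ be the set of all $x$ such that for every vertex $v$ the sum of $x(a)$ over arrows $a$ ending at $v$ minus the sum of $x(a)$ over arrows $a$ starting at $v$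 equals $\theta(v)$. Put $\nabla(Q,\theta)=\{x\in\mathcal{A}(Q,\theta): x(a)\ge 0\ \forall a\}$ and, for $\ell,u\in\mathbb{N}_0^{Q_1}$, $\nabla(Q,\theta,\ell,u)=\{x\in\mathcal{A}(Q,\theta):\ell(a)\le x(a)\le u(a)\ \forall a\}$. A *flow polytope* is a polytope equivalent to some $\nabla(Q,\theta,\ell,u)$. The *Ehrhart polynomial* of a lattice polytope $P\subset\mathbb{R}^m$ is the polynomial $L_P\in\mathbb{Q}[n]$ with $L_P(n)=|nP\cap\mathbb{Z}^m|$ for every positive integer $n$. **The polytopes.** Let $\nabla_X^{(d)}=\nabla(Q,\theta)$ for the following pairs $(Q,\theta)$; vertices are numbered $0,1,2,\dots$, $\theta$ is listed in this order, and $ij^k$ means $k$ arrows from $i$ to $j$. - $\nabla_{\mathrm{I.a}}^{(3)}$: $\theta=(-1,1)$; $01^4$. - $\nabla_{\mathrm{II.c}}^{(3)}$: $\theta=(-1,0,1)$; $01^2,12^2,02$. - $\nabla_{\mathrm{I.b}}^{(3)}$: $\theta=(-2,-2,1,1,1,1)$; one arrow from each of $0,1$ to each of $2,3,4,5$. - $\nabla_{\mathrm{II.c}}^{(4)}$: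 $\theta=(-1,1)$; $01^5$. - $\nabla_{\mathrm{I.d}}^{(4)}$: $\theta=(-1,0,1)$; $01^2,12^2,02^2$. - $\nabla_{\mathrm{II.f}}^{(4)}$: $\theta=(-1,0,1)$; $01^2,12^3,02$. - $\nabla_{\mathrm{III.d}}^{(4)}$: $\theta=(-1,-1,1,1)$; $01,02,03,12^2,13^2$. - $\nabla_{\mathrm{I.a}}^{(4)}$: $\theta=(-1,0,0,1)$; $03,01^2,12^2,23^2$. - $\nabla_{\mathrm{V.b}}^{(4)}$: $\theta=(-1,-1,-1,1,1,1)$; one arrow from each of $0,1,2$ to each of $3,4,5$. - $\nabla_{\mathrm{VI.c}}^{(4)}$: $\theta=(-1,-1,0,1,1)$; one arrow from each of $0,1$ to each of $2,3,4$, and $23,24$. - $\nabla_{\mathrm{VII.b}}^{(4)}$: $\theta=(-1,-1,-1,1,1,1)$; one arrow from each of $0,1$ to each of $3,4,5$, and $20,21,23$. - $\nabla_{\mathrm{VIII.a}}^{(4)}$: $\theta=(-2,-2,-2,1,1,1,1,1,1)$; $03,13,04,14,05,25,06,26,17,27,18,28$. - $\nabla_{\mathrm{IX.a}}^{(4)}$: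 $\theta=(-2,-3,1,1,1,1,1)$; one arrow from each of $0,1$ to each of $2,\dots,6$. - $\nabla_{\mathrm{X.a}}^{(4)}$: $\theta=(-1,-1,-1,1,1,1)$; one arrow from each of $0,1$ to each of $3,4,5$, and $20^2,21$. **Proposition.** The polytopes $\nabla_X^{(d)}$ above are prime compressed flow polytopes of dimension $d$, and every prime compressed flow polytope of dimension $3$ or $4$ is equivalent to exactly one of them (so there are $3$ in dimension $3$ and $11$ in dimension $4$, up to equivalence). The Ehrhart polynomial of any polytope equivalent to $\nabla_X^{(d)}$ is given by the table, where in each row the two expressions agree. \[ \begin{array}{c|c} \nabla & L_{\nabla}(n) \\ \hline \nabla_{\mathrm{I.a}}^{(3)} & \binom{n+3}{3}=\frac{1}{6}(n^3+6n^2+11n+6) \\ \nabla_{\mathrm{II.c}}^{(3)} & \binom{n+3}{3}+\binom{n+2}{3}=\frac{1}{6}(2n^3+9n^2+13n+6) \\ \nabla_{\mathrm{I.b}}^{(3)} & \binom{n+3}{3}+2\binom{n+2}{3}+\binom{n+1}{3}=\frac{1}{6}(4n^3+12n^2+14n+6) \\ \nabla_{\mathrm{II.c}}^{(4)} & \binom{n+4}{4}=\frac{1}{24}(n^4+10n^3+35n^2+50n+24)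 \\ \nabla_{\mathrm{I.d}}^{(4)} & \binom{n+4}{4}+\binom{n+3}{4}=\frac{1}{24}(2n^4+16n^3+46n^2+56n+24) \\ \nabla_{\mathrm{II.f}}^{(4)} & \binom{n+4}{4}+2\binom{n+3}{4}=\frac{1}{24}(3n^4+22n^3+57n^2+62n+24) \\ \nabla_{\mathrm{III.d}}^{(4)} & \binom{n+4}{4}+3\binom{n+3}{4}+\binom{n+2}{4}=\frac{1}{24}(5n^4+30n^3+67n^2+66n+24) \\ \nabla_{\mathrm{I.a}}^{(4)} & \binom{n+4}{4}+4\binom{n+3}{4}+\binom{n+2}{4}=\frac{1}{24}(6n^4+36n^3+78n^2+72n+24) \\ \nabla_{\mathrm{V.b}}^{(4)} & \binom{n+4}{4}+\binom{n+3}{4}+\binom{n+2}{4}=\frac{1}{24}(3n^4+18n^3+45n^2+54n+24) \\ \nabla_{\mathrm{VI.c}}^{(4)} & \binom{n+4}{4}+2\binom{n+3}{4}+\binom{n+2}{4}=\frac{1}{24}(4n^4+24n^3+56n^2+60n+24) \\ \nabla_{\mathrm{VII.b}}^{(4)} & \binom{n+4}{4}+3\binom{n+3}{4}+2\binom{n+2}{4}=\frac{1}{24}(6n^4+32n^3+66n^2+64n+24)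 \\ \nabla_{\mathrm{VIII.a}}^{(4)} & \binom{n+4}{4}+5\binom{n+3}{4}+5\binom{n+2}{4}+\binom{n+1}{4}=\frac{1}{24}(12n^4+48n^3+84n^2+72n+24) \\ \nabla_{\mathrm{IX.a}}^{(4)} & \binom{n+4}{4}+5\binom{n+3}{4}+5\binom{n+2}{4}=\frac{1}{24}(11n^4+50n^3+85n^2+70n+24) \\ \nabla_{\mathrm{X.a}}^{(4)} & \binom{n+4}{4}+4\binom{n+3}{4}+3\binom{n+2}{4}=\frac{1}{24}(8n^4+40n^3+76n^2+68n+24) \end{array} \] -/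

import Mathlib

/-! ### Lattice polytopes in `ℝ^ι` -/

/-- The real point with the given integer coordinates. -/
def latticePoint {ι : Type*} (z : ι → ℤ) : ι → ℝ := fun i => (z i : ℝ)

/-- The lattice `ℤ^ι` inside `ℝ^ι`. -/
def latticePoints (ι : Type*) : Set (ι → ℝ) := Set.range (latticePoint (ι := ι))

/-- A lattice polytope: the convex hull of finitely many lattice points. -/
def IsLatticePolytope {ι : Type*} (P : Set (ι → ℝ)) : Prop :=
  ∃ S : Finset (ι → ℤ), P = convexHull ℝ (latticePoint '' (S : Set (ι → ℤ)))

/-- The dimension of a polytope, i.e. the dimension of its affine span. -/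
noncomputable def polytopeDim {ι : Type*} (P : Set (ι → ℝ)) : ℕ :=
  Module.finrank ℝ (vectorSpan ℝ P)

/-- Equivalence of `P ⊆ ℝ^ι` and `P' ⊆ ℝ^κ`: there is an affine isomorphism of the affine span of
`P` onto the affine span of `P'` that maps lattice points onto lattice points and `P` onto `P'`.
The isomorphism is given as the restriction of an affine map of the ambient spaces (every affine
map between affine subspaces extends to such a map). -/
def AreEquivalent {ι κ : Type*} (P : Set (ι → ℝ)) (P' : Set (κ → ℝ)) : Prop :=
  ∃ φ : (ι → ℝ) →ᵃ[ℝ] (κ → ℝ),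
    Set.InjOn φ (affineSpan ℝ P : Set (ι → ℝ)) ∧
    φ '' (affineSpan ℝ P : Set (ι → ℝ)) = (affineSpan ℝ P' : Set (κ → ℝ)) ∧
    φ '' ((affineSpan ℝ P : Set (ι → ℝ)) ∩ latticePoints ι) =
      (affineSpan ℝ P' : Set (κ → ℝ)) ∩ latticePoints κ ∧
    φ '' P = P'

/-- The product `P × P'` inside `ℝ^ι × ℝ^κ = ℝ^(ι ⊕ κ)`. -/
def polytopeProd {ι κ : Type*} (P : Set (ι → ℝ)) (P' : Set (κ → ℝ)) : Set (ι ⊕ κ → ℝ) :=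
  {x | (fun i => x (Sum.inl i)) ∈ P ∧ (fun k => x (Sum.inr k)) ∈ P'}

/-- A positive dimensional lattice polytope is prime if it is not equivalent to a product of
lattice polytopes of strictly smaller dimension. -/
def IsPrimePolytope {ι : Type*} (P : Set (ι → ℝ)) : Prop :=
  IsLatticePolytope P ∧ 0 < polytopeDim P ∧
    ¬ ∃ (m n : ℕ) (P₁ : Set (Fin m → ℝ)) (P₂ : Set (Fin n → ℝ)),
      IsLatticePolytope P₁ ∧ IsLatticePolytope P₂ ∧
      polytopeDim P₁ < polytopeDim P ∧ polytopeDim P₂ < polytopeDim P ∧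
      AreEquivalent P (polytopeProd P₁ P₂)

/-- A facet: a nonempty face cut out by a linear functional, of codimension one in `P`. -/
def IsFacet {ι : Type*} (P F : Set (ι → ℝ)) : Prop :=
  F.Nonempty ∧ IsExposed ℝ P F ∧ polytopeDim F + 1 = polytopeDim P

/-- A lattice polytope is compressed if it has width one with respect to each facet `F`: it lies
between the hyperplane spanned by `F` and a neighbouring parallel lattice hyperplane. Here `g` is
the primitive integral affine function on the affine span of `P` (it maps the lattice points of
the affine span onto `ℤ`) which vanishes on `F`; the two hyperplanes are `g = 0` and `g = 1`. -/
def IsCompressed {ι : Type*} (P : Set (ι → ℝ)) : Prop :=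
  IsLatticePolytope P ∧ ∀ F : Set (ι → ℝ), IsFacet P F →
    ∃ g : (ι → ℝ) →ᵃ[ℝ] ℝ,
      g '' ((affineSpan ℝ P : Set (ι → ℝ)) ∩ latticePoints ι) = Set.range (Int.cast : ℤ → ℝ) ∧
      (∀ x ∈ F, g x = 0) ∧ ∀ x ∈ P, 0 ≤ g x ∧ g x ≤ 1

/-- `L` is the Ehrhart polynomial of `P`: for every positive integer `n`, the dilate `n P` contains
exactly `L(n)` lattice points (finitely many). -/
def IsEhrhartPolynomial {ι : Type*} (P : Set (ι → ℝ)) (L : Polynomial ℚ) : Prop :=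
  ∀ n : ℕ, 0 < n →
    (((fun x : ι → ℝ => (n : ℝ) • x) '' P) ∩ latticePoints ι).Finite ∧
    ((((fun x : ι → ℝ => (n : ℝ) • x) '' P) ∩ latticePoints ι).ncard : ℚ) = L.eval (n : ℚ)

/-! ### Quivers and flow polytopes -/

/-- A quiver: a finite directed graph without loops, multiple arrows allowed, with enumerated
vertices and arrows. -/
structure FlowQuiver where
  numVertices : ℕ
  numArrows : ℕ
  tail : Fin numArrows → Fin numVertices
  head : Fin numArrows → Fin numVertices
  no_loops : ∀ a, tail a ≠ head a

namespace FlowQuiver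

/-- The affine space of all `x` such that inflow minus outflow at each vertex is the weight. -/
def flowSpace (Q : FlowQuiver) (θ : Fin Q.numVertices → ℤ) : Set (Fin Q.numArrows → ℝ) :=
  {x | ∀ v, (∑ a with Q.head a = v, x a) - (∑ a with Q.tail a = v, x a) = (θ v : ℝ)}

/-- The flow polytope with lower bounds `l` and upper bounds `u`. -/
def boundedFlows (Q : FlowQuiver) (θ : Fin Q.numVertices → ℤ) (l u : Fin Q.numArrows → ℕ) :
    Set (Fin Q.numArrows → ℝ) :=
  {x | x ∈ Q.flowSpace θ ∧ ∀ a, (l a : ℝ) ≤ x a ∧ x a ≤ (u a : ℝ)}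

/-- The polyhedron of all nonnegative flows; it is a polytope when the quiver is acyclic. -/
def nonnegFlows (Q : FlowQuiver) (θ : Fin Q.numVertices → ℤ) : Set (Fin Q.numArrows → ℝ) :=
  {x | x ∈ Q.flowSpace θ ∧ ∀ a, 0 ≤ x a}

end FlowQuiver

/-- `P` is a flow polytope, that is, it is equivalent to the polytope of bounded flows of some
quiver with weight and bounds. -/
def IsFlowPolytope {ι : Type*} (P : Set (ι → ℝ)) : Prop :=
  ∃ (Q : FlowQuiver) (θ : Fin Q.numVertices → ℤ) (l u : Fin Q.numArrows → ℕ),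
    AreEquivalent P (Q.boundedFlows θ l u)

/-! ### The table -/

/-- A quiver with a weight. -/
structure WeightedQuiver extends FlowQuiver where
  weight : Fin numVertices → ℤ

/-- The quiver with the listed weight on its vertices and the listed arrows `(tail, head)`. -/
def WeightedQuiver.ofList {p q : ℕ} (weight : Fin p → ℤ) (arrows : Fin q → Fin p × Fin p)
    (h : ∀ a, (arrows a).1 ≠ (arrows a).2) : WeightedQuiver where
  numVertices := p
  numArrows := q
  tail a := (arrows a).1
  head a := (arrows a).2
  no_loops := h
  weight := weight

/-- The rows of the table; the last digit is the dimension. -/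
inductive Row where
  | Ia3 | IIc3 | Ib3
  | IIc4 | Id4 | IIf4 | IIId4 | Ia4 | Vb4 | VIc4 | VIIb4 | VIIIa4 | IXa4 | Xa4

namespace Row

def dim : Row → ℕ
  | Ia3 | IIc3 | Ib3 => 3
  | _ => 4

/-- The pair (quiver, weight) of each row. -/
def pair : Row → WeightedQuiver
  | Ia3 => .ofList ![-1, 1] ![(0, 1), (0, 1), (0, 1), (0, 1)] (by decide)
  | IIc3 => .ofList ![-1, 0, 1] ![(0, 1), (0, 1), (1, 2), (1, 2), (0, 2)] (by decide)
  | Ib3 => .ofList ![-2, -2, 1, 1, 1, 1]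
      ![(0, 2), (0, 3), (0, 4), (0, 5), (1, 2), (1, 3), (1, 4), (1, 5)] (by decide)
  | IIc4 => .ofList ![-1, 1] ![(0, 1), (0, 1), (0, 1), (0, 1), (0, 1)] (by decide)
  | Id4 => .ofList ![-1, 0, 1]
      ![(0, 1), (0, 1), (1, 2), (1, 2), (0, 2), (0, 2)] (by decide)
  | IIf4 => .ofList ![-1, 0, 1]
      ![(0, 1), (0, 1), (1, 2), (1, 2), (1, 2), (0, 2)] (by decide)
  | IIId4 => .ofList ![-1, -1, 1, 1]
      ![(0, 1), (0, 2), (0, 3), (1, 2), (1, 2), (1, 3), (1, 3)] (by decide)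
  | Ia4 => .ofList ![-1, 0, 0, 1]
      ![(0, 3), (0, 1), (0, 1), (1, 2), (1, 2), (2, 3), (2, 3)] (by decide)
  | Vb4 => .ofList ![-1, -1, -1, 1, 1, 1]
      ![(0, 3), (0, 4), (0, 5), (1, 3), (1, 4), (1, 5), (2, 3), (2, 4), (2, 5)] (by decide)
  | VIc4 => .ofList ![-1, -1, 0, 1, 1]
      ![(0, 2), (0, 3), (0, 4), (1, 2), (1, 3), (1, 4), (2, 3), (2, 4)] (by decide)
  | VIIb4 => .ofList ![-1, -1, -1, 1, 1, 1]
      ![(0, 3), (0, 4), (0, 5), (1, 3), (1, 4), (1, 5), (2, 0), (2, 1), (2, 3)] (by decide)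
  | VIIIa4 => .ofList ![-2, -2, -2, 1, 1, 1, 1, 1, 1]
      ![(0, 3), (1, 3), (0, 4), (1, 4), (0, 5), (2, 5), (0, 6), (2, 6),
        (1, 7), (2, 7), (1, 8), (2, 8)] (by decide)
  | IXa4 => .ofList ![-2, -3, 1, 1, 1, 1, 1]
      ![(0, 2), (0, 3), (0, 4), (0, 5), (0, 6), (1, 2), (1, 3), (1, 4), (1, 5), (1, 6)]
      (by decide)
  | Xa4 => .ofList ![-1, -1, -1, 1, 1, 1]
      ![(0, 3), (0, 4), (0, 5), (1, 3), (1, 4), (1, 5), (2, 0), (2, 0), (2, 1)] (by decide)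

/-- The polytope of each row: the nonnegative flows of its quiver and weight. -/
def polytope (r : Row) : Set (Fin r.pair.numArrows → ℝ) :=
  r.pair.toFlowQuiver.nonnegFlows r.pair.weight

/-- The sum of binomial coefficients in each row. -/
def binomialSum : Row → ℕ → ℕ
  | Ia3, n => (n + 3).choose 3
  | IIc3, n => (n + 3).choose 3 + (n + 2).choose 3
  | Ib3, n => (n + 3).choose 3 + 2 * (n + 2).choose 3 + (n + 1).choose 3
  | IIc4, n => (n + 4).choose 4
  | Id4, n => (n + 4).choose 4 + (n + 3).choose 4
  | IIf4, n => (n + 4).choose 4 + 2 * (n + 3).choose 4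
  | IIId4, n => (n + 4).choose 4 + 3 * (n + 3).choose 4 + (n + 2).choose 4
  | Ia4, n => (n + 4).choose 4 + 4 * (n + 3).choose 4 + (n + 2).choose 4
  | Vb4, n => (n + 4).choose 4 + (n + 3).choose 4 + (n + 2).choose 4
  | VIc4, n => (n + 4).choose 4 + 2 * (n + 3).choose 4 + (n + 2).choose 4
  | VIIb4, n => (n + 4).choose 4 + 3 * (n + 3).choose 4 + 2 * (n + 2).choose 4
  | VIIIa4, n => (n + 4).choose 4 + 5 * (n + 3).choose 4 + 5 * (n + 2).choose 4 + (n + 1).choose 4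
  | IXa4, n => (n + 4).choose 4 + 5 * (n + 3).choose 4 + 5 * (n + 2).choose 4
  | Xa4, n => (n + 4).choose 4 + 4 * (n + 3).choose 4 + 3 * (n + 2).choose 4

open Polynomial in
/-- The polynomial in each row, written out in powers of the variable. -/
noncomputable def ehrhart : Row → Polynomial ℚ
  | Ia3 => C (1 / 6) * (X ^ 3 + 6 * X ^ 2 + 11 * X + 6)
  | IIc3 => C (1 / 6) * (2 * X ^ 3 + 9 * X ^ 2 + 13 * X + 6)
  | Ib3 => C (1 / 6) * (4 * X ^ 3 + 12 * X ^ 2 + 14 * X + 6)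
  | IIc4 => C (1 / 24) * (X ^ 4 + 10 * X ^ 3 + 35 * X ^ 2 + 50 * X + 24)
  | Id4 => C (1 / 24) * (2 * X ^ 4 + 16 * X ^ 3 + 46 * X ^ 2 + 56 * X + 24)
  | IIf4 => C (1 / 24) * (3 * X ^ 4 + 22 * X ^ 3 + 57 * X ^ 2 + 62 * X + 24)
  | IIId4 => C (1 / 24) * (5 * X ^ 4 + 30 * X ^ 3 + 67 * X ^ 2 + 66 * X + 24)
  | Ia4 => C (1 / 24) * (6 * X ^ 4 + 36 * X ^ 3 + 78 * X ^ 2 + 72 * X + 24)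
  | Vb4 => C (1 / 24) * (3 * X ^ 4 + 18 * X ^ 3 + 45 * X ^ 2 + 54 * X + 24)
  | VIc4 => C (1 / 24) * (4 * X ^ 4 + 24 * X ^ 3 + 56 * X ^ 2 + 60 * X + 24)
  | VIIb4 => C (1 / 24) * (6 * X ^ 4 + 32 * X ^ 3 + 66 * X ^ 2 + 64 * X + 24)
  | VIIIa4 => C (1 / 24) * (12 * X ^ 4 + 48 * X ^ 3 + 84 * X ^ 2 + 72 * X + 24)
  | IXa4 => C (1 / 24) * (11 * X ^ 4 + 50 * X ^ 3 + 85 * X ^ 2 + 70 * X + 24)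
  | Xa4 => C (1 / 24) * (8 * X ^ 4 + 40 * X ^ 3 + 76 * X ^ 2 + 68 * X + 24)

end Row

/-! ### Equivalence of polytopes -/

/-! The classification rests on total unimodularity of flows. Every circulation contains in its
support a nonzero circulation with values in {-1, 0, 1} (`FlowQuiver.exists_unit_circulation`), so
the direction space of a flow polytope is a unimodular subspace. For a compressed flow polytope,
keep an irredundant system of the bounds on arrows. Each remaining inequality defines a facet and is
primitive on the lattice, so compressedness forces its values on the polytope into [0, 1]
(`IsCompressed.le_one`). The inequalities tight at a vertex contain a basis of the dual of the
direction space, and the dual vectors are lattice vectors with entries in {-1, 0, 1}. In these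
coordinates the polytope is the set of y in ℝ^d with 0 ≤ r·y ≤ 1 for all r in a set R of {-1, 0,
1}-rows containing the unit rows; R is unimodular, and each hyperplane y_i = 0 meets the polytope in
a facet (`exists_normalForm`).

Such a polytope is the hull of a set of zero-one points, stored as a number with 2^d bits. For d = 3
and d = 4 a finite search runs through all possible R, pruned only by necessary conditions: minors
of order two and three lie in {-1, 0, 1}, and the coordinate hyperplanes still carry facets
(`search_sound`, `exists_mask_of_search`). Every surviving mask is moved by coordinate permutations
into a short list, and each entry of the list has an explicit unimodular affine map from a table
polytope or from a product of smaller polytopes. A prime polytope is not such a product, so it lies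
in the table.

Conversely, cuts of the quivers express all flows of a row by 3 or 4 of them and bound each flow by
1. Hence each row is a flow polytope with bounds 0 and 1, its facets lie on x_a = 0, and it is
compressed. For primeness, a product whose factors have α and β lattice points gives each lattice
point at least (α - 1)(β - 1) partners that are opposite to it in a parallelogram of lattice points;
in each row some vertex has too few (`card_opposites_of_areEquivalent`).

For the Ehrhart polynomials, the cone over each polytope is dissected into half-open unimodular
cones. A cone with s open facets has binom(n - s + d, d) lattice points at height n
(`CutTree.solutions_leaf`), so the counts of s give the binomial sum. The values at n = 1, 2, 3
separate rows of equal dimension, which gives uniqueness. -/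

theorem latticePoint_mem {ι : Type*} (z : ι → ℤ) : latticePoint z ∈ latticePoints ι := ⟨z, rfl⟩

theorem mem_latticePoints_iff {ι : Type*} {x : ι → ℝ} :
    x ∈ latticePoints ι ↔ ∀ i, ∃ z : ℤ, (z : ℝ) = x i := by
  constructor
  · rintro ⟨z, rfl⟩ i
    exact ⟨z i, rfl⟩
  · intro h
    choose z hz using h
    exact ⟨z, funext hz⟩

theorem latticePoints_add {ι : Type*} {x y : ι → ℝ} (hx : x ∈ latticePoints ι)
    (hy : y ∈ latticePoints ι) : x + y ∈ latticePoints ι := by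
  obtain ⟨a, rfl⟩ := hx
  obtain ⟨b, rfl⟩ := hy
  exact ⟨a + b, by ext i; simp [latticePoint]⟩

theorem latticePoints_sub {ι : Type*} {x y : ι → ℝ} (hx : x ∈ latticePoints ι)
    (hy : y ∈ latticePoints ι) : x - y ∈ latticePoints ι := by
  obtain ⟨a, rfl⟩ := hx
  obtain ⟨b, rfl⟩ := hy
  exact ⟨a - b, by ext i; simp [latticePoint]⟩

theorem latticePoints_smul {ι : Type*} {x : ι → ℝ} (hx : x ∈ latticePoints ι) (n : ℤ) :
    (n : ℝ) • x ∈ latticePoints ι := by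
  obtain ⟨a, rfl⟩ := hx
  exact ⟨n • a, by ext i; simp [latticePoint]⟩

theorem latticePoint_injective {ι : Type*} : Function.Injective (latticePoint (ι := ι)) := by
  intro a b h
  ext i
  have := congrFun h i
  simpa [latticePoint] using this

/-! ### Affine maps on affine spans -/

section affine

variable {V W : Type*} [AddCommGroup V] [Module ℝ V] [AddCommGroup W] [Module ℝ W]

theorem mapsTo_affineSpan {φ : V →ᵃ[ℝ] W} {P : Set V} {P' : Set W} (h : ∀ x ∈ P, φ x ∈ P') :
    ∀ x ∈ affineSpan ℝ P, φ x ∈ affineSpan ℝ P' := by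
  intro x hx
  have h1 : affineSpan ℝ P ≤ (affineSpan ℝ P').comap φ :=
    affineSpan_le.2 fun y hy => subset_affineSpan ℝ P' (h y hy)
  exact h1 hx

theorem leftInverse_affineSpan {φ : V →ᵃ[ℝ] W} {ψ : W →ᵃ[ℝ] V} {P : Set V}
    (h : ∀ x ∈ P, ψ (φ x) = x) : ∀ x ∈ affineSpan ℝ P, ψ (φ x) = x := by
  intro x hx
  exact AffineMap.eqOn_affineSpan (f := ψ.comp φ) (g := AffineMap.id ℝ V) (fun y hy => h y hy) hx

/-- An affine map that is injective on the affine span of `P` has an affine left inverse there. -/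
theorem exists_leftInverse_affineSpan {φ : V →ᵃ[ℝ] W} {P : Set V}
    (h : Set.InjOn φ (affineSpan ℝ P : Set V)) :
    ∃ ψ : W →ᵃ[ℝ] V, ∀ x ∈ affineSpan ℝ P, ψ (φ x) = x := by
  rcases P.eq_empty_or_nonempty with rfl | ⟨p, hp⟩
  · refine ⟨AffineMap.const ℝ W 0, fun x hx => ?_⟩
    rw [AffineSubspace.span_empty] at hx
    exact absurd hx (AffineSubspace.notMem_bot ℝ V x)
  · have hp' := subset_affineSpan ℝ P hp
    set D := (affineSpan ℝ P).direction
    let f : D →ₗ[ℝ] W := φ.linear.comp D.subtype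
    have hf : LinearMap.ker f = ⊥ := by
      refine LinearMap.ker_eq_bot'.2 fun w hw => ?_
      have h1 : φ ((w : V) +ᵥ p) = φ p := by
        rw [AffineMap.map_vadd]
        have : φ.linear w = 0 := hw
        simp [this]
      have h2 := h (AffineSubspace.vadd_mem_of_mem_direction w.2 hp') hp' h1
      ext
      simpa using h2
    obtain ⟨g, hg⟩ := LinearMap.exists_leftInverse_of_injective f hf
    refine ⟨(D.subtype.comp g).toAffineMap.comp
      (AffineMap.id ℝ W - AffineMap.const ℝ W (φ p)) + AffineMap.const ℝ W p, fun x hx => ?_⟩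
    have hd : x - p ∈ D := AffineSubspace.vsub_mem_direction hx hp'
    have h1 : φ x - φ p = f ⟨x - p, hd⟩ := by
      have := AffineMap.linearMap_vsub φ x p
      simpa [f] using this.symm
    have h2 : g (φ x - φ p) = ⟨x - p, hd⟩ := by
      rw [h1]
      exact LinearMap.congr_fun hg _
    simp [h2]

end affine

/-- Affine identities that hold on P hold on its affine span, so an equivalence amounts to a pair of
affine maps that are mutually inverse on P and P' and preserve lattice points of the spans. This
symmetric form makes `symm` and `trans` immediate. -/
theorem areEquivalent_iff {ι κ : Type*} {P : Set (ι → ℝ)} {P' : Set (κ → ℝ)} :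
    AreEquivalent P P' ↔ ∃ (φ : (ι → ℝ) →ᵃ[ℝ] (κ → ℝ)) (ψ : (κ → ℝ) →ᵃ[ℝ] (ι → ℝ)),
      (∀ x ∈ P, φ x ∈ P' ∧ ψ (φ x) = x) ∧ (∀ y ∈ P', ψ y ∈ P ∧ φ (ψ y) = y) ∧
      (∀ x ∈ affineSpan ℝ P, x ∈ latticePoints ι → φ x ∈ latticePoints κ) ∧
      (∀ y ∈ affineSpan ℝ P', y ∈ latticePoints κ → ψ y ∈ latticePoints ι) := by
  constructor
  · rintro ⟨φ, hinj, himg, hlat, hP⟩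
    obtain ⟨ψ, hψ⟩ := exists_leftInverse_affineSpan hinj
    refine ⟨φ, ψ, fun x hx => ⟨hP ▸ Set.mem_image_of_mem φ hx, hψ x (subset_affineSpan ℝ P hx)⟩,
      fun y hy => ?_, fun x hx hx' => ?_, fun y hy hy' => ?_⟩
    · rw [← hP] at hy
      obtain ⟨x, hx, rfl⟩ := hy
      have := hψ x (subset_affineSpan ℝ P hx)
      rw [this]
      exact ⟨hx, rfl⟩
    · have : φ x ∈ φ '' ((affineSpan ℝ P : Set (ι → ℝ)) ∩ latticePoints ι) := ⟨x, ⟨hx, hx'⟩, rfl⟩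
      rw [hlat] at this
      exact this.2
    · have : y ∈ (affineSpan ℝ P' : Set (κ → ℝ)) ∩ latticePoints κ := ⟨hy, hy'⟩
      rw [← hlat] at this
      obtain ⟨x, hx, rfl⟩ := this
      rw [hψ x hx.1]
      exact hx.2
  · rintro ⟨φ, ψ, h1, h2, h3, h4⟩
    have a1 := mapsTo_affineSpan fun x hx => (h1 x hx).1
    have a2 := mapsTo_affineSpan fun x hx => (h2 x hx).1
    have b1 := leftInverse_affineSpan fun x hx => (h1 x hx).2
    have b2 := leftInverse_affineSpan fun x hx => (h2 x hx).2
    refine ⟨φ, fun x hx y hy hxy => ?_, ?_, ?_, ?_⟩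
    · rw [← b1 x hx, hxy, b1 y hy]
    · ext y
      constructor
      · rintro ⟨x, hx, rfl⟩
        exact a1 x hx
      · intro hy
        exact ⟨ψ y, a2 y hy, b2 y hy⟩
    · ext y
      constructor
      · rintro ⟨x, hx, rfl⟩
        exact ⟨a1 x hx.1, h3 x hx.1 hx.2⟩
      · intro hy
        exact ⟨ψ y, ⟨a2 y hy.1, h4 y hy.1 hy.2⟩, b2 y hy.1⟩
    · ext y
      constructor
      · rintro ⟨x, hx, rfl⟩
        exact (h1 x hx).1
      · intro hy
        exact ⟨ψ y, (h2 y hy).1, (h2 y hy).2⟩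

theorem AreEquivalent.symm {ι κ : Type*} {P : Set (ι → ℝ)} {P' : Set (κ → ℝ)}
    (h : AreEquivalent P P') : AreEquivalent P' P := by
  obtain ⟨φ, ψ, h1, h2, h3, h4⟩ := areEquivalent_iff.1 h
  exact areEquivalent_iff.2 ⟨ψ, φ, h2, h1, h4, h3⟩

theorem AreEquivalent.trans {ι κ τ : Type*} {P : Set (ι → ℝ)} {P' : Set (κ → ℝ)}
    {P'' : Set (τ → ℝ)} (h : AreEquivalent P P') (h' : AreEquivalent P' P'') :
    AreEquivalent P P'' := by
  obtain ⟨φ, ψ, h1, h2, h3, h4⟩ := areEquivalent_iff.1 h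
  obtain ⟨φ', ψ', h1', h2', h3', h4'⟩ := areEquivalent_iff.1 h'
  have a1 := mapsTo_affineSpan fun x hx => (h1 x hx).1
  have a2 := mapsTo_affineSpan fun x hx => (h2' x hx).1
  refine areEquivalent_iff.2 ⟨φ'.comp φ, ψ.comp ψ', fun x hx => ⟨?_, ?_⟩, fun y hy => ⟨?_, ?_⟩,
    fun x hx hx' => h3' _ (a1 x hx) (h3 x hx hx'), fun y hy hy' => h4 _ (a2 y hy) (h4' y hy hy')⟩
  · exact (h1' _ (h1 x hx).1).1
  · simp only [AffineMap.comp_apply]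
    rw [(h1' _ (h1 x hx).1).2, (h1 x hx).2]
  · exact (h2 _ (h2' y hy).1).1
  · simp only [AffineMap.comp_apply]
    rw [(h2 _ (h2' y hy).1).2, (h2' y hy).2]

/-- An integral affine section of an integral affine map induces an equivalence of polytopes. -/
theorem areEquivalent_of_section {ι κ : Type*} (ψ : (ι → ℝ) →ᵃ[ℝ] (κ → ℝ))
    (π : (κ → ℝ) →ᵃ[ℝ] (ι → ℝ)) (hψ : ∀ x ∈ latticePoints ι, ψ x ∈ latticePoints κ)
    (hπ : ∀ y ∈ latticePoints κ, π y ∈ latticePoints ι) (hs : ∀ x, π (ψ x) = x)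
    (P : Set (ι → ℝ)) : AreEquivalent P (ψ '' P) :=
  areEquivalent_iff.2 ⟨ψ, π, fun x hx => ⟨⟨x, hx, rfl⟩, hs x⟩,
    by rintro _ ⟨x, hx, rfl⟩; rw [hs]; exact ⟨hx, rfl⟩,
    fun x _ hx => hψ x hx, fun y _ hy => hπ y hy⟩

theorem AreEquivalent.refl {ι : Type*} (P : Set (ι → ℝ)) : AreEquivalent P P :=
  areEquivalent_iff.2 ⟨AffineMap.id ℝ _, AffineMap.id ℝ _, fun _ hx => ⟨hx, rfl⟩,
    fun _ hx => ⟨hx, rfl⟩, fun _ _ hx => hx, fun _ _ hx => hx⟩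

theorem AreEquivalent.polytopeDim_eq {ι κ : Type*} {P : Set (ι → ℝ)} {P' : Set (κ → ℝ)}
    (h : AreEquivalent P P') : polytopeDim P = polytopeDim P' := by
  obtain ⟨φ, hinj, -, -, rfl⟩ := h
  unfold polytopeDim
  have h1 : vectorSpan ℝ (φ '' P) = (vectorSpan ℝ P).map φ.linear :=
    φ.map_vectorSpan.symm
  rw [h1]
  rcases P.eq_empty_or_nonempty with rfl | ⟨p, hp⟩
  · rw [vectorSpan_empty, Submodule.map_bot, finrank_bot, finrank_bot]
  have hp' := subset_affineSpan ℝ P hp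
  have hj : Function.Injective (φ.linear.domRestrict (vectorSpan ℝ P)) := by
    refine (injective_iff_map_eq_zero _).2 fun w hw => ?_
    have hw1 : (w : ι → ℝ) ∈ (affineSpan ℝ P).direction := by
      rw [direction_affineSpan]
      exact w.2
    have h1 : φ ((w : ι → ℝ) +ᵥ p) = φ p := by
      rw [AffineMap.map_vadd]
      have : φ.linear w = 0 := hw
      simp [this]
    have h2 := hinj (AffineSubspace.vadd_mem_of_mem_direction hw1 hp') hp' h1
    ext1
    simpa using h2
  have h3 : (vectorSpan ℝ P).map φ.linear
      = LinearMap.range (φ.linear.domRestrict (vectorSpan ℝ P)) := by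
    rw [LinearMap.range_domRestrict]
  rw [h3]
  exact (LinearEquiv.ofInjective _ hj).finrank_eq

theorem AreEquivalent.isLatticePolytope {ι κ : Type*} {P : Set (ι → ℝ)} {P' : Set (κ → ℝ)}
    (h : AreEquivalent P P') (hP : IsLatticePolytope P) : IsLatticePolytope P' := by
  classical
  obtain ⟨φ, ψ, h1, h2, h3, h4⟩ := areEquivalent_iff.1 h
  obtain ⟨S, hS⟩ := hP
  have hSP : ∀ s ∈ S, latticePoint s ∈ P := by
    intro s hs
    rw [hS]
    exact subset_convexHull ℝ _ ⟨s, hs, rfl⟩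
  have h5 : ∀ s : S, ∃ z : κ → ℤ, latticePoint z = φ (latticePoint s.1) := fun s =>
    h3 _ (subset_affineSpan ℝ P (hSP s s.2)) (latticePoint_mem _)
  choose z hz using h5
  refine ⟨Finset.univ.image z, ?_⟩
  have h6 : P' = φ '' P := by
    ext y
    exact ⟨fun hy => ⟨ψ y, (h2 y hy).1, (h2 y hy).2⟩, by rintro ⟨x, hx, rfl⟩; exact (h1 x hx).1⟩
  rw [h6, hS, AffineMap.image_convexHull]
  congr 1
  ext y
  constructor
  · rintro ⟨_, ⟨s, hs, rfl⟩, rfl⟩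
    exact ⟨z ⟨s, hs⟩, by simp, hz ⟨s, hs⟩⟩
  · rintro ⟨w, hw, rfl⟩
    simp only [Finset.coe_image, Set.mem_image] at hw
    obtain ⟨s, -, rfl⟩ := hw
    exact ⟨latticePoint s.1, ⟨s.1, s.2, rfl⟩, (hz s).symm⟩

/-! ### Invariance of the Ehrhart polynomial -/

/-- The map x ↦ n φ(x / n) carries nP into nP' injectively. It preserves lattice points because P
contains a lattice point p and nφ(x) = φ(p + n(x - p)) - φ(p) + nφ(p), where p + n(x - p) is a
lattice point of the affine span. Applied in both directions this gives equal counts. -/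
theorem AreEquivalent.dilate_le {ι κ : Type*} {P : Set (ι → ℝ)} {P' : Set (κ → ℝ)}
    (h : AreEquivalent P P') (hP : IsLatticePolytope P) (n : ℕ) (hn : 0 < n)
    (hfin : (((fun x : κ → ℝ => (n : ℝ) • x) '' P') ∩ latticePoints κ).Finite) :
    (((fun x : ι → ℝ => (n : ℝ) • x) '' P) ∩ latticePoints ι).Finite ∧
    (((fun x : ι → ℝ => (n : ℝ) • x) '' P) ∩ latticePoints ι).ncard ≤
      (((fun x : κ → ℝ => (n : ℝ) • x) '' P') ∩ latticePoints κ).ncard := by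
  obtain ⟨φ, ψ, h1, h2, h3, h4⟩ := areEquivalent_iff.1 h
  have hn' : (n : ℝ) ≠ 0 := by positivity
  let f : (ι → ℝ) → (κ → ℝ) := fun x => (n : ℝ) • φ ((n : ℝ)⁻¹ • x)
  have hmaps : Set.MapsTo f (((fun x : ι → ℝ => (n : ℝ) • x) '' P) ∩ latticePoints ι)
      (((fun x : κ → ℝ => (n : ℝ) • x) '' P') ∩ latticePoints κ) := by
    rintro _ ⟨⟨x, hx, rfl⟩, hx'⟩
    have hf : f ((n : ℝ) • x) = (n : ℝ) • φ x := by simp [f, smul_smul, hn']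
    simp only [hf]
    refine ⟨⟨φ x, (h1 x hx).1, rfl⟩, ?_⟩
    obtain ⟨S, hS⟩ := hP
    have hne : S.Nonempty := by
      rw [Finset.nonempty_iff_ne_empty]
      rintro rfl
      simp [hS] at hx
    obtain ⟨s, hs⟩ := hne
    have hsP : latticePoint s ∈ P := by
      rw [hS]
      exact subset_convexHull ℝ _ ⟨s, hs, rfl⟩
    have hsA := subset_affineSpan ℝ P hsP
    set p := latticePoint s
    have hw : (n : ℝ) • (x - p) ∈ (affineSpan ℝ P).direction :=
      Submodule.smul_mem _ _ (AffineSubspace.vsub_mem_direction (subset_affineSpan ℝ P hx) hsA)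
    have hwl : (n : ℝ) • (x - p) ∈ latticePoints ι := by
      rw [smul_sub]
      refine latticePoints_sub hx' ?_
      exact_mod_cast latticePoints_smul (latticePoint_mem s) (n : ℤ)
    have h5 := AffineSubspace.vadd_mem_of_mem_direction hw hsA
    have h6 := h3 _ h5 (latticePoints_add hwl (latticePoint_mem s))
    have h7 := h3 _ hsA (latticePoint_mem s)
    rw [AffineMap.map_vadd, map_smul] at h6
    have h8 : φ.linear (x - p) = φ x - φ p := by
      simpa using AffineMap.linearMap_vsub φ x p
    have h9 : (n : ℝ) • φ x = ((n : ℝ) • φ.linear (x - p) +ᵥ φ p) - φ p + ((n : ℤ) : ℝ) • φ p := by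
      rw [h8]
      simp [smul_sub]
    rw [h9]
    exact latticePoints_add (latticePoints_sub h6 h7) (latticePoints_smul h7 n)
  have hinj : Set.InjOn f (((fun x : ι → ℝ => (n : ℝ) • x) '' P) ∩ latticePoints ι) := by
    rintro _ ⟨⟨x, hx, rfl⟩, -⟩ _ ⟨⟨y, hy, rfl⟩, -⟩ hxy
    simp only [f, smul_smul, inv_mul_cancel₀ hn', one_smul] at hxy
    have := smul_right_injective _ hn' hxy
    rw [← (h1 x hx).2, this, (h1 y hy).2]
  exact ⟨Set.Finite.of_injOn hmaps hinj hfin, Set.ncard_le_ncard_of_injOn f hmaps hinj hfin⟩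

theorem AreEquivalent.isEhrhartPolynomial {ι κ : Type*} {P : Set (ι → ℝ)} {P' : Set (κ → ℝ)}
    (h : AreEquivalent P P') (hP : IsLatticePolytope P') {L : Polynomial ℚ}
    (hL : IsEhrhartPolynomial P' L) : IsEhrhartPolynomial P L := by
  intro n hn
  obtain ⟨hfin, hcard⟩ := hL n hn
  obtain ⟨h1, h2⟩ := h.dilate_le (h.symm.isLatticePolytope hP) n hn hfin
  obtain ⟨h3, h4⟩ := h.symm.dilate_le hP n hn h1
  refine ⟨h1, ?_⟩
  rw [← hcard, le_antisymm h2 h4]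

/-! ### Facets and compressed polytopes under equivalence -/

/-- A facet of P' is pulled back to P by the inverse map: its exposing functional is composed with
the linear part of φ, and its dimension is an invariant. The width function of the pulled-back facet
is then transported by ψ. -/
theorem AreEquivalent.isCompressed {ι κ : Type*} [Finite ι] [Finite κ] {P : Set (ι → ℝ)}
    {P' : Set (κ → ℝ)} (h : AreEquivalent P P') (hP : IsCompressed P) : IsCompressed P' := by
  refine ⟨h.isLatticePolytope hP.1, fun F' hF' => ?_⟩
  have hdim := h.polytopeDim_eq
  obtain ⟨φ, ψ, h1, h2, h3, h4⟩ := areEquivalent_iff.1 h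
  have a1 := mapsTo_affineSpan fun x hx => (h1 x hx).1
  have a2 := mapsTo_affineSpan fun x hx => (h2 x hx).1
  have b1 := leftInverse_affineSpan fun x hx => (h1 x hx).2
  have b2 := leftInverse_affineSpan fun x hx => (h2 x hx).2
  obtain ⟨hne, hexp, hd⟩ := hF'
  have hFP : F' ⊆ P' := hexp.subset
  have hequiv : AreEquivalent F' (ψ '' F') := by
    refine areEquivalent_iff.2 ⟨ψ, φ, fun x hx => ⟨⟨x, hx, rfl⟩, (h2 x (hFP hx)).2⟩, ?_, ?_, ?_⟩
    · rintro _ ⟨x, hx, rfl⟩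
      rw [(h2 x (hFP hx)).2]
      exact ⟨hx, rfl⟩
    · exact fun x hx hx' => h4 x (affineSpan_mono ℝ hFP hx) hx'
    · refine fun x hx hx' => h3 x (affineSpan_mono ℝ ?_ hx) hx'
      rintro _ ⟨y, hy, rfl⟩
      exact (h2 y (hFP hy)).1
  have hfac : IsFacet P (ψ '' F') := by
    refine ⟨hne.image _, fun _ => ?_, ?_⟩
    · obtain ⟨l, hl⟩ := hexp hne
      have := Fintype.ofFinite ι
      refine ⟨LinearMap.toContinuousLinearMap ((l : (κ → ℝ) →ₗ[ℝ] ℝ).comp φ.linear), ?_⟩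
      have key : ∀ x y, l (φ x) ≤ l (φ y) ↔
          LinearMap.toContinuousLinearMap ((l : (κ → ℝ) →ₗ[ℝ] ℝ).comp φ.linear) x ≤
          LinearMap.toContinuousLinearMap ((l : (κ → ℝ) →ₗ[ℝ] ℝ).comp φ.linear) y := by
        intro x y
        have : φ x = φ.linear x + φ 0 := congrFun (AffineMap.decomp φ) x
        have h' : φ y = φ.linear y + φ 0 := congrFun (AffineMap.decomp φ) y
        rw [this, h']
        simp
      ext x
      constructor
      · rintro ⟨y, hy, rfl⟩
        refine ⟨(h2 y (hFP hy)).1, fun x hx => ?_⟩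
        rw [← key, (h2 y (hFP hy)).2]
        rw [hl] at hy
        exact hy.2 _ (h1 x hx).1
      · rintro ⟨hx, hx'⟩
        refine ⟨φ x, ?_, (h1 x hx).2⟩
        rw [hl]
        refine ⟨(h1 x hx).1, fun y hy => ?_⟩
        have := hx' _ (h2 y hy).1
        rwa [← key, (h2 y hy).2] at this
    · rw [← hequiv.polytopeDim_eq, hdim, hd]
  obtain ⟨g, hg1, hg2, hg3⟩ := hP.2 _ hfac
  refine ⟨g.comp ψ, ?_, fun x hx => hg2 _ ⟨x, hx, rfl⟩, fun x hx => hg3 _ (h2 x hx).1⟩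
  rw [← hg1]
  ext t
  constructor
  · rintro ⟨y, ⟨hy, hy'⟩, rfl⟩
    exact ⟨ψ y, ⟨a2 y hy, h4 y hy hy'⟩, rfl⟩
  · rintro ⟨x, ⟨hx, hx'⟩, rfl⟩
    refine ⟨φ x, ⟨a1 x hx, h3 x hx hx'⟩, ?_⟩
    simp [b1 x hx]

/-! ### Integrality of flow polytopes -/

/-- If finitely many coordinates have room, a small multiple of any direction can be added. -/
theorem exists_small_step {ι : Type*} [Finite ι] (x w l u : ι → ℝ)
    (h : ∀ a, w a ≠ 0 → l a < x a ∧ x a < u a) (hb : ∀ a, l a ≤ x a ∧ x a ≤ u a) :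
    ∃ ε : ℝ, 0 < ε ∧ ∀ t : ℝ, |t| ≤ ε → ∀ a, l a ≤ x a + t * w a ∧ x a + t * w a ≤ u a := by
  have key : ∀ a, ∃ ε : ℝ, 0 < ε ∧ ∀ t : ℝ, |t| ≤ ε →
      l a ≤ x a + t * w a ∧ x a + t * w a ≤ u a := by
    intro a
    by_cases hw : w a = 0
    · exact ⟨1, one_pos, fun t _ => by simpa [hw] using hb a⟩
    · obtain ⟨h1, h2⟩ := h a hw
      have hw' : 0 < |w a| := abs_pos.2 hw
      refine ⟨min (x a - l a) (u a - x a) / |w a|,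
        div_pos (lt_min (by linarith) (by linarith)) hw', fun t ht => ?_⟩
      rw [le_div_iff₀ hw', ← abs_mul] at ht
      have h3 := abs_le.1 (ht.trans (min_le_left _ _))
      have h4 := abs_le.1 (ht.trans (min_le_right _ _))
      constructor <;> linarith [h3.1, h4.2]
  choose ε hε hε' using key
  have := Fintype.ofFinite ι
  rcases isEmpty_or_nonempty ι with hι | hι
  · exact ⟨1, one_pos, fun t _ a => hι.elim a⟩
  refine ⟨Finset.univ.inf' Finset.univ_nonempty ε, ?_, fun t ht a => hε' a t (ht.trans ?_)⟩
  · rw [Finset.lt_inf'_iff]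
    exact fun a _ => hε a
  · exact Finset.inf'_le _ (Finset.mem_univ a)

namespace FlowQuiver

/-- The incidence number of a vertex and an arrow. -/
def incidence (Q : FlowQuiver) (v : Fin Q.numVertices) (a : Fin Q.numArrows) : ℤ :=
  (if Q.head a = v then 1 else 0) - (if Q.tail a = v then 1 else 0)

theorem mem_flowSpace_iff (Q : FlowQuiver) (θ : Fin Q.numVertices → ℤ)
    (x : Fin Q.numArrows → ℝ) :
    x ∈ Q.flowSpace θ ↔ ∀ v, ∑ a, (Q.incidence v a : ℝ) * x a = θ v := by
  unfold flowSpace incidence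
  simp only [Set.mem_ofPred_eq, Int.cast_sub, sub_mul, Finset.sum_sub_distrib, Finset.sum_filter]
  refine forall_congr' fun v => ?_
  have h1 : ∀ f : Fin Q.numArrows → Fin Q.numVertices,
      ∑ a, (if f a = v then x a else 0) = ∑ a, (((if f a = v then 1 else 0 : ℤ)) : ℝ) * x a :=
    fun f => Finset.sum_congr rfl fun a _ => by split_ifs <;> simp
  rw [h1, h1]

theorem sum_incidence (Q : FlowQuiver) (a : Fin Q.numArrows) : ∑ v, Q.incidence v a = 0 := by
  simp [incidence]

theorem incidence_of_ne_zero (Q : FlowQuiver) {v : Fin Q.numVertices} {a : Fin Q.numArrows}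
    (h : Q.incidence v a ≠ 0) : Q.incidence v a = 1 ∨ Q.incidence v a = -1 := by
  unfold incidence at *
  split_ifs at * <;> simp_all

theorem incidence_ne_zero_iff (Q : FlowQuiver) {v : Fin Q.numVertices} {a : Fin Q.numArrows} :
    Q.incidence v a ≠ 0 ↔ v = Q.head a ∨ v = Q.tail a := by
  have := Q.no_loops a
  unfold incidence
  split_ifs with h1 h2 h2
  · exact absurd (h2.trans h1.symm) this
  · simp [h1.symm]
  · simp [h2.symm]
  · simp only [sub_zero, ne_eq, not_true_eq_false, false_iff, not_or]
    exact ⟨fun h => h1 h.symm, fun h => h2 h.symm⟩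

/-- A nonempty set of arrows without a vertex of degree one supports a nonzero circulation. -/
theorem exists_circulation (Q : FlowQuiver) (s : Finset (Fin Q.numArrows)) (hs : s.Nonempty)
    (hdeg : ∀ v, (s.filter fun a => Q.incidence v a ≠ 0).card ≠ 1) :
    ∃ w : Fin Q.numArrows → ℝ, w ∈ Q.flowSpace 0 ∧ w ≠ 0 ∧ ∀ a, a ∉ s → w a = 0 := by
  classical
  set T : Finset (Fin Q.numVertices) :=
    Finset.univ.filter fun v => (s.filter fun a => Q.incidence v a ≠ 0).Nonempty with hT
  -- Double counting of incidences: each arrow of s has two ends, and each vertex touched by s has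
  -- degree at least two.
  have hcard : T.card ≤ s.card := by
    have h1 : ∑ v, (s.filter fun a => Q.incidence v a ≠ 0).card
        = ∑ a ∈ s, (Finset.univ.filter fun v => Q.incidence v a ≠ 0).card :=
      Finset.sum_card_bipartiteAbove_eq_sum_card_bipartiteBelow _
    have h2 : ∀ a ∈ s, (Finset.univ.filter fun v => Q.incidence v a ≠ 0).card = 2 := by
      intro a _
      have : (Finset.univ.filter fun v => Q.incidence v a ≠ 0) = {Q.head a, Q.tail a} := by
        ext v
        simp [Q.incidence_ne_zero_iff]
      rw [this, Finset.card_pair (Q.no_loops a).symm]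
    rw [Finset.sum_congr rfl h2, Finset.sum_const, smul_eq_mul] at h1
    have h3 : ∑ v ∈ T, 2 ≤ ∑ v, (s.filter fun a => Q.incidence v a ≠ 0).card := by
      refine (Finset.sum_le_sum fun v hv => ?_).trans
        (Finset.sum_le_sum_of_subset (Finset.subset_univ T))
      have h4 := Finset.card_pos.2 (Finset.mem_filter.1 hv).2
      have h5 := hdeg v
      omega
    rw [Finset.sum_const, smul_eq_mul, h1] at h3
    omega
  let D : (s → ℝ) →ₗ[ℝ] (T → ℝ) := LinearMap.pi fun v : T =>
    ∑ a : s, (Q.incidence v a : ℝ) • LinearMap.proj (R := ℝ) (φ := fun _ : s => ℝ) a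
  have hD : ∀ x v, D x v = ∑ a : s, (Q.incidence v a : ℝ) * x a := by
    intro x v
    simp [D]
  have hsum : ∀ x, ∑ v, D x v = 0 := by
    intro x
    simp only [hD]
    rw [Finset.sum_comm]
    refine Finset.sum_eq_zero fun a _ => ?_
    rw [← Finset.sum_mul]
    have h1 : ∑ v : T, (Q.incidence v a : ℝ) = ∑ v, (Q.incidence v a : ℝ) := by
      rw [Finset.sum_coe_sort T fun v => (Q.incidence v a : ℝ)]
      refine Finset.sum_subset (Finset.subset_univ T) fun v _ hv => ?_
      by_contra hne
      refine hv (Finset.mem_filter.2 ⟨Finset.mem_univ _, a, Finset.mem_filter.2 ⟨a.2, ?_⟩⟩)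
      exact_mod_cast hne
    rw [h1, ← Int.cast_sum, Q.sum_incidence]
    simp
  -- The incidence map goes to a space of no larger dimension, and its image lies in the hyperplane
  -- of vectors with coordinate sum zero. Injectivity would make it surjective onto a nonzero space,
  -- which is impossible.
  have hninj : ¬ Function.Injective D := by
    intro hinj
    have h1 := LinearMap.finrank_le_finrank_of_injective hinj
    simp only [Module.finrank_fintype_fun_eq_card, Fintype.card_coe] at h1
    have h2 : Module.finrank ℝ (s → ℝ) = Module.finrank ℝ (T → ℝ) := by
      simp only [Module.finrank_fintype_fun_eq_card, Fintype.card_coe]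
      omega
    have h3 := (LinearMap.injective_iff_surjective_of_finrank_eq_finrank h2).1 hinj
    obtain ⟨a, ha⟩ := hs
    have hv : Q.head a ∈ T := Finset.mem_filter.2 ⟨Finset.mem_univ _, a,
      Finset.mem_filter.2 ⟨ha, Q.incidence_ne_zero_iff.2 (Or.inl rfl)⟩⟩
    obtain ⟨x, hx⟩ := h3 (Pi.single ⟨_, hv⟩ 1)
    have h4 := hsum x
    rw [hx] at h4
    simp at h4
  have h5 : ∃ x, D x = 0 ∧ x ≠ 0 := by
    by_contra hcon
    push Not at hcon
    exact hninj ((injective_iff_map_eq_zero _).2 hcon)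
  obtain ⟨x, hx, hx0⟩ := h5
  refine ⟨fun a => if h : a ∈ s then x ⟨a, h⟩ else 0, ?_, ?_, fun a ha => dif_neg ha⟩
  · rw [mem_flowSpace_iff]
    intro v
    have h6 : ∑ a, (Q.incidence v a : ℝ) * (if h : a ∈ s then x ⟨a, h⟩ else 0)
        = ∑ a : s, (Q.incidence v a : ℝ) * x a := by
      rw [← Finset.sum_subset (Finset.subset_univ s) fun a _ ha => by simp [ha],
        ← Finset.sum_coe_sort s]
      exact Finset.sum_congr rfl fun a _ => by simp
    rw [h6]
    by_cases hv : v ∈ T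
    · have := congrFun hx ⟨v, hv⟩
      rw [hD] at this
      simpa using this
    · rw [Finset.sum_eq_zero]
      · simp
      intro a _
      have : Q.incidence v a = 0 := by
        by_contra hne
        exact hv (Finset.mem_filter.2 ⟨Finset.mem_univ _, a, Finset.mem_filter.2 ⟨a.2, hne⟩⟩)
      simp [this]
  · intro h
    refine hx0 (funext fun a => ?_)
    have := congrFun h a
    simpa using this

/-! ### Polytopes of flows with integral bounds -/

/-- Flows with integral lower and upper bounds. -/
def integralFlows (Q : FlowQuiver) (θ : Fin Q.numVertices → ℤ) (l u : Fin Q.numArrows → ℤ) :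
    Set (Fin Q.numArrows → ℝ) :=
  {x | x ∈ Q.flowSpace θ ∧ ∀ a, (l a : ℝ) ≤ x a ∧ x a ≤ (u a : ℝ)}

theorem boundedFlows_eq_integralFlows (Q : FlowQuiver) (θ : Fin Q.numVertices → ℤ)
    (l u : Fin Q.numArrows → ℕ) :
    Q.boundedFlows θ l u = Q.integralFlows θ (fun a => l a) (fun a => u a) := by
  simp [boundedFlows, integralFlows]

theorem flowSpace_add_smul (Q : FlowQuiver) {θ : Fin Q.numVertices → ℤ}
    {x w : Fin Q.numArrows → ℝ} (hx : x ∈ Q.flowSpace θ) (hw : w ∈ Q.flowSpace 0) (t : ℝ) :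
    x + t • w ∈ Q.flowSpace θ := by
  rw [mem_flowSpace_iff] at *
  intro v
  have h1 := hx v
  have h2 := hw v
  simp only [Pi.add_apply, Pi.smul_apply, smul_eq_mul, mul_add, Finset.sum_add_distrib]
  have h3 : ∑ a, (Q.incidence v a : ℝ) * (t * w a) = t * ∑ a, (Q.incidence v a : ℝ) * w a := by
    rw [Finset.mul_sum]
    exact Finset.sum_congr rfl fun a _ => by ring
  rw [h3, h1, h2]
  simp

theorem flowSpace_sub (Q : FlowQuiver) {θ : Fin Q.numVertices → ℤ}
    {x y : Fin Q.numArrows → ℝ} (hx : x ∈ Q.flowSpace θ) (hy : y ∈ Q.flowSpace θ) :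
    x - y ∈ Q.flowSpace 0 := by
  rw [mem_flowSpace_iff] at *
  intro v
  simp [mul_sub, hx v, hy v]

/-- The arrows with non-integral flow leave no vertex of degree one, because conservation with
integral weight would make the single remaining flow integral. They therefore support a circulation,
along which the point can move both ways: a non-integral value lies strictly between its integral
bounds. -/
theorem extremePoint_integral (Q : FlowQuiver) {θ : Fin Q.numVertices → ℤ}
    {l u : Fin Q.numArrows → ℤ} {x : Fin Q.numArrows → ℝ}
    (hx : x ∈ (Q.integralFlows θ l u).extremePoints ℝ) : x ∈ latticePoints _ := by
  classical
  rw [mem_latticePoints_iff]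
  by_contra hcon
  set s : Finset (Fin Q.numArrows) := Finset.univ.filter fun a => ¬ ∃ z : ℤ, (z : ℝ) = x a with hs
  have hne : s.Nonempty := by
    push Not at hcon
    obtain ⟨a, ha⟩ := hcon
    exact ⟨a, Finset.mem_filter.2 ⟨Finset.mem_univ _, fun ⟨z, hz⟩ => ha z hz⟩⟩
  have hflow := (Q.mem_flowSpace_iff θ x).1 hx.1.1
  have hdeg : ∀ v, (s.filter fun a => Q.incidence v a ≠ 0).card ≠ 1 := by
    intro v hv
    obtain ⟨a, ha⟩ := Finset.card_eq_one.1 hv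
    have ha' : a ∈ s.filter fun a => Q.incidence v a ≠ 0 := by simp [ha]
    obtain ⟨ha1, ha2⟩ := Finset.mem_filter.1 ha'
    have hint : ∀ b, b ≠ a → ∃ z : ℤ, (z : ℝ) = (Q.incidence v b : ℝ) * x b := by
      intro b hb
      by_cases h0 : Q.incidence v b = 0
      · exact ⟨0, by simp [h0]⟩
      · have hbs : b ∉ s := fun h => hb (by
          have : b ∈ s.filter fun a => Q.incidence v a ≠ 0 := Finset.mem_filter.2 ⟨h, h0⟩
          simpa [ha] using this)
        have hz : ∃ z : ℤ, (z : ℝ) = x b := by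
          by_contra hz
          exact hbs (Finset.mem_filter.2 ⟨Finset.mem_univ _, hz⟩)
        obtain ⟨z, hz⟩ := hz
        exact ⟨Q.incidence v b * z, by simp [hz]⟩
    choose! z hz using hint
    have h1 := hflow v
    rw [← Finset.add_sum_erase _ _ (Finset.mem_univ a)] at h1
    rw [← Finset.sum_congr rfl fun b hb => hz b (Finset.ne_of_mem_erase hb)] at h1
    refine (Finset.mem_filter.1 ha1).2 ?_
    rcases Q.incidence_of_ne_zero ha2 with h | h <;> rw [h] at h1
    · exact ⟨θ v - ∑ b ∈ Finset.univ.erase a, z b, by push_cast at h1 ⊢; linarith⟩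
    · exact ⟨∑ b ∈ Finset.univ.erase a, z b - θ v, by push_cast at h1 ⊢; linarith⟩
  obtain ⟨w, hw, hw0, hws⟩ := Q.exists_circulation s hne hdeg
  obtain ⟨ε, hε, hstep⟩ := exists_small_step x w (fun a => (l a : ℝ)) (fun a => (u a : ℝ))
    (fun a ha => by
      have has : a ∈ s := by
        by_contra h
        exact ha (hws a h)
      have h1 := (Finset.mem_filter.1 has).2
      exact ⟨lt_of_le_of_ne (hx.1.2 a).1 fun h => h1 ⟨_, h⟩,
        lt_of_le_of_ne (hx.1.2 a).2 fun h => h1 ⟨_, h.symm⟩⟩) hx.1.2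
  have hp : x + ε • w ∈ Q.integralFlows θ l u :=
    ⟨Q.flowSpace_add_smul hx.1.1 hw ε, hstep ε (abs_of_pos hε).le⟩
  have hm : x + (-ε) • w ∈ Q.integralFlows θ l u :=
    ⟨Q.flowSpace_add_smul hx.1.1 hw (-ε), hstep (-ε) (by rw [abs_neg, abs_of_pos hε])⟩
  have hmem : x ∈ openSegment ℝ (x + ε • w) (x + (-ε) • w) := by
    refine ⟨1 / 2, 1 / 2, by norm_num, by norm_num, by norm_num, ?_⟩
    ext a
    simp
    ring
  have := hx.2 hp hm hmem
  refine hw0 (funext fun a => ?_)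
  have h1 := congrFun this a
  simp only [Pi.add_apply, Pi.smul_apply, smul_eq_mul, add_eq_left, mul_eq_zero] at h1
  rcases h1 with h1 | h1
  · exact absurd h1 hε.ne'
  · exact h1

theorem isClosed_flowSpace (Q : FlowQuiver) (θ : Fin Q.numVertices → ℤ) :
    IsClosed (Q.flowSpace θ) := by
  have : Q.flowSpace θ = ⋂ v, {x | ∑ a, (Q.incidence v a : ℝ) * x a = θ v} := by
    ext x
    simp [mem_flowSpace_iff]
  rw [this]
  exact isClosed_iInter fun v => isClosed_eq (by fun_prop) continuous_const

theorem integralFlows_eq_inter (Q : FlowQuiver) (θ : Fin Q.numVertices → ℤ)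
    (l u : Fin Q.numArrows → ℤ) : Q.integralFlows θ l u
      = Q.flowSpace θ ∩ Set.Icc (fun a => (l a : ℝ)) (fun a => (u a : ℝ)) := by
  ext x
  rw [Set.mem_inter_iff, Set.mem_Icc, Pi.le_def, Pi.le_def, ← forall_and]
  rfl

theorem isCompact_integralFlows (Q : FlowQuiver) (θ : Fin Q.numVertices → ℤ)
    (l u : Fin Q.numArrows → ℤ) : IsCompact (Q.integralFlows θ l u) := by
  rw [integralFlows_eq_inter]
  exact (isCompact_Icc).inter_left (Q.isClosed_flowSpace θ)

theorem convex_flowSpace (Q : FlowQuiver) (θ : Fin Q.numVertices → ℤ) :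
    Convex ℝ (Q.flowSpace θ) := by
  intro x hx y hy a b _ _ hab
  have h := Q.flowSpace_add_smul hx (Q.flowSpace_sub hy hx) b
  have h1 : a • x + b • y = x + b • (y - x) := by
    rw [smul_sub, ← sub_eq_iff_eq_add.2 hab.symm, sub_smul, one_smul]
    abel
  rwa [h1]

theorem convex_integralFlows (Q : FlowQuiver) (θ : Fin Q.numVertices → ℤ)
    (l u : Fin Q.numArrows → ℤ) : Convex ℝ (Q.integralFlows θ l u) := by
  rw [integralFlows_eq_inter]
  exact (Q.convex_flowSpace θ).inter (convex_Icc _ _)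

/-- Krein–Milman: a compact convex set is the closed hull of its extreme points. These are integral,
hence among the finitely many lattice points of the box, and the hull of a finite set is already
closed. -/
theorem isLatticePolytope_integralFlows (Q : FlowQuiver) (θ : Fin Q.numVertices → ℤ)
    (l u : Fin Q.numArrows → ℤ) : IsLatticePolytope (Q.integralFlows θ l u) := by
  classical
  have hfin : (Set.Icc l u ∩ latticePoint ⁻¹' Q.integralFlows θ l u).Finite :=
    (Set.finite_Icc l u).inter_of_left _
  refine ⟨hfin.toFinset, subset_antisymm ?_ ?_⟩
  · refine (closure_convexHull_extremePoints (Q.isCompact_integralFlows θ l u)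
      (Q.convex_integralFlows θ l u)).symm.subset.trans ?_
    have hcl : IsClosed (convexHull ℝ (latticePoint '' (hfin.toFinset : Set (Fin Q.numArrows → ℤ)))) :=
      ((Finset.finite_toSet hfin.toFinset).image latticePoint).isClosed_convexHull ℝ
    refine closure_minimal (convexHull_mono fun x hx => ?_) hcl
    obtain ⟨z, rfl⟩ := Q.extremePoint_integral hx
    refine ⟨z, ?_, rfl⟩
    simp only [Set.Finite.coe_toFinset, Set.mem_inter_iff, Set.mem_preimage]
    refine ⟨?_, hx.1⟩
    rw [Set.mem_Icc, Pi.le_def, Pi.le_def]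
    have h := hx.1.2
    simp only [latticePoint, Int.cast_le] at h
    exact ⟨fun a => (h a).1, fun a => (h a).2⟩
  · refine convexHull_min ?_ (Q.convex_integralFlows θ l u)
    rintro _ ⟨z, hz, rfl⟩
    simp only [Set.Finite.coe_toFinset] at hz
    exact hz.2

/-- The support of a nonzero circulation contains the support of a nonzero circulation with
values in `{-1, 0, 1}`. -/
theorem exists_unit_circulation (Q : FlowQuiver) {w : Fin Q.numArrows → ℝ}
    (hw : w ∈ Q.flowSpace 0) (hw0 : w ≠ 0) :
    ∃ u : Fin Q.numArrows → ℤ, latticePoint u ∈ Q.flowSpace 0 ∧ u ≠ 0 ∧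
      (∀ a, -1 ≤ u a ∧ u a ≤ 1) ∧ ∀ a, w a = 0 → u a = 0 := by
  classical
  -- K consists of the circulations that vanish off the support of w and have values in [-1, 1]. It
  -- contains a positive multiple of w, so it is not {0} and has a nonzero extreme point, which is
  -- integral.
  set l : Fin Q.numArrows → ℤ := fun a => if w a = 0 then 0 else -1 with hl
  set u : Fin Q.numArrows → ℤ := fun a => if w a = 0 then 0 else 1 with hu
  set K := Q.integralFlows 0 l u with hK
  have hzero : (0 : Fin Q.numArrows → ℝ) ∈ Q.flowSpace 0 := by
    rw [mem_flowSpace_iff]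
    simp
  have hb : ∀ a, ((l a : ℤ) : ℝ) ≤ (0 : Fin Q.numArrows → ℝ) a ∧
      (0 : Fin Q.numArrows → ℝ) a ≤ ((u a : ℤ) : ℝ) := by
    intro a
    simp only [hl, hu, Pi.zero_apply]
    split_ifs <;> norm_num
  obtain ⟨ε, hε, hstep⟩ := exists_small_step 0 w (fun a => ((l a : ℤ) : ℝ))
    (fun a => ((u a : ℤ) : ℝ)) (fun a ha => by simp [hl, hu, ha]) hb
  have hmem : ε • w ∈ K := by
    have h1 := Q.flowSpace_add_smul hzero hw ε
    rw [zero_add] at h1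
    refine ⟨h1, fun a => ?_⟩
    have := hstep ε (abs_of_pos hε).le a
    simpa using this
  have hex : ∃ x ∈ K.extremePoints ℝ, x ≠ 0 := by
    by_contra hcon
    push Not at hcon
    have h1 : K ⊆ {0} := by
      refine (closure_convexHull_extremePoints (Q.isCompact_integralFlows 0 l u)
        (Q.convex_integralFlows 0 l u)).symm.subset.trans ?_
      exact closure_minimal (convexHull_min (fun x hx => hcon x hx) (convex_singleton 0))
        isClosed_singleton
    have h2 : ε • w = 0 := h1 hmem
    rcases smul_eq_zero.1 h2 with h | h
    · exact hε.ne' h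
    · exact hw0 h
  obtain ⟨x, hx, hx0⟩ := hex
  obtain ⟨z, rfl⟩ := Q.extremePoint_integral hx
  refine ⟨z, hx.1.1, fun h => hx0 (by subst h; ext; simp [latticePoint]), fun a => ?_,
    fun a ha => ?_⟩
  · have := hx.1.2 a
    simp only [latticePoint, Int.cast_le] at this
    simp only [hl, hu] at this
    split_ifs at this <;> omega
  · have := hx.1.2 a
    simp only [latticePoint, Int.cast_le] at this
    simp only [hl, hu, ha, if_true] at this
    omega

end FlowQuiver

/-! ### Irredundant inequalities, interior points and facets -/

/-- Inequalities implied by the others are discarded one at a time. When none is left to discard,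
each remaining one is violated at some point of A where all the others hold. -/
theorem exists_irredundant {E J : Type*} [DecidableEq J] (A : Set E) (h : J → E → ℝ)
    (J₁ : Finset J) : ∃ J₀ ⊆ J₁, (∀ x ∈ A, (∀ j ∈ J₀, 0 ≤ h j x) → ∀ j ∈ J₁, 0 ≤ h j x) ∧
      ∀ j ∈ J₀, ∃ x ∈ A, h j x < 0 ∧ ∀ k ∈ J₀, k ≠ j → 0 ≤ h k x := by
  induction J₁ using Finset.strongInduction with
  | H J₁ ih =>
    by_cases hred : ∃ j ∈ J₁, ∀ x ∈ A, (∀ k ∈ J₁, k ≠ j → 0 ≤ h k x) → 0 ≤ h j x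
    · obtain ⟨j, hj, hj'⟩ := hred
      obtain ⟨J₀, hsub, h1, h2⟩ := ih (J₁.erase j) (Finset.erase_ssubset hj)
      refine ⟨J₀, hsub.trans (Finset.erase_subset _ _), fun x hx hx' => ?_, h2⟩
      have h3 := h1 x hx hx'
      intro k hk
      by_cases hkj : k = j
      · subst hkj
        exact hj' x hx fun i hi hik => h3 i (Finset.mem_erase.2 ⟨hik, hi⟩)
      · exact h3 k (Finset.mem_erase.2 ⟨hkj, hk⟩)
    · push Not at hred
      exact ⟨J₁, subset_rfl, fun x _ hx => hx, fun j hj => by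
        obtain ⟨x, hx, hx', hx''⟩ := hred j hj
        exact ⟨x, hx, hx'', hx'⟩⟩

/-- Passing to the midpoint with a witness of one more strict inequality keeps all strict
inequalities obtained so far, because none of the functions is negative on P. -/
theorem exists_interior {E J : Type*} [AddCommGroup E] [Module ℝ E] [Finite J] {P : Set E}
    (hP : Convex ℝ P) (hne : P.Nonempty) (h : J → E →ᵃ[ℝ] ℝ) (hpos : ∀ j, ∀ x ∈ P, 0 ≤ h j x) :
    ∃ z ∈ P, ∀ j, (∃ x ∈ P, 0 < h j x) → 0 < h j z := by
  classical
  have := Fintype.ofFinite J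
  suffices H : ∀ s : Finset J, ∃ z ∈ P, ∀ j ∈ s, (∃ x ∈ P, 0 < h j x) → 0 < h j z by
    obtain ⟨z, hz, hz'⟩ := H Finset.univ
    exact ⟨z, hz, fun j => hz' j (Finset.mem_univ j)⟩
  intro s
  induction s using Finset.induction_on with
  | empty =>
    obtain ⟨z, hz⟩ := hne
    exact ⟨z, hz, by simp⟩
  | insert a s _ ih =>
    obtain ⟨z, hz, hz'⟩ := ih
    by_cases ha : ∃ x ∈ P, 0 < h a x
    · obtain ⟨x, hx, hx'⟩ := ha
      refine ⟨midpoint ℝ z x, hP.midpoint_mem hz hx, fun j hj hex => ?_⟩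
      rw [AffineMap.map_midpoint, midpoint_eq_smul_add]
      simp only [invOf_eq_inv, smul_eq_mul]
      rcases Finset.mem_insert.1 hj with rfl | hj
      · linarith [hpos j z hz]
      · linarith [hz' j hj hex, hpos j x hx]
    · refine ⟨z, hz, fun j hj hex => ?_⟩
      rcases Finset.mem_insert.1 hj with rfl | hj
      · exact absurd hex ha
      · exact hz' j hj hex

theorem AffineMap.apply_add_smul {E : Type*} [AddCommGroup E] [Module ℝ E] (h : E →ᵃ[ℝ] ℝ)
    (p w : E) (t : ℝ) : h (p + t • w) = h p + t * h.linear w := by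
  have := h.map_vadd p (t • w)
  simp only [vadd_eq_add, map_smul, smul_eq_mul] at this
  rw [add_comm p, this, add_comm]

theorem exists_small_affine_step {E J : Type*} [AddCommGroup E] [Module ℝ E] [Finite J]
    (h : J → E →ᵃ[ℝ] ℝ) (p w : E) (h0 : ∀ j, 0 ≤ h j p)
    (hw : ∀ j, (h j).linear w ≠ 0 → 0 < h j p) :
    ∃ ε : ℝ, 0 < ε ∧ ∀ t : ℝ, |t| ≤ ε → ∀ j, 0 ≤ h j (p + t • w) := by
  -- Only the lower bound 0 matters; `h j p + 1` is an upper bound that merely leaves room.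
  obtain ⟨ε, hε, h1⟩ := exists_small_step (fun j => h j p) (fun j => (h j).linear w)
    (fun _ => 0) (fun j => h j p + 1) (fun j hj => ⟨hw j hj, by simp⟩)
    (fun j => ⟨h0 j, by simp⟩)
  exact ⟨ε, hε, fun t ht j => by rw [AffineMap.apply_add_smul]; exact (h1 t ht j).1⟩

theorem mem_vectorSpan_of_step {E : Type*} [AddCommGroup E] [Module ℝ E] {P : Set E} {p w : E}
    {ε : ℝ} (hε : ε ≠ 0) (hp : p ∈ P) (h : p + ε • w ∈ P) : w ∈ vectorSpan ℝ P := by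
  have h1 := vsub_mem_vectorSpan ℝ h hp
  simp only [vsub_eq_sub, add_sub_cancel_left] at h1
  have h2 := Submodule.smul_mem _ ε⁻¹ h1
  rwa [smul_smul, inv_mul_cancel₀ hε, one_smul] at h2

theorem add_smul_mem_affineSpan {E : Type*} [AddCommGroup E] [Module ℝ E] {P : Set E} {p w : E}
    (hp : p ∈ affineSpan ℝ P) (hw : w ∈ vectorSpan ℝ P) (t : ℝ) :
    p + t • w ∈ affineSpan ℝ P := by
  rw [← direction_affineSpan] at hw
  have := AffineSubspace.vadd_mem_of_mem_direction (Submodule.smul_mem _ t hw) hp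
  rwa [vadd_eq_add, add_comm] at this

theorem finrank_inf_ker {E : Type*} [AddCommGroup E] [Module ℝ E] [FiniteDimensional ℝ E]
    (W : Submodule ℝ E) (f : E →ₗ[ℝ] ℝ) {w : E} (hw : w ∈ W) (hfw : f w ≠ 0) :
    Module.finrank ℝ (W ⊓ LinearMap.ker f : Submodule ℝ E) + 1 = Module.finrank ℝ W := by
  have h1 : f.domRestrict W ≠ 0 := fun h => hfw (by simpa using LinearMap.congr_fun h ⟨w, hw⟩)
  rw [← Module.Dual.finrank_ker_add_one_of_ne_zero h1]
  have h2 : (LinearMap.ker (f.domRestrict W)).map W.subtype = W ⊓ LinearMap.ker f := by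
    ext x
    simp only [Submodule.mem_map, LinearMap.mem_ker, Submodule.mem_inf]
    constructor
    · rintro ⟨y, hy, rfl⟩
      exact ⟨y.2, hy⟩
    · rintro ⟨hx, hx'⟩
      exact ⟨⟨x, hx⟩, hx', rfl⟩
  rw [← h2, Submodule.finrank_map_subtype_eq]

/-- A point on one irredundant inequality where all the other ones are strict. -/
theorem exists_facet_point {E J : Type*} [AddCommGroup E] [Module ℝ E] {P : Set E}
    {J₀ : Finset J} {h : J → E →ᵃ[ℝ] ℝ}
    (hP : ∀ x, x ∈ P ↔ x ∈ affineSpan ℝ P ∧ ∀ j ∈ J₀, 0 ≤ h j x) {z : E} (hz : z ∈ P)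
    (hz' : ∀ j ∈ J₀, 0 < h j z) {j : J} (hj : j ∈ J₀) {x : E} (hx : x ∈ affineSpan ℝ P)
    (hxj : h j x < 0) (hxk : ∀ k ∈ J₀, k ≠ j → 0 ≤ h k x) :
    ∃ p ∈ P, h j p = 0 ∧ ∀ k ∈ J₀, k ≠ j → 0 < h k p := by
  have hzj := hz' j hj
  -- The parameter at which the segment from z to x crosses the hyperplane h j = 0.
  set t : ℝ := h j z / (h j z - h j x) with ht
  have hden : 0 < h j z - h j x := by linarith
  have ht0 : 0 < t := div_pos hzj hden
  have ht1 : t < 1 := by rw [ht, div_lt_one hden]; linarith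
  have hval : ∀ k, h k (AffineMap.lineMap z x t) = (1 - t) * h k z + t * h k x := by
    intro k
    rw [AffineMap.apply_lineMap, AffineMap.lineMap_apply_module]
    simp
  have hj0 : h j (AffineMap.lineMap z x t) = 0 := by
    rw [hval, ht]
    field_simp
    ring
  have hk0 : ∀ k ∈ J₀, k ≠ j → 0 < h k (AffineMap.lineMap z x t) := by
    intro k hk hkj
    rw [hval]
    have h1 := mul_pos (sub_pos.2 ht1) (hz' k hk)
    have h2 := mul_nonneg ht0.le (hxk k hk hkj)
    linarith
  refine ⟨AffineMap.lineMap z x t, (hP _).2 ⟨AffineMap.lineMap_mem t ((hP z).1 hz).1 hx,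
    fun k hk => ?_⟩, hj0, hk0⟩
  by_cases hkj : k = j
  · rw [hkj, hj0]
  · exact (hk0 k hk hkj).le

/-- Near a point where only inequality j is tight, every direction of P on which h j is constant
stays in P. Hence the face h j = 0 spans the whole kernel of h j in the direction space, so it is a
facet. -/
theorem vectorSpan_facet {E J : Type*} [AddCommGroup E] [Module ℝ E] {P : Set E}
    {J₀ : Finset J} {h : J → E →ᵃ[ℝ] ℝ}
    (hP : ∀ x, x ∈ P ↔ x ∈ affineSpan ℝ P ∧ ∀ j ∈ J₀, 0 ≤ h j x) {j : J} {p : E}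
    (hp : p ∈ P) (hpj : h j p = 0) (hpk : ∀ k ∈ J₀, k ≠ j → 0 < h k p) {w : E}
    (hw : w ∈ vectorSpan ℝ P) (hwj : (h j).linear w = 0) :
    ∃ ε : ℝ, 0 < ε ∧ p + ε • w ∈ {x | x ∈ P ∧ h j x = 0} := by
  obtain ⟨ε, hε, h1⟩ := exists_small_affine_step (fun k : J₀ => h k) p w
    (fun k => ((hP p).1 hp).2 k k.2) (fun k hk => hpk k k.2 fun hkj => hk (by rw [hkj, hwj]))
  refine ⟨ε, hε, (hP _).2 ⟨add_smul_mem_affineSpan (subset_affineSpan ℝ P hp) hw ε,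
    fun k hk => h1 ε (abs_of_pos hε).le ⟨k, hk⟩⟩, ?_⟩
  rw [AffineMap.apply_add_smul, hpj, hwj, mul_zero, add_zero]

/-- A facet inequality of a compressed polytope that is primitive on the lattice has width one. -/
theorem IsCompressed.le_one {ι : Type*} [Finite ι] {J : Type*} {P : Set (ι → ℝ)}
    (hc : IsCompressed P) {J₀ : Finset J} {h : J → (ι → ℝ) →ᵃ[ℝ] ℝ}
    (hP : ∀ x, x ∈ P ↔ x ∈ affineSpan ℝ P ∧ ∀ j ∈ J₀, 0 ≤ h j x) {j : J} (hj : j ∈ J₀) {p : ι → ℝ}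
    (hp : p ∈ P) (hpj : h j p = 0) (hpk : ∀ k ∈ J₀, k ≠ j → 0 < h k p)
    (hint : ∀ x ∈ latticePoints ι, ∃ z : ℤ, (z : ℝ) = h j x)
    {u : ι → ℝ} (hu : u ∈ vectorSpan ℝ P) (hul : u ∈ latticePoints ι)
    (huj : (h j).linear u = 1) : ∀ x ∈ P, h j x ≤ 1 := by
  have := Fintype.ofFinite ι
  set F : Set (ι → ℝ) := {x | x ∈ P ∧ h j x = 0} with hF
  have hpF : p ∈ F := ⟨hp, hpj⟩
  have hspan : vectorSpan ℝ F = vectorSpan ℝ P ⊓ LinearMap.ker (h j).linear := by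
    refine le_antisymm (le_inf (vectorSpan_mono ℝ fun x hx => hx.1) ?_) ?_
    · rw [vectorSpan_def, Submodule.span_le]
      rintro _ ⟨x, hx, y, hy, rfl⟩
      change (h j).linear (x -ᵥ y) = 0
      rw [AffineMap.linearMap_vsub, hx.2, hy.2]
      simp
    · rintro w ⟨hw, hwj⟩
      obtain ⟨ε, hε, h1⟩ := vectorSpan_facet hP hp hpj hpk hw hwj
      exact mem_vectorSpan_of_step hε.ne' hpF h1
  have hfacet : IsFacet P F := by
    refine ⟨⟨p, hpF⟩, fun _ => ?_, ?_⟩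
    · refine ⟨-LinearMap.toContinuousLinearMap (h j).linear, ?_⟩
      have key : ∀ x, h j x = (h j).linear x + h j 0 := fun x => congrFun (AffineMap.decomp (h j)) x
      ext x
      constructor
      · rintro ⟨hx, hx0⟩
        refine ⟨hx, fun y hy => ?_⟩
        have h1 := ((hP y).1 hy).2 j hj
        have h2 := key x
        have h3 := key y
        simp only [neg_apply, LinearMap.coe_toContinuousLinearMap']
        linarith
      · rintro ⟨hx, hx'⟩
        refine ⟨hx, ?_⟩
        have h1 := hx' p hp
        have h2 := key x
        have h3 := key p
        have h4 := ((hP x).1 hx).2 j hj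
        simp only [neg_apply, LinearMap.coe_toContinuousLinearMap'] at h1
        linarith
    · unfold polytopeDim
      rw [hspan]
      exact finrank_inf_ker _ _ hu (by rw [huj]; exact one_ne_zero)
  obtain ⟨g, hg1, hg2, hg3⟩ := hc.2 F hfacet
  have hpA := subset_affineSpan ℝ P hp
  -- Both g and h j vanish on the facet, so they are proportional on the affine span. The factor is
  -- read off at the direction u, where h j has slope one.
  have hgh : ∀ x ∈ affineSpan ℝ P, g x = g.linear u * h j x := by
    intro x hx
    have hxp : x - p ∈ vectorSpan ℝ P := by
      rw [← direction_affineSpan]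
      exact AffineSubspace.vsub_mem_direction hx hpA
    have hlin : (h j).linear (x - p) = h j x := by
      have := AffineMap.linearMap_vsub (h j) x p
      simpa [hpj] using this
    have hglin : g.linear (x - p) = g x := by
      have := AffineMap.linearMap_vsub g x p
      simpa [hg2 p hpF] using this
    have hmem : (x - p) - h j x • u ∈ vectorSpan ℝ F := by
      rw [hspan]
      refine ⟨Submodule.sub_mem _ hxp (Submodule.smul_mem _ _ hu), ?_⟩
      simp [hlin, huj]
    have hvan : vectorSpan ℝ F ≤ LinearMap.ker g.linear := by
      rw [vectorSpan_def, Submodule.span_le]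
      rintro _ ⟨x, hx, y, hy, rfl⟩
      change g.linear (x -ᵥ y) = 0
      rw [AffineMap.linearMap_vsub, hg2 x hx, hg2 y hy]
      simp
    have := hvan hmem
    simp only [LinearMap.mem_ker, map_sub, map_smul, smul_eq_mul] at this
    have h5 : g.linear x - g.linear p = g x := by rw [← map_sub, hglin]
    linarith
  have hex : ∀ n : ℤ, ∃ x ∈ (affineSpan ℝ P : Set (ι → ℝ)) ∩ latticePoints ι, g x = n := by
    intro n
    have : (n : ℝ) ∈ Set.range (Int.cast : ℤ → ℝ) := ⟨n, rfl⟩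
    rw [← hg1] at this
    obtain ⟨x, hx, hx'⟩ := this
    exact ⟨x, hx, hx'⟩
  obtain ⟨q, ⟨hqA, hql⟩, hq⟩ := hex 1
  have hqu : ∃ m : ℤ, (m : ℝ) = g.linear u := by
    have h1 : q + (1 : ℝ) • u ∈ (affineSpan ℝ P : Set (ι → ℝ)) ∩ latticePoints ι :=
      ⟨add_smul_mem_affineSpan hqA hu 1, by
        rw [one_smul]
        exact latticePoints_add hql hul⟩
    have h2 : g (q + (1 : ℝ) • u) ∈ Set.range (Int.cast : ℤ → ℝ) := by
      rw [← hg1]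
      exact ⟨_, h1, rfl⟩
    obtain ⟨m, hm⟩ := h2
    rw [AffineMap.apply_add_smul, hq] at hm
    exact ⟨m - 1, by push_cast at hm ⊢; linarith⟩
  obtain ⟨m, hm⟩ := hqu
  obtain ⟨k, hk⟩ := hint q hql
  -- At a lattice point q with g q = 1, the factor m and the value k = h j q are integers with
  -- product one. So h j is g or -g, and the bounds on g apply.
  have hmk : m * k = 1 := by
    have := hgh q hqA
    rw [hq, ← hm, ← hk] at this
    exact_mod_cast this.symm
  intro x hx
  have h1 := hgh x (subset_affineSpan ℝ P hx)
  have h2 := hg3 x hx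
  have h3 := ((hP x).1 hx).2 j hj
  rw [← hm] at h1
  rcases Int.eq_one_or_neg_one_of_mul_eq_one hmk with rfl | rfl
  · push_cast at h1
    linarith
  · push_cast at h1
    linarith

/-- Functionals with trivial common kernel on a subspace contain a basis of its dual. -/
theorem exists_dual_basis {E J : Type*} [AddCommGroup E] [Module ℝ E] (W : Submodule ℝ E)
    (f : J → E →ₗ[ℝ] ℝ) (J₁ : Finset J) (hker : ∀ w ∈ W, (∀ j ∈ J₁, f j w = 0) → w = 0) :
    ∃ (b : Fin (Module.finrank ℝ W) → J) (e : Fin (Module.finrank ℝ W) → E),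
      (∀ i, b i ∈ J₁) ∧ (∀ i, e i ∈ W) ∧ (∀ i k, f (b k) (e i) = if i = k then 1 else 0) ∧
      ∀ w ∈ W, w = ∑ i, f (b i) w • e i := by
  classical
  induction J₁ using Finset.strongInduction with
  | H J₁ ih =>
    -- Pass to a minimal family that still separates W. Dropping any j from it leaves a nonzero
    -- vector killed by all the others; scaled to value one at j, these vectors form the dual basis.
    by_cases hred : ∃ j ∈ J₁, ∀ w ∈ W, (∀ k ∈ J₁.erase j, f k w = 0) → w = 0
    · obtain ⟨j, hj, hj'⟩ := hred
      obtain ⟨b, e, h1, h2⟩ := ih (J₁.erase j) (Finset.erase_ssubset hj) hj'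
      exact ⟨b, e, fun i => Finset.mem_of_mem_erase (h1 i), h2⟩
    · push Not at hred
      have hex : ∀ j : J₁, ∃ w ∈ W, ∀ k : J₁, f k w = if j = k then 1 else 0 := by
        intro j
        obtain ⟨w, hw, hk, hw0⟩ := hred j j.2
        have hj : f j w ≠ 0 := by
          intro h0
          refine hw0 (hker w hw fun k hk' => ?_)
          by_cases hkj : k = j
          · rw [hkj, h0]
          · exact hk k (Finset.mem_erase.2 ⟨hkj, hk'⟩)
        refine ⟨(f j w)⁻¹ • w, W.smul_mem _ hw, fun k => ?_⟩
        rw [map_smul, smul_eq_mul]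
        split_ifs with hjk
        · rw [← hjk, inv_mul_cancel₀ hj]
        · rw [hk k (Finset.mem_erase.2 ⟨fun h => hjk (Subtype.ext h.symm), k.2⟩), mul_zero]
      choose e he hfe using hex
      have hrep : ∀ w ∈ W, w = ∑ j : J₁, f j w • e j := by
        intro w hw
        rw [← sub_eq_zero]
        refine hker _ (W.sub_mem hw (W.sum_mem fun j _ => W.smul_mem _ (he j))) fun k hk => ?_
        rw [map_sub, map_sum]
        simp only [map_smul, smul_eq_mul]
        rw [Finset.sum_congr rfl fun j _ => by rw [hfe j ⟨k, hk⟩]]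
        simp
      let Φ : W ≃ₗ[ℝ] (J₁ → ℝ) :=
        { toFun := fun w j => f j w
          map_add' := fun x y => by ext j; simp
          map_smul' := fun c x => by ext j; simp
          invFun := fun y => ⟨∑ j, y j • e j, W.sum_mem fun j _ => W.smul_mem _ (he j)⟩
          left_inv := fun w => Subtype.ext (hrep w w.2).symm
          right_inv := fun y => by
            ext k
            simp only [map_sum, map_smul, smul_eq_mul]
            rw [Finset.sum_congr rfl fun j _ => by rw [hfe j k]]
            simp }
      have hcard : Fintype.card (Fin (Module.finrank ℝ W)) = Fintype.card J₁ := by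
        rw [Φ.finrank_eq]
        simp
      let σ := Fintype.equivOfCardEq hcard
      refine ⟨fun i => σ i, fun i => e (σ i), fun i => (σ i).2, fun i => he _, fun i k => ?_,
        fun w hw => ?_⟩
      · rw [hfe]
        simp
      · conv_lhs => rw [hrep w hw]
        exact (Equiv.sum_comp σ fun j : J₁ => f j w • e j).symm

/-! ### Normal form of compressed polytopes with a unimodular lattice of directions -/

/-- The polytope of all points on which the given integral functionals lie between `0` and `1`. -/
def rowPolytope {d : ℕ} (R : Set (Fin d → ℤ)) : Set (Fin d → ℝ) :=
  {y | ∀ r ∈ R, 0 ≤ ∑ i, (r i : ℝ) * y i ∧ ∑ i, (r i : ℝ) * y i ≤ 1}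

/-- Every nonzero integral vector can be replaced by a nonzero one of smaller support on which all
functionals take values in `{-1, 0, 1}`, and vanish where they vanished before. -/
def IsUnimodularRows {d : ℕ} (R : Set (Fin d → ℤ)) : Prop :=
  ∀ y : Fin d → ℤ, y ≠ 0 → ∃ u : Fin d → ℤ, u ≠ 0 ∧ (∀ i, y i = 0 → u i = 0) ∧
    ∀ r ∈ R, (-1 ≤ ∑ i, r i * u i ∧ ∑ i, r i * u i ≤ 1) ∧
      (∑ i, r i * y i = 0 → ∑ i, r i * u i = 0)

/-- Every direction can be replaced by an integral one of smaller support with coordinates in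
`{-1, 0, 1}`. -/
def IsUnimodularSubspace {ι : Type*} (W : Submodule ℝ (ι → ℝ)) : Prop :=
  ∀ w ∈ W, w ≠ 0 → ∃ z : ι → ℤ, latticePoint z ∈ W ∧ z ≠ 0 ∧ (∀ a, -1 ≤ z a ∧ z a ≤ 1) ∧
    ∀ a, w a = 0 → z a = 0

/-- The affine function `x ↦ s * x a + k`. -/
def coordinateBound {ι : Type*} (a : ι) (s k : ℤ) : (ι → ℝ) →ᵃ[ℝ] ℝ :=
  ((s : ℝ) • LinearMap.proj (R := ℝ) (φ := fun _ : ι => ℝ) a).toAffineMap +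
    AffineMap.const ℝ (ι → ℝ) (k : ℝ)

theorem coordinateBound_apply {ι : Type*} (a : ι) (s k : ℤ) (x : ι → ℝ) :
    coordinateBound a s k x = s * x a + k := by
  simp [coordinateBound]

theorem coordinateBound_linear {ι : Type*} (a : ι) (s k : ℤ) (x : ι → ℝ) :
    (coordinateBound a s k).linear x = s * x a := by
  simp [coordinateBound]

/-- The hypothesis `huniq` says that e is determined up to scaling by its support. The {-1, 0,
1}-vector of W inside that support is therefore a multiple of e, and the entry ±1 at b forces the
factor to be ±1. -/
theorem IsUnimodularSubspace.exists_int {ι : Type*} {W : Submodule ℝ (ι → ℝ)}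
    (hT : IsUnimodularSubspace W) {e : ι → ℝ} (he : e ∈ W) {b : ι} (hb : e b = 1 ∨ e b = -1)
    (huniq : ∀ z ∈ W, (∀ a, e a = 0 → z a = 0) → ∃ t : ℝ, z = t • e) :
    ∃ z : ι → ℤ, e = latticePoint z ∧ ∀ a, -1 ≤ z a ∧ z a ≤ 1 := by
  have he0 : e ≠ 0 := by
    rintro rfl
    simp at hb
  obtain ⟨z, hz, hz0, hz1, hz2⟩ := hT e he he0
  obtain ⟨t, ht⟩ := huniq _ hz fun a ha => by simp [latticePoint, hz2 a ha]
  have hzb : (z b : ℝ) = t * e b := congrFun ht b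
  have ht0 : t ≠ 0 := by
    rintro rfl
    refine hz0 (latticePoint_injective ?_)
    rw [ht]
    ext
    simp [latticePoint]
  have hzb0 : z b ≠ 0 := by
    intro h
    rw [h] at hzb
    rcases hb with hb | hb <;> rw [hb] at hzb <;> simp at hzb <;> exact ht0 (by linarith)
  have ht1 : t = 1 ∨ t = -1 := by
    have h1 : z b = 1 ∨ z b = -1 := by have := hz1 b; omega
    rcases h1 with h1 | h1 <;> rw [h1] at hzb <;> rcases hb with hb | hb <;> rw [hb] at hzb <;>
      push_cast at hzb
    · left; linarith
    · right; linarith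
    · right; linarith
    · left; linarith
  rcases ht1 with rfl | rfl
  · exact ⟨z, by rw [ht, one_smul], hz1⟩
  · refine ⟨-z, ?_, fun a => by have := hz1 a; simp only [Pi.neg_apply]; omega⟩
    have h1 : latticePoint (-z) = -latticePoint z := by
      ext
      simp [latticePoint]
    rw [h1, ht]
    simp

/-- In a basis of W dual to some of the coordinates, each vector is determined up to scaling by its
support, so it has entries in {-1, 0, 1}. Since w is a combination of them, one is nonzero at a,
hence ±1 there. -/
theorem IsUnimodularSubspace.exists_apply_eq {ι : Type*} [Finite ι] {W : Submodule ℝ (ι → ℝ)}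
    (hT : IsUnimodularSubspace W) {w : ι → ℝ} (hw : w ∈ W) {a : ι} (ha : w a ≠ 0) {s : ℤ}
    (hs : s = 1 ∨ s = -1) : ∃ u ∈ W, u ∈ latticePoints ι ∧ u a = s := by
  classical
  have := Fintype.ofFinite ι
  obtain ⟨b, e, -, he, hbe, hrep⟩ := exists_dual_basis W
    (fun a => LinearMap.proj (R := ℝ) (φ := fun _ : ι => ℝ) a) Finset.univ
    fun w _ h => funext fun a => h a (Finset.mem_univ a)
  simp only [LinearMap.proj_apply] at hbe hrep
  have hex : ∃ i, e i a ≠ 0 := by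
    by_contra hcon
    push Not at hcon
    refine ha ?_
    have := congrFun (hrep w hw) a
    rw [this]
    simp [hcon]
  obtain ⟨i, hi⟩ := hex
  obtain ⟨z, hz, hz1⟩ := hT.exists_int (he i) (b := b i) (Or.inl (by simp [hbe])) fun y hy hsupp => by
    refine ⟨y (b i), ?_⟩
    conv_lhs => rw [hrep y hy]
    refine Finset.sum_eq_single i (fun m _ hm => ?_) (by simp)
    rw [hsupp (b m) (by rw [hbe, if_neg hm.symm]), zero_smul]
  have hza : e i a = z a := congrFun hz a
  have hza0 : z a ≠ 0 := fun h => hi (by rw [hza, h, Int.cast_zero])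
  have h1 : z a = s ∨ z a = -s := by have := hz1 a; omega
  rcases h1 with h1 | h1
  · exact ⟨e i, he i, hz ▸ latticePoint_mem z, by rw [hza, h1]⟩
  · refine ⟨-e i, W.neg_mem (he i), ?_, by simp [hza, h1]⟩
    have := latticePoints_smul (hz ▸ latticePoint_mem z : e i ∈ latticePoints ι) (-1)
    simpa using this

/-- The coordinates are the inequalities of a basis among those tight at a vertex p₀, and the rows
are the irredundant inequalities written in these coordinates. The last conclusion records that each
coordinate hyperplane meets the polytope in a facet: a form c that vanishes on the intersection is a
multiple of the i-th coordinate. -/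
theorem exists_normalForm {ι J : Type*} [Finite ι] [Finite J] {P : Set (ι → ℝ)}
    (hc : IsCompressed P) (hne : P.Nonempty) (a : J → ι) (s k : J → ℤ)
    (hs : ∀ j, s j = 1 ∨ s j = -1)
    (hP : ∀ x, x ∈ P ↔ x ∈ affineSpan ℝ P ∧ ∀ j, 0 ≤ coordinateBound (a j) (s j) (k j) x)
    (hT : IsUnimodularSubspace (vectorSpan ℝ P)) :
    ∃ R : Set (Fin (polytopeDim P) → ℤ), (∀ i, Pi.single i 1 ∈ R) ∧
      (∀ r ∈ R, ∀ i, -1 ≤ r i ∧ r i ≤ 1) ∧ IsUnimodularRows R ∧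
      AreEquivalent P (rowPolytope R) ∧
      ∀ i, ∀ c : Fin (polytopeDim P) → ℤ,
        (∀ y ∈ rowPolytope R, y i = 0 → ∑ m, (c m : ℝ) * y m = 0) → ∀ m, m ≠ i → c m = 0 := by
  classical
  have := Fintype.ofFinite ι
  have := Fintype.ofFinite J
  set h : J → (ι → ℝ) →ᵃ[ℝ] ℝ := fun j => coordinateBound (a j) (s j) (k j) with hh
  have happ : ∀ j x, h j x = s j * x (a j) + k j := fun j x => coordinateBound_apply _ _ _ _
  have hlin : ∀ j x, (h j).linear x = s j * x (a j) := fun j x => coordinateBound_linear _ _ _ _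
  have hconv : Convex ℝ P := by
    obtain ⟨S, hS⟩ := hc.1
    rw [hS]
    exact convex_convexHull ℝ _
  obtain ⟨J₀, -, hJ1, hJ2⟩ := exists_irredundant (affineSpan ℝ P : Set (ι → ℝ))
    (fun j x => h j x) Finset.univ
  have hP0 : ∀ x, x ∈ P ↔ x ∈ affineSpan ℝ P ∧ ∀ j ∈ J₀, 0 ≤ h j x := fun x =>
    ⟨fun hx => ⟨((hP x).1 hx).1, fun j _ => ((hP x).1 hx).2 j⟩,
      fun hx => (hP x).2 ⟨hx.1, fun j => hJ1 x hx.1 hx.2 j (Finset.mem_univ j)⟩⟩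
  obtain ⟨z, hzP, hz⟩ := exists_interior hconv hne h fun j x hx => ((hP x).1 hx).2 j
  -- An inequality that vanishes on P vanishes on its affine span, so it could not be violated there
  -- at the point provided by irredundancy.
  have hzpos : ∀ j ∈ J₀, 0 < h j z := by
    intro j hj
    refine hz j ?_
    by_contra hcon
    push Not at hcon
    obtain ⟨x, hx, hx', -⟩ := hJ2 j hj
    have h1 : Set.EqOn (h j) (AffineMap.const ℝ _ 0) P := fun y hy =>
      le_antisymm (hcon y hy) (((hP y).1 hy).2 j)
    have h2 := AffineMap.eqOn_affineSpan h1 hx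
    simp only [AffineMap.const_apply] at h2
    linarith
  have hfp : ∀ j ∈ J₀, ∃ p ∈ P, h j p = 0 ∧ ∀ k ∈ J₀, k ≠ j → 0 < h k p := by
    intro j hj
    obtain ⟨x, hx, hxj, hxk⟩ := hJ2 j hj
    exact exists_facet_point hP0 hzP hzpos hj hx hxj hxk
  have hunit : ∀ j ∈ J₀, ∃ u ∈ vectorSpan ℝ P, u ∈ latticePoints ι ∧ (h j).linear u = 1 := by
    intro j hj
    obtain ⟨x, hx, hxj, -⟩ := hJ2 j hj
    have hw : z - x ∈ vectorSpan ℝ P := by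
      rw [← direction_affineSpan]
      exact AffineSubspace.vsub_mem_direction (subset_affineSpan ℝ P hzP) hx
    have hwa : (z - x) (a j) ≠ 0 := by
      intro h0
      have h1 := hzpos j hj
      simp only [Pi.sub_apply] at h0
      simp only [happ] at hxj h1
      rw [sub_eq_zero.1 h0] at h1
      linarith
    obtain ⟨u, hu, hul, hua⟩ := hT.exists_apply_eq hw hwa (hs j)
    refine ⟨u, hu, hul, ?_⟩
    rw [hlin, hua]
    rcases hs j with h1 | h1 <;> rw [h1] <;> norm_num
  -- Here compressedness enters; primitivity of h j is witnessed by the unit direction from `hunit`.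
  have hle : ∀ j ∈ J₀, ∀ x ∈ P, h j x ≤ 1 := by
    intro j hj
    obtain ⟨p, hp, hpj, hpk⟩ := hfp j hj
    obtain ⟨u, hu, hul, huj⟩ := hunit j hj
    refine hc.le_one hP0 hj hp hpj hpk ?_ hu hul huj
    rintro _ ⟨y, rfl⟩
    exact ⟨s j * y (a j) + k j, by rw [happ]; simp [latticePoint]⟩
  obtain ⟨p₀, hp₀⟩ : (P.extremePoints ℝ).Nonempty := by
    obtain ⟨S, hS⟩ := hc.1
    refine IsCompact.extremePoints_nonempty ?_ hne
    rw [hS]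
    exact ((Finset.finite_toSet S).image _).isCompact_convexHull ℝ
  have hp₀P : p₀ ∈ P := hp₀.1
  have hp₀l : p₀ ∈ latticePoints ι := by
    obtain ⟨S, hS⟩ := hc.1
    rw [hS] at hp₀
    obtain ⟨y, -, rfl⟩ := extremePoints_convexHull_subset hp₀
    exact latticePoint_mem y
  -- A direction killed by all tight inequalities could be followed both ways from p₀, contradicting
  -- extremality.
  have htight : ∀ w ∈ vectorSpan ℝ P, (∀ j ∈ J₀.filter fun j => h j p₀ = 0,
      (h j).linear w = 0) → w = 0 := by
    intro w hw hw0
    obtain ⟨ε, hε, hstep⟩ := exists_small_affine_step (fun j : J₀ => h j) p₀ w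
      (fun j => ((hP0 p₀).1 hp₀P).2 j j.2) (fun j hj => by
        refine lt_of_le_of_ne (((hP0 p₀).1 hp₀P).2 j j.2) fun h0 => hj (hw0 j ?_)
        exact Finset.mem_filter.2 ⟨j.2, h0.symm⟩)
    have hmem : ∀ t : ℝ, |t| ≤ ε → p₀ + t • w ∈ P := fun t ht =>
      (hP0 _).2 ⟨add_smul_mem_affineSpan (subset_affineSpan ℝ P hp₀P) hw t,
        fun j hj => hstep t ht ⟨j, hj⟩⟩
    have hseg : p₀ ∈ openSegment ℝ (p₀ + ε • w) (p₀ + (-ε) • w) := by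
      refine ⟨1 / 2, 1 / 2, by norm_num, by norm_num, by norm_num, ?_⟩
      ext i
      simp
      ring
    have h1 := hp₀.2 (hmem ε (abs_of_pos hε).le) (hmem (-ε) (by rw [abs_neg, abs_of_pos hε])) hseg
    rw [add_eq_left, smul_eq_zero] at h1
    exact h1.resolve_left hε.ne'
  have hbasis : ∃ (b : Fin (polytopeDim P) → J) (e : Fin (polytopeDim P) → ι → ℝ),
      (∀ i, b i ∈ J₀.filter fun j => h j p₀ = 0) ∧ (∀ i, e i ∈ vectorSpan ℝ P) ∧
      (∀ i k, (h (b k)).linear (e i) = if i = k then 1 else 0) ∧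
      ∀ w ∈ vectorSpan ℝ P, w = ∑ i, (h (b i)).linear w • e i :=
    exists_dual_basis (vectorSpan ℝ P) (fun j => (h j).linear) _ htight
  clear htight
  generalize polytopeDim P = d at *
  obtain ⟨b, e, hb, he, hbe, hrep⟩ := hbasis
  have hbJ : ∀ i, b i ∈ J₀ := fun i => (Finset.mem_filter.1 (hb i)).1
  have hb0 : ∀ i, h (b i) p₀ = 0 := fun i => (Finset.mem_filter.1 (hb i)).2
  -- A vector of W whose support lies in that of e i is killed by the other basis functionals, which
  -- are coordinates up to sign, so it is a multiple of e i.
  have hz : ∀ i, ∃ z : ι → ℤ, e i = latticePoint z ∧ ∀ a, -1 ≤ z a ∧ z a ≤ 1 := by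
    intro i
    refine hT.exists_int (he i) (b := a (b i)) ?_ fun y hy hsupp => ?_
    · have := hbe i i
      rw [hlin, if_pos rfl] at this
      rcases hs (b i) with h1 | h1 <;> rw [h1] at this <;> push_cast at this
      · left; linarith
      · right; linarith
    · refine ⟨(h (b i)).linear y, ?_⟩
      conv_lhs => rw [hrep y hy]
      refine Finset.sum_eq_single i (fun m _ hm => ?_) (by simp)
      have h1 := hbe i m
      rw [if_neg hm.symm, hlin, mul_eq_zero] at h1
      have h2 : (s (b m) : ℝ) ≠ 0 := by
        rcases hs (b m) with h | h <;> rw [h] <;> norm_num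
      rw [hlin, hsupp _ (h1.resolve_left h2), mul_zero, zero_smul]
  choose v hv hv1 using hz
  obtain ⟨q, hq⟩ := hp₀l
  set r : J → Fin d → ℤ := fun j i => s j * v i (a j) with hr
  have hrlin : ∀ j i, (h j).linear (e i) = r j i := by
    intro j i
    rw [hlin, hv]
    simp [hr, latticePoint]
  have hqv : ∀ j ∈ J₀, h j p₀ = 0 ∨ h j p₀ = 1 := by
    intro j hj
    have h1 := ((hP0 p₀).1 hp₀P).2 j hj
    have h2 := hle j hj p₀ hp₀P
    have h3 : h j p₀ = ((s j * q (a j) + k j : ℤ) : ℝ) := by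
      rw [happ, ← hq]
      simp [latticePoint]
    rw [h3] at h1 h2 ⊢
    norm_cast at h1 h2 ⊢
    omega
  -- At p₀ an inequality has value 0 or 1. With value 1 the range 0 ≤ 1 + r·y ≤ 1 is rewritten with
  -- -r, so that every row has the range [0, 1].
  set ρ : J → Fin d → ℤ := fun j => if h j p₀ = 0 then r j else -r j with hρ
  let ψ : (Fin d → ℝ) →ᵃ[ℝ] (ι → ℝ) := AffineMap.const ℝ _ p₀ +
    (∑ i, (LinearMap.proj (R := ℝ) (φ := fun _ : Fin d => ℝ) i).smulRight (e i)).toAffineMap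
  have hψ : ∀ y, ψ y = p₀ + ∑ i, y i • e i := by
    intro y
    simp [ψ]
  let π : (ι → ℝ) →ᵃ[ℝ] (Fin d → ℝ) := AffineMap.pi fun i => h (b i)
  have hπ : ∀ x i, π x i = h (b i) x := fun x i => rfl
  have hψW : ∀ y : Fin d → ℝ, ∑ i, y i • e i ∈ vectorSpan ℝ P := fun y =>
    Submodule.sum_mem _ fun i _ => Submodule.smul_mem _ _ (he i)
  have hlinsum : ∀ j (y : Fin d → ℝ), (h j).linear (∑ i, y i • e i) = ∑ i, (r j i : ℝ) * y i := by
    intro j y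
    rw [map_sum]
    exact Finset.sum_congr rfl fun i _ => by rw [map_smul, hrlin, smul_eq_mul, mul_comm]
  have hψh : ∀ j y, h j (ψ y) = h j p₀ + ∑ i, (r j i : ℝ) * y i := by
    intro j y
    have := (h j).apply_add_smul p₀ (∑ i, y i • e i) 1
    rw [one_smul, one_mul, hlinsum] at this
    rw [hψ, this]
  have hrb : ∀ i m, r (b i) m = if m = i then 1 else 0 := by
    intro i m
    have := hbe m i
    rw [hrlin] at this
    split_ifs at this ⊢ <;> exact_mod_cast this
  have hπψ : ∀ y, π (ψ y) = y := by
    intro y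
    ext i
    rw [hπ, hψh, hb0]
    simp [hrb]
  have hψA : ∀ y, ψ y ∈ affineSpan ℝ P := by
    intro y
    have := add_smul_mem_affineSpan (subset_affineSpan ℝ P hp₀P) (hψW y) 1
    rwa [one_smul, ← hψ] at this
  have hψπ : ∀ x ∈ P, ψ (π x) = x := by
    intro x hx
    have hw : x - p₀ ∈ vectorSpan ℝ P := vsub_mem_vectorSpan ℝ hx hp₀P
    have h1 : ∀ i, h (b i) x = (h (b i)).linear (x - p₀) := by
      intro i
      have := AffineMap.linearMap_vsub (h (b i)) x p₀
      simpa [hb0] using this.symm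
    rw [hψ]
    simp only [hπ, h1]
    rw [← hrep _ hw, add_sub_cancel]
  have hmem : ∀ y, y ∈ rowPolytope {x | ∃ j ∈ J₀, x = ρ j} ↔ ψ y ∈ P := by
    intro y
    rw [hP0]
    constructor
    · intro hy
      refine ⟨hψA y, fun j hj => ?_⟩
      have h1 := hy (ρ j) ⟨j, hj, rfl⟩
      rw [hψh]
      rcases hqv j hj with h2 | h2 <;> simp only [hρ, h2, if_true, one_ne_zero, if_false] at h1
      · rw [h2, zero_add]
        exact h1.1
      · simp only [Pi.neg_apply, Int.cast_neg, neg_mul, Finset.sum_neg_distrib] at h1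
        rw [h2]
        linarith [h1.2]
    · rintro ⟨hyA, hy⟩ _ ⟨j, hj, rfl⟩
      have h1 := hy j hj
      have h3 := hle j hj (ψ y) ((hP0 _).2 ⟨hyA, hy⟩)
      rw [hψh] at h1 h3
      rcases hqv j hj with h2 | h2 <;> simp only [hρ, h2, if_true, one_ne_zero, if_false] at h1 h3 ⊢
      · rw [zero_add] at h1 h3
        exact ⟨h1, h3⟩
      · simp only [Pi.neg_apply, Int.cast_neg, neg_mul, Finset.sum_neg_distrib]
        constructor <;> linarith
  refine ⟨{x | ∃ j ∈ J₀, x = ρ j}, fun i => ⟨b i, hbJ i, ?_⟩, ?_, ?_, ?_, ?_⟩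
  · ext m
    simp only [hρ, hb0, if_true, hrb, Pi.single_apply]
  · rintro _ ⟨j, -, rfl⟩ i
    have h1 := hv1 i (a j)
    simp only [hρ, hr]
    split_ifs <;> rcases hs j with h2 | h2 <;> simp only [h2, Pi.neg_apply] <;> omega
  · intro y hy
    -- Unimodularity of the rows is that of the direction space: up to sign, the values of the rows
    -- on y are coordinates of w.
    set w : ι → ℝ := ∑ i, ((y i : ℤ) : ℝ) • e i with hw
    have hwb : ∀ i, (h (b i)).linear w = y i := by
      intro i
      rw [hw, hlinsum]
      simp [hrb]
    have hw0 : w ≠ 0 := by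
      intro h0
      refine hy (funext fun i => ?_)
      have := hwb i
      rw [h0, map_zero] at this
      exact_mod_cast this.symm
    obtain ⟨z, hzW, hz0, hz1, hz2⟩ := hT w (hψW _) hw0
    set u : Fin d → ℤ := fun i => s (b i) * z (a (b i)) with hu
    have hub : ∀ i, (h (b i)).linear (latticePoint z) = u i := by
      intro i
      rw [hlin]
      simp [hu, latticePoint]
    have hzrep : latticePoint z = ∑ i, ((u i : ℤ) : ℝ) • e i := by
      conv_lhs => rw [hrep _ hzW]
      exact Finset.sum_congr rfl fun i _ => by rw [hub]
    have hru : ∀ j, ∑ i, r j i * u i = s j * z (a j) := by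
      intro j
      have h1 := hlinsum j fun i => ((u i : ℤ) : ℝ)
      rw [← hzrep, hlin] at h1
      simp only [latticePoint] at h1
      exact_mod_cast h1.symm
    have hry : ∀ j, ((∑ i, r j i * y i : ℤ) : ℝ) = s j * w (a j) := by
      intro j
      have h1 := hlinsum j fun i => ((y i : ℤ) : ℝ)
      rw [← hw, hlin] at h1
      rw [h1]
      push_cast
      rfl
    have hsne : ∀ j, (s j : ℝ) ≠ 0 := by
      intro j
      rcases hs j with h | h <;> rw [h] <;> norm_num
    refine ⟨u, ?_, fun i hi => ?_, ?_⟩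
    · intro h0
      refine hz0 (latticePoint_injective ?_)
      rw [hzrep, h0]
      ext
      simp [latticePoint]
    · have h1 := hwb i
      rw [hi, hlin, Int.cast_zero, mul_eq_zero] at h1
      simp only [hu]
      rw [hz2 _ (h1.resolve_left (hsne _)), mul_zero]
    · rintro _ ⟨j, -, rfl⟩
      have key : (-1 ≤ ∑ i, r j i * u i ∧ ∑ i, r j i * u i ≤ 1) ∧
          (∑ i, r j i * y i = 0 → ∑ i, r j i * u i = 0) := by
        rw [hru]
        refine ⟨?_, fun h0 => ?_⟩
        · have := hz1 (a j)
          rcases hs j with h | h <;> rw [h] <;> omega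
        · have h1 := hry j
          rw [h0, Int.cast_zero] at h1
          rw [hz2 _ ((mul_eq_zero.1 h1.symm).resolve_left (hsne _)), mul_zero]
      simp only [hρ]
      split_ifs
      · exact key
      · simp only [Pi.neg_apply, neg_mul, Finset.sum_neg_distrib, neg_eq_zero]
        exact ⟨by omega, key.2⟩
  · have h1 := areEquivalent_of_section ψ π ?_ ?_ hπψ (rowPolytope {x | ∃ j ∈ J₀, x = ρ j})
    · have h2 : ψ '' rowPolytope {x | ∃ j ∈ J₀, x = ρ j} = P := by
        ext x
        constructor
        · rintro ⟨y, hy, rfl⟩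
          exact (hmem y).1 hy
        · intro hx
          exact ⟨π x, (hmem _).2 (by rwa [hψπ x hx]), hψπ x hx⟩
      rw [h2] at h1
      exact h1.symm
    · rintro _ ⟨y, rfl⟩
      rw [hψ, ← hq]
      refine ⟨q + ∑ i, y i • v i, ?_⟩
      ext m
      simp [latticePoint, hv]
    · rintro _ ⟨x, rfl⟩
      refine ⟨fun i => s (b i) * x (a (b i)) + k (b i), ?_⟩
      ext i
      rw [hπ, happ]
      simp [latticePoint]
  · intro i c hcy m hm
    -- The form c vanishes at a point p of facet i with all other inequalities strict, and also at p
    -- + ε e m, which still lies on that facet. The difference is c m ε.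
    obtain ⟨p, hp, hpj, hpk⟩ := hfp (b i) (hbJ i)
    obtain ⟨ε, hε, hstep, hstep0⟩ := vectorSpan_facet hP0 hp hpj hpk (he m)
      (by rw [hbe, if_neg hm])
    have h1 := hcy (π p) ((hmem _).2 (by rwa [hψπ p hp])) hpj
    have h2 := hcy (π (p + ε • e m)) ((hmem _).2 (by rwa [hψπ _ hstep])) hstep0
    have h3 : ∀ l, π (p + ε • e m) l = π p l + if m = l then ε else 0 := by
      intro l
      rw [hπ, AffineMap.apply_add_smul, hbe, hπ]
      simp
    simp only [h3, mul_add, Finset.sum_add_distrib, h1, zero_add] at h2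
    simp only [mul_ite, mul_zero, Finset.sum_ite_eq, Finset.mem_univ, if_true, mul_eq_zero] at h2
    exact_mod_cast h2.resolve_right hε.ne'

/-! ### Flow polytopes satisfy the hypotheses of the normal form -/

namespace FlowQuiver

theorem affineSpan_le_flowSpace (Q : FlowQuiver) {θ : Fin Q.numVertices → ℤ}
    {P : Set (Fin Q.numArrows → ℝ)} (hP : P ⊆ Q.flowSpace θ) :
    ∀ x ∈ affineSpan ℝ P, x ∈ Q.flowSpace θ := by
  let A : AffineSubspace ℝ (Fin Q.numArrows → ℝ) :=
    { carrier := Q.flowSpace θ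
      smul_vsub_vadd_mem' := by
        intro c x y z hx hy hz
        have := Q.flowSpace_add_smul hz (Q.flowSpace_sub hx hy) c
        rwa [add_comm] at this }
  have h : affineSpan ℝ P ≤ A := affineSpan_le.2 hP
  exact fun x hx => h hx

/-- Tight bounds may make the affine span smaller than the flow space, so it is not enough to find a
unit circulation. Its support lies in that of a direction w of the polytope, and a point y with room
on all arrows of w can be moved along it; hence it is a direction of the polytope too. -/
theorem isUnimodularSubspace (Q : FlowQuiver) (θ : Fin Q.numVertices → ℤ)
    (l u : Fin Q.numArrows → ℕ) : IsUnimodularSubspace (vectorSpan ℝ (Q.boundedFlows θ l u)) := by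
  intro w hw hw0
  set P := Q.boundedFlows θ l u with hP
  rcases P.eq_empty_or_nonempty with hempty | hne
  · rw [hempty, vectorSpan_empty, Submodule.mem_bot] at hw
    exact absurd hw hw0
  have hconv : Convex ℝ P := by
    rw [hP, boundedFlows_eq_integralFlows]
    exact Q.convex_integralFlows _ _ _
  have hsub : P ⊆ Q.flowSpace θ := fun x hx => hx.1
  have hwflow : w ∈ Q.flowSpace 0 := by
    obtain ⟨p, hp⟩ := hne
    have h1 := add_smul_mem_affineSpan (subset_affineSpan ℝ P hp) hw 1
    have h2 := Q.flowSpace_sub (Q.affineSpan_le_flowSpace hsub _ h1) (hsub hp)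
    rwa [one_smul, add_sub_cancel_left] at h2
  obtain ⟨z, hz, hz0, hz1, hz2⟩ := Q.exists_unit_circulation hwflow hw0
  refine ⟨z, ?_, hz0, hz1, hz2⟩
  obtain ⟨y, hy, hy'⟩ := exists_interior hconv hne
    (fun j : Fin Q.numArrows × Bool =>
      cond j.2 (coordinateBound j.1 1 (-(l j.1 : ℤ))) (coordinateBound j.1 (-1) (u j.1)))
    (by
      rintro ⟨a, _ | _⟩ x hx <;> have := hx.2 a <;> simp [coordinateBound_apply] <;> linarith)
  have hstrict : ∀ a, w a ≠ 0 → (l a : ℝ) < y a ∧ y a < u a := by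
    intro a ha
    have hnc : ∃ x ∈ P, ∃ x' ∈ P, x a < x' a := by
      by_contra hcon
      push Not at hcon
      have h1 : vectorSpan ℝ P ≤
          LinearMap.ker (LinearMap.proj (R := ℝ) (φ := fun _ : Fin Q.numArrows => ℝ) a) := by
        rw [vectorSpan_def, Submodule.span_le]
        rintro _ ⟨x, hx, x', hx', rfl⟩
        have := le_antisymm (hcon x hx x' hx') (hcon x' hx' x hx)
        simp [this]
      exact ha (h1 hw)
    obtain ⟨x, hx, x', hx', hlt⟩ := hnc
    have h1 := hy' (a, true) ⟨x', hx', by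
      have := (hx.2 a).1
      simp [coordinateBound_apply]
      linarith⟩
    have h2 := hy' (a, false) ⟨x, hx, by
      have := (hx'.2 a).2
      simp [coordinateBound_apply]
      linarith⟩
    simp [coordinateBound_apply] at h1 h2
    constructor <;> linarith
  obtain ⟨ε, hε, hstep⟩ := exists_small_step y (latticePoint z) (fun a => (l a : ℝ))
    (fun a => (u a : ℝ)) (fun a ha => hstrict a fun h0 => ha (by simp [latticePoint, hz2 a h0]))
    hy.2
  exact mem_vectorSpan_of_step hε.ne' hy
    ⟨Q.flowSpace_add_smul hy.1 hz ε, hstep ε (abs_of_pos hε).le⟩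

end FlowQuiver

theorem IsFlowPolytope.exists_normalForm {ι : Type*} [Finite ι] {P : Set (ι → ℝ)}
    (hf : IsFlowPolytope P) (hc : IsCompressed P) (hne : P.Nonempty) :
    ∃ R : Set (Fin (polytopeDim P) → ℤ), (∀ i, Pi.single i 1 ∈ R) ∧
      (∀ r ∈ R, ∀ i, -1 ≤ r i ∧ r i ≤ 1) ∧ IsUnimodularRows R ∧
      AreEquivalent P (rowPolytope R) ∧
      ∀ i, ∀ c : Fin (polytopeDim P) → ℤ,
        (∀ y ∈ rowPolytope R, y i = 0 → ∑ m, (c m : ℝ) * y m = 0) → ∀ m, m ≠ i → c m = 0 := by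
  obtain ⟨Q, θ, l, u, hequiv⟩ := hf
  have hc' := hequiv.isCompressed hc
  have hne' : (Q.boundedFlows θ l u).Nonempty := by
    obtain ⟨φ, -, -, -, hφ⟩ := hequiv
    rw [← hφ]
    exact hne.image _
  -- Each arrow gives two inequalities: `true` stands for x a - l a ≥ 0 and `false` for u a - x a ≥
  -- 0.
  obtain ⟨R, h1, h2, h3, h4, h5⟩ := _root_.exists_normalForm hc' hne'
    (fun j : Fin Q.numArrows × Bool => j.1) (fun j => cond j.2 1 (-1))
    (fun j => cond j.2 (-(l j.1 : ℤ)) (u j.1)) (by rintro ⟨a, _ | _⟩ <;> simp) (fun x => by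
      constructor
      · intro hx
        refine ⟨subset_affineSpan ℝ _ hx, ?_⟩
        rintro ⟨a, _ | _⟩ <;> have := hx.2 a <;> simp [coordinateBound_apply] <;> linarith
      · rintro ⟨hx, hx'⟩
        refine ⟨Q.affineSpan_le_flowSpace (fun y hy => hy.1) x hx, fun a => ?_⟩
        have h1 := hx' (a, true)
        have h2 := hx' (a, false)
        simp [coordinateBound_apply] at h1 h2
        constructor <;> linarith) (Q.isUnimodularSubspace θ l u)
  rw [hequiv.polytopeDim_eq]
  exact ⟨R, h1, h2, h3, hequiv.trans h4, h5⟩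

/-! ### Sets of zero-one points as bit masks -/

/-- The zero-one vector with the binary digits of `x`. -/
def bitVec (d x : ℕ) : Fin d → ℤ := fun i => if x.testBit i then 1 else 0

/-- The convex hull of the zero-one vectors listed by the bits of `V`. -/
def maskHull (d V : ℕ) : Set (Fin d → ℝ) :=
  convexHull ℝ (latticePoint '' {z | ∃ x < 2 ^ d, V.testBit x = true ∧ z = bitVec d x})

/-- The number whose bits below `n` are the values of `f`. -/
def maskOf (f : ℕ → Bool) : ℕ → ℕ
  | 0 => 0
  | n + 1 => cond (f n) (2 ^ n) 0 ||| maskOf f n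

theorem testBit_maskOf (f : ℕ → Bool) (n x : ℕ) :
    (maskOf f n).testBit x = (decide (x < n) && f x) := by
  induction n with
  | zero => simp [maskOf]
  | succ n ih =>
    rw [maskOf, Nat.testBit_or, ih]
    rcases lt_trichotomy x n with h | rfl | h
    · cases f n <;> simp [h, h.ne', Nat.lt_succ_of_lt h]
    · cases f x <;> simp
    · have h1 : ¬ x < n := by omega
      have h2 : ¬ x < n + 1 := by omega
      cases f n <;> simp [h.ne, h1, h2]

theorem bitVec_mem (d x : ℕ) (i : Fin d) : bitVec d x i = 0 ∨ bitVec d x i = 1 := by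
  unfold bitVec
  split_ifs <;> simp

theorem exists_bitVec {d : ℕ} (z : Fin d → ℤ) (hz : ∀ i, z i = 0 ∨ z i = 1) :
    ∃ x < 2 ^ d, z = bitVec d x := by
  refine ⟨Nat.ofBits fun i => decide (z i = 1), Nat.ofBits_lt_two_pow _, ?_⟩
  ext i
  rw [bitVec, Nat.testBit_ofBits_lt _ _ i.2]
  rcases hz i with h | h <;> simp [h]

/-! ### Minors of unimodular systems of rows -/

theorem sum_mul_pair {d : ℕ} {u : Fin d → ℤ} {i j : Fin d} (hij : i ≠ j)
    (h : ∀ m, m ≠ i → m ≠ j → u m = 0) (r : Fin d → ℤ) :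
    ∑ m, r m * u m = r i * u i + r j * u j :=
  Fintype.sum_eq_add i j hij fun m hm => by rw [h m hm.1 hm.2, mul_zero]

theorem sum_mul_triple {d : ℕ} {u : Fin d → ℤ} {i j k : Fin d} (hij : i ≠ j) (hik : i ≠ k)
    (hjk : j ≠ k) (h : ∀ m, m ≠ i → m ≠ j → m ≠ k → u m = 0) (r : Fin d → ℤ) :
    ∑ m, r m * u m = r i * u i + r j * u j + r k * u k := by
  rw [← Finset.sum_subset (Finset.subset_univ {i, j, k}) fun m _ hm => ?_]
  · rw [Finset.sum_insert (by simp [hij, hik]), Finset.sum_pair hjk, add_assoc]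
  · simp only [Finset.mem_insert, Finset.mem_singleton, not_or] at hm
    rw [h m hm.1 hm.2.1 hm.2.2, mul_zero]

theorem abs_le_one_of_mul {u m t s : ℤ} (hu : u = 1 ∨ u = -1) (h : u * m = t * s)
    (ht : |t| ≤ 1) (hs : |s| ≤ 1) : |m| ≤ 1 := by
  have h1 : |m| = |t| * |s| := by
    rw [← abs_mul, ← h, abs_mul]
    rcases hu with rfl | rfl <;> simp
  rw [h1]
  exact mul_le_one₀ ht (abs_nonneg s) hs

variable {d : ℕ} {R : Set (Fin d → ℤ)}

/-- The vector y with entries b j and -b i at i and j is orthogonal to b, and the minor is a·y.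
Unimodularity replaces y by a vector u with entries in {-1, 0, 1}, parallel to it when b is nonzero
at i or j. So the minor is, up to sign, the product of an entry of y and a·u, each at most one in
absolute value. -/
theorem IsUnimodularRows.abs_minor_two (hR : IsUnimodularRows R) (he : ∀ i, Pi.single i 1 ∈ R)
    (hent : ∀ r ∈ R, ∀ i, -1 ≤ r i ∧ r i ≤ 1) {a b : Fin d → ℤ} (ha : a ∈ R) (hb : b ∈ R)
    (i j : Fin d) : |a i * b j - a j * b i| ≤ 1 := by
  by_cases hij : i = j
  · subst hij
    simp
  set y : Fin d → ℤ := fun m => if m = i then b j else if m = j then -b i else 0 with hy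
  have hyi : y i = b j := by simp [hy]
  have hyj : y j = -b i := by simp [hy, Ne.symm hij]
  have hy0 : ∀ m, m ≠ i → m ≠ j → y m = 0 := fun m h1 h2 => by simp [hy, h1, h2]
  by_cases hyz : y = 0
  · have h1 := congrFun hyz i
    have h2 := congrFun hyz j
    rw [hyi] at h1
    rw [hyj] at h2
    simp only [Pi.zero_apply, neg_eq_zero] at h1 h2
    simp [h1, h2]
  obtain ⟨u, hu0, hus, hur⟩ := hR y hyz
  have husupp : ∀ m, m ≠ i → m ≠ j → u m = 0 := fun m h1 h2 => hus m (hy0 m h1 h2)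
  have hbu := (hur b hb).2 (by rw [sum_mul_pair hij hy0, hyi, hyj]; ring)
  have hau := (hur a ha).1
  rw [sum_mul_pair hij husupp] at hbu hau
  have hu1 : ∀ m, -1 ≤ u m ∧ u m ≤ 1 := fun m => by
    have := (hur _ (he m)).1
    simpa [Pi.single_apply] using this
  have hbent := hent b hb
  by_cases hui : u i = 0
  · have huj : u j ≠ 0 := by
      intro huj
      refine hu0 (funext fun m => ?_)
      by_cases h1 : m = i
      · rw [h1, hui]; rfl
      by_cases h2 : m = j
      · rw [h2, huj]; rfl
      exact husupp m h1 h2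
    refine abs_le_one_of_mul (u := u j) (t := -b i) (s := a i * u i + a j * u j) ?_ ?_ ?_ ?_
    · have := hu1 j; omega
    · linear_combination a i * hbu
    · rw [abs_neg]; exact abs_le.2 (hbent i)
    · exact abs_le.2 hau
  · refine abs_le_one_of_mul (u := u i) (t := b j) (s := a i * u i + a j * u j) ?_ ?_ ?_ ?_
    · have := hu1 i; omega
    · linear_combination -a j * hbu
    · exact abs_le.2 (hbent j)
    · exact abs_le.2 hau

/-- A minor of order three. -/
def minorThree {d : ℕ} (a b c : Fin d → ℤ) (i j k : Fin d) : ℤ :=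
  a i * (b j * c k - b k * c j) + a j * (b k * c i - b i * c k) + a k * (b i * c j - b j * c i)

/-- The same argument with y the cross product of b and c. Its entries are minors of order two,
already bounded, and the replacement u is orthogonal to b and c, hence parallel to y. -/
theorem IsUnimodularRows.abs_minorThree (hR : IsUnimodularRows R) (he : ∀ i, Pi.single i 1 ∈ R)
    (hent : ∀ r ∈ R, ∀ i, -1 ≤ r i ∧ r i ≤ 1) {a b c : Fin d → ℤ} (ha : a ∈ R) (hb : b ∈ R)
    (hc : c ∈ R) (i j k : Fin d) : |minorThree a b c i j k| ≤ 1 := by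
  unfold minorThree
  by_cases hij : i = j
  · subst hij
    ring_nf
    simp
  by_cases hik : i = k
  · subst hik
    ring_nf
    simp
  by_cases hjk : j = k
  · subst hjk
    ring_nf
    simp
  set y : Fin d → ℤ := fun m => if m = i then b j * c k - b k * c j else
    if m = j then b k * c i - b i * c k else if m = k then b i * c j - b j * c i else 0 with hy
  have hyi : y i = b j * c k - b k * c j := by simp [hy]
  have hyj : y j = b k * c i - b i * c k := by simp [hy, Ne.symm hij]
  have hyk : y k = b i * c j - b j * c i := by simp [hy, Ne.symm hik, Ne.symm hjk]
  have hy0 : ∀ m, m ≠ i → m ≠ j → m ≠ k → y m = 0 := fun m h1 h2 h3 => by simp [hy, h1, h2, h3]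
  rw [← hyi, ← hyj, ← hyk]
  by_cases hyz : y = 0
  · simp [hyz]
  have hy1 : ∀ m, |y m| ≤ 1 := by
    intro m
    by_cases h1 : m = i
    · rw [h1, hyi]
      exact hR.abs_minor_two he hent hb hc j k
    by_cases h2 : m = j
    · rw [h2, hyj]
      exact hR.abs_minor_two he hent hb hc k i
    by_cases h3 : m = k
    · rw [h3, hyk]
      exact hR.abs_minor_two he hent hb hc i j
    simp [hy0 m h1 h2 h3]
  obtain ⟨u, hu0, hus, hur⟩ := hR y hyz
  have husupp : ∀ m, m ≠ i → m ≠ j → m ≠ k → u m = 0 := fun m h1 h2 h3 => hus m (hy0 m h1 h2 h3)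
  have hbu := (hur b hb).2 (by rw [sum_mul_triple hij hik hjk hy0, hyi, hyj, hyk]; ring)
  have hcu := (hur c hc).2 (by rw [sum_mul_triple hij hik hjk hy0, hyi, hyj, hyk]; ring)
  have hau := (hur a ha).1
  rw [sum_mul_triple hij hik hjk husupp] at hbu hcu hau
  have hu1 : ∀ m, -1 ≤ u m ∧ u m ≤ 1 := fun m => by
    have := (hur _ (he m)).1
    simpa [Pi.single_apply] using this
  -- Orthogonality of u to b and c makes u parallel to their cross product.
  have hxij : y i * u j = y j * u i := by
    rw [hyi, hyj]
    linear_combination c k * hbu - b k * hcu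
  have hxjk : y j * u k = y k * u j := by
    rw [hyj, hyk]
    linear_combination c i * hbu - b i * hcu
  have hxik : y i * u k = y k * u i := by
    rw [hyi, hyk]
    linear_combination -c j * hbu + b j * hcu
  obtain ⟨m, hm, hmul⟩ : ∃ m, (u m = 1 ∨ u m = -1) ∧
      u m * (a i * y i + a j * y j + a k * y k) = y m * (a i * u i + a j * u j + a k * u k) := by
    by_cases h1 : u i = 0
    · by_cases h2 : u j = 0
      · have h3 : u k ≠ 0 := by
          intro h3
          refine hu0 (funext fun m => ?_)
          by_cases h4 : m = i
          · rw [h4, h1]; rfl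
          by_cases h5 : m = j
          · rw [h5, h2]; rfl
          by_cases h6 : m = k
          · rw [h6, h3]; rfl
          exact husupp m h4 h5 h6
        exact ⟨k, by have := hu1 k; omega, by linear_combination a i * hxik + a j * hxjk⟩
      · exact ⟨j, by have := hu1 j; omega, by linear_combination a i * hxij - a k * hxjk⟩
    · exact ⟨i, by have := hu1 i; omega, by linear_combination -a j * hxij - a k * hxik⟩
  exact abs_le_one_of_mul hm hmul (hy1 m) (abs_le.2 hau)

/-! ### The search through all unimodular systems of rows -/

/-- The vector with entries in `{-1, 0, 1}` given by the sets of its positive and negative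
entries. -/
def codeVec (d : ℕ) (p n : ℕ) : Fin d → ℤ := fun i => bitVec d p i - bitVec d n i

def dotBits (d : ℕ) (p n x : ℕ) : ℤ := ∑ i, codeVec d p n i * bitVec d x i

/-- A row, together with the set of zero-one points at which it takes a value in `{0, 1}`. -/
structure Slab where
  pos : ℕ
  neg : ℕ
  mask : ℕ

def slabMask (d p n : ℕ) : ℕ :=
  maskOf (fun x => decide (dotBits d p n x = 0) || decide (dotBits d p n x = 1)) (2 ^ d)

/-- All codes of nonzero rows. -/
def codes (d : ℕ) : List (ℕ × ℕ) :=
  ((List.range (2 ^ d)).product (List.range (2 ^ d))).filter fun c =>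
    (c.1 &&& c.2 == 0) && (c.1 ||| c.2 != 0)

def slabs (d : ℕ) : List Slab := (codes d).map fun c => ⟨c.1, c.2, slabMask d c.1 c.2⟩

/-- Zero-one points on the coordinate hyperplane `i` outside of the kernel of a row. -/
def facetTests (d : ℕ) : List ℕ :=
  (List.finRange d).flatMap fun i : Fin d =>
    -- The condition `c.2 ≤ c.1` keeps one of a row and its negative, which have the same kernel.
    ((codes d).filter fun c => decide (c.2 ≤ c.1) && !c.1.testBit i && !c.2.testBit i).map fun c =>
      maskOf (fun x => !x.testBit i && !decide (dotBits d c.1 c.2 x = 0)) (2 ^ d)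

/-- Every coordinate hyperplane contains points of `V` outside of every test hyperplane. -/
def isFull (tests : List ℕ) (V : ℕ) : Bool := tests.all fun t => V &&& t != 0

/-- All minors of order two of the two rows are in `{-1, 0, 1}`. -/
def compat (a b : Slab) : Bool :=
  -- For entries in {-1, 0, 1}, a minor of order two is ±2 exactly when the rows agree at one common
  -- nonzero position and are opposite at the other.
  ((a.pos &&& b.pos ||| a.neg &&& b.neg) == 0) || ((a.pos &&& b.neg ||| a.neg &&& b.pos) == 0)

def badTriple (d : ℕ) (a b c : Slab) : Bool :=
  (List.finRange d).any fun i => (List.finRange d).any fun j => (List.finRange d).any fun k =>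
    decide (2 ≤ (minorThree (codeVec d a.pos a.neg) (codeVec d b.pos b.neg)
      (codeVec d c.pos c.neg) i j k).natAbs)

/-- Some minor of order three of the rows is not in `{-1, 0, 1}`. -/
def hasBadTriple (d : ℕ) : List Slab → Bool
  | [] => false
  | a :: l => hasBadTriple d l || (l.any fun b => l.any fun c => badTriple d a b c)

/-- Search through all sets of rows: `cands` are the rows still available, `ch` are the rows chosen
so far, which cut out the set `V`. -/
def search (d : ℕ) (tests : List ℕ) (good : ℕ → Bool) : ℕ → List Slab → List Slab → ℕ → Bool
  | _, [], ch, V => good V || hasBadTriple d ch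
  -- Running out of fuel counts as failure, so the fuel need not be justified.
  | 0, _ :: _, _, _ => false
  -- The row c is either left out or chosen. In the second case only rows survive that are
  -- compatible with c, cut V further, and leave enough points for the facets.
  | n + 1, c :: cs, ch, V => search d tests good n cs ch V && search d tests good n
      (cs.filter fun s => compat c s && !(V &&& c.mask &&& s.mask == V &&& c.mask) &&
        isFull tests (V &&& c.mask &&& s.mask)) (c :: ch) (V &&& c.mask)

/-- The search from all rows. -/
def runSearch (d : ℕ) (good : ℕ → Bool) : Bool :=
  -- Rows whose slab contains the whole cube, such as the unit rows, cut nothing and are dropped.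
  search d (facetTests d) good (3 ^ d) ((slabs d).filter fun s =>
    !(s.mask == 2 ^ 2 ^ d - 1) && isFull (facetTests d) s.mask) [] (2 ^ 2 ^ d - 1)

def Slab.vec (d : ℕ) (s : Slab) : Fin d → ℤ := codeVec d s.pos s.neg

theorem exists_slab {d : ℕ} (r : Fin d → ℤ) (hr : ∀ i, -1 ≤ r i ∧ r i ≤ 1) (h0 : r ≠ 0) :
    ∃ s ∈ slabs d, s.vec d = r := by
  obtain ⟨p, hp, hp'⟩ := exists_bitVec (fun i => if r i = 1 then 1 else 0)
    (fun i => by split_ifs <;> simp)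
  obtain ⟨n, hn, hn'⟩ := exists_bitVec (fun i => if r i = -1 then 1 else 0)
    (fun i => by split_ifs <;> simp)
  have hpi : ∀ i : Fin d, p.testBit i = decide (r i = 1) := by
    intro i
    have := congrFun hp' i
    simp only [bitVec] at this
    split_ifs at this <;> simp_all
  have hni : ∀ i : Fin d, n.testBit i = decide (r i = -1) := by
    intro i
    have := congrFun hn' i
    simp only [bitVec] at this
    split_ifs at this <;> simp_all
  have hvec : codeVec d p n = r := by
    ext i
    have := hr i
    simp only [codeVec, bitVec, hpi, hni, decide_eq_true_eq]
    split_ifs <;> omega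
  refine ⟨⟨p, n, slabMask d p n⟩, ?_, hvec⟩
  refine List.mem_map.2 ⟨(p, n), List.mem_filter.2 ⟨?_, ?_⟩, rfl⟩
  · exact List.mem_product.2 ⟨List.mem_range.2 hp, List.mem_range.2 hn⟩
  · simp only [Bool.and_eq_true, beq_iff_eq, bne_iff_ne, ne_eq]
    constructor
    · refine Nat.eq_of_testBit_eq fun i => ?_
      rw [Nat.testBit_and, Nat.zero_testBit]
      by_cases hi : i < d
      · have h1 := hpi ⟨i, hi⟩
        have h2 := hni ⟨i, hi⟩
        simp only at h1 h2
        rw [h1, h2]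
        by_cases h : r ⟨i, hi⟩ = 1 <;> simp [h]
      · rw [Nat.testBit_lt_two_pow (hp.trans_le (Nat.pow_le_pow_right (by norm_num) (by omega)))]
        simp
    · intro h
      refine h0 ?_
      rw [← hvec]
      have h1 : ∀ i, p.testBit i = false ∧ n.testBit i = false := by
        intro i
        have := congrArg (fun m => m.testBit i) h
        simpa using this
      ext i
      simp [codeVec, bitVec, h1]

theorem testBit_slabMask (d p n x : ℕ) : (slabMask d p n).testBit x = true ↔
    x < 2 ^ d ∧ (0 ≤ dotBits d p n x ∧ dotBits d p n x ≤ 1) := by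
  rw [slabMask, testBit_maskOf]
  simp only [Bool.and_eq_true, decide_eq_true_eq, Bool.or_eq_true]
  refine and_congr_right fun _ => ⟨fun h => by omega, fun h => by omega⟩

/-- An incompatible pair agrees at some position i and is opposite at some j, which produces a minor
±2. -/
theorem IsUnimodularRows.compat (hR : IsUnimodularRows R) (he : ∀ i, Pi.single i 1 ∈ R)
    (hent : ∀ r ∈ R, ∀ i, -1 ≤ r i ∧ r i ≤ 1) {a b : Slab} (ha : a ∈ slabs d) (hb : b ∈ slabs d)
    (haR : a.vec d ∈ R) (hbR : b.vec d ∈ R) : compat a b = true := by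
  by_contra hcon
  simp only [_root_.compat, Bool.or_eq_true, beq_iff_eq, not_or] at hcon
  have hlt : ∀ s ∈ slabs d, s.pos < 2 ^ d ∧ s.neg < 2 ^ d ∧ s.pos &&& s.neg = 0 := by
    intro s hs
    obtain ⟨c, hc, rfl⟩ := List.mem_map.1 hs
    obtain ⟨hc1, hc2⟩ := List.mem_filter.1 hc
    obtain ⟨h1, h2⟩ := List.mem_product.1 hc1
    simp only [Bool.and_eq_true, beq_iff_eq] at hc2
    exact ⟨List.mem_range.1 h1, List.mem_range.1 h2, hc2.1⟩
  obtain ⟨hap, han, ha0⟩ := hlt a ha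
  obtain ⟨hbp, hbn, hb0⟩ := hlt b hb
  have hex : ∀ m : ℕ, m ≠ 0 → m < 2 ^ d → ∃ i : Fin d, m.testBit i = true := by
    intro m hm hm'
    obtain ⟨i, hi⟩ := Nat.exists_testBit_of_ne_zero hm
    refine ⟨⟨i, ?_⟩, hi⟩
    by_contra hid
    rw [Nat.testBit_lt_two_pow (hm'.trans_le (Nat.pow_le_pow_right (by norm_num) (by omega)))] at hi
    exact Bool.false_ne_true hi
  obtain ⟨i, hi⟩ := hex _ hcon.1 (Nat.or_lt_two_pow (Nat.and_lt_two_pow _ hbp)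
    (Nat.and_lt_two_pow _ hbn))
  obtain ⟨j, hj⟩ := hex _ hcon.2 (Nat.or_lt_two_pow (Nat.and_lt_two_pow _ hbn)
    (Nat.and_lt_two_pow _ hbp))
  have hdis : ∀ p n : ℕ, p &&& n = 0 → ∀ i, p.testBit i = true → n.testBit i = false := by
    intro p n h i hp
    have := congrArg (fun m => m.testBit i) h
    simpa [hp] using this
  have ea : ∀ i : Fin d, (a.pos.testBit i = true → a.vec d i = 1) ∧
      (a.neg.testBit i = true → a.vec d i = -1) := by
    intro i
    refine ⟨fun h => ?_, fun h => ?_⟩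
    · simp [Slab.vec, codeVec, bitVec, h, hdis _ _ ha0 _ h]
    · have := hdis _ _ ((Nat.and_comm _ _).trans ha0) _ h
      simp [Slab.vec, codeVec, bitVec, h, this]
  have eb : ∀ i : Fin d, (b.pos.testBit i = true → b.vec d i = 1) ∧
      (b.neg.testBit i = true → b.vec d i = -1) := by
    intro i
    refine ⟨fun h => ?_, fun h => ?_⟩
    · simp [Slab.vec, codeVec, bitVec, h, hdis _ _ hb0 _ h]
    · have := hdis _ _ ((Nat.and_comm _ _).trans hb0) _ h
      simp [Slab.vec, codeVec, bitVec, h, this]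
  have hmin := hR.abs_minor_two he hent haR hbR i j
  simp only [Nat.testBit_or, Nat.testBit_and, Bool.or_eq_true, Bool.and_eq_true] at hi hj
  rcases hi with ⟨h1, h2⟩ | ⟨h1, h2⟩ <;> rcases hj with ⟨h3, h4⟩ | ⟨h3, h4⟩
  · rw [(ea i).1 h1, (eb i).1 h2, (ea j).1 h3, (eb j).2 h4] at hmin
    norm_num at hmin
  · rw [(ea i).1 h1, (eb i).1 h2, (ea j).2 h3, (eb j).1 h4] at hmin
    norm_num at hmin
  · rw [(ea i).2 h1, (eb i).2 h2, (ea j).1 h3, (eb j).2 h4] at hmin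
    norm_num at hmin
  · rw [(ea i).2 h1, (eb i).2 h2, (ea j).2 h3, (eb j).1 h4] at hmin
    norm_num at hmin

theorem IsUnimodularRows.hasBadTriple (hR : IsUnimodularRows R) (he : ∀ i, Pi.single i 1 ∈ R)
    (hent : ∀ r ∈ R, ∀ i, -1 ≤ r i ∧ r i ≤ 1) (l : List Slab) (hl : ∀ s ∈ l, s.vec d ∈ R) :
    hasBadTriple d l = false := by
  induction l with
  | nil => rfl
  | cons a l ih =>
    rw [_root_.hasBadTriple, ih fun s hs => hl s (List.mem_cons_of_mem _ hs), Bool.false_or]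
    by_contra hcon
    simp only [Bool.not_eq_false, List.any_eq_true, badTriple, decide_eq_true_eq] at hcon
    obtain ⟨b, hb, c, hc, i, -, j, -, k, -, h⟩ := hcon
    have := hR.abs_minorThree he hent (hl a List.mem_cons_self)
      (hl b (List.mem_cons_of_mem _ hb)) (hl c (List.mem_cons_of_mem _ hc)) i j k
    rw [Int.abs_eq_natAbs] at this
    simp only [Slab.vec] at this
    omega

/-- M is the set of zero-one points satisfying all rows of R. The proof follows the single branch
that chooses a candidate exactly when it lies in R. Along it V contains M, and every row of R is
still a candidate or already holds on V; at the end V = M. Pruning is harmless: rows of R are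
pairwise compatible, redundant rows hold on V, and fullness passes from M to larger sets. -/
theorem search_sound (hR : IsUnimodularRows R) (he : ∀ i, Pi.single i 1 ∈ R)
    (hent : ∀ r ∈ R, ∀ i, -1 ≤ r i ∧ r i ≤ 1) {tests : List ℕ} {good : ℕ → Bool} {M : ℕ}
    (hM : ∀ x, M.testBit x = true ↔ x < 2 ^ d ∧ ∀ r ∈ R,
      0 ≤ ∑ i, r i * bitVec d x i ∧ ∑ i, r i * bitVec d x i ≤ 1)
    (hfull : isFull tests M = true) (n : ℕ) (cands ch : List Slab) (V : ℕ)
    (hrun : search d tests good n cands ch V = true) (hcands : ∀ s ∈ cands, s ∈ slabs d)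
    (hch : ∀ s ∈ ch, s.vec d ∈ R) (hMV : ∀ x, M.testBit x = true → V.testBit x = true)
    (hV : ∀ x, V.testBit x = true → x < 2 ^ d)
    (hred : ∀ r ∈ R, (∃ s ∈ cands, s.vec d = r) ∨ ∀ x, V.testBit x = true →
      0 ≤ ∑ i, r i * bitVec d x i ∧ ∑ i, r i * bitVec d x i ≤ 1) : good M = true := by
  have hslab : ∀ s ∈ slabs d, ∀ x, s.mask.testBit x = true ↔ x < 2 ^ d ∧
      (0 ≤ ∑ i, s.vec d i * bitVec d x i ∧ ∑ i, s.vec d i * bitVec d x i ≤ 1) := by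
    intro s hs x
    obtain ⟨c, -, rfl⟩ := List.mem_map.1 hs
    exact testBit_slabMask d c.1 c.2 x
  induction n generalizing cands ch V with
  | zero =>
    cases cands with
    | cons c cs => simp [search] at hrun
    | nil =>
      have hVM : V = M := Nat.eq_of_testBit_eq fun x => by
        rw [Bool.eq_iff_iff]
        exact ⟨fun hx => (hM x).2 ⟨hV x hx, fun r hr => by
          rcases hred r hr with ⟨s, hs, -⟩ | h
          · simp at hs
          · exact h x hx⟩, hMV x⟩
      rw [search, hR.hasBadTriple he hent ch hch, Bool.or_false, hVM] at hrun
      exact hrun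
  | succ n ih =>
    cases cands with
    | nil =>
      have hVM : V = M := Nat.eq_of_testBit_eq fun x => by
        rw [Bool.eq_iff_iff]
        exact ⟨fun hx => (hM x).2 ⟨hV x hx, fun r hr => by
          rcases hred r hr with ⟨s, hs, -⟩ | h
          · simp at hs
          · exact h x hx⟩, hMV x⟩
      rw [search, hR.hasBadTriple he hent ch hch, Bool.or_false, hVM] at hrun
      exact hrun
    | cons c cs =>
      rw [search, Bool.and_eq_true] at hrun
      have hc := hcands c List.mem_cons_self
      have hcs : ∀ s ∈ cs, s ∈ slabs d := fun s hs => hcands s (List.mem_cons_of_mem _ hs)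
      by_cases hcR : c.vec d ∈ R
      · have hMs : ∀ s ∈ slabs d, s.vec d ∈ R → ∀ x, M.testBit x = true →
            s.mask.testBit x = true := fun s hs hsR x hx =>
          (hslab s hs x).2 ⟨((hM x).1 hx).1, ((hM x).1 hx).2 _ hsR⟩
        have hMV2 : ∀ x, M.testBit x = true → (V &&& c.mask).testBit x = true := fun x hx => by
          rw [Nat.testBit_and, hMV x hx, hMs c hc hcR x hx]
          rfl
        refine ih _ _ _ hrun.2 (fun s hs => hcs s (List.mem_filter.1 hs).1) ?_ hMV2
          (fun x hx => ?_) fun r hr => ?_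
        · intro s hs
          rcases List.mem_cons.1 hs with rfl | hs
          · exact hcR
          · exact hch s hs
        · rw [Nat.testBit_and, Bool.and_eq_true] at hx
          exact hV x hx.1
        · rcases hred r hr with ⟨s, hs, rfl⟩ | h
          · rcases List.mem_cons.1 hs with rfl | hs
            · right
              intro x hx
              rw [Nat.testBit_and, Bool.and_eq_true] at hx
              exact ((hslab _ hc x).1 hx.2).2
            · by_cases hrd : V &&& c.mask &&& s.mask = V &&& c.mask
              · right
                intro x hx
                rw [← hrd, Nat.testBit_and, Bool.and_eq_true] at hx
                exact ((hslab _ (hcs s hs) x).1 hx.2).2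
              · left
                refine ⟨s, List.mem_filter.2 ⟨hs, ?_⟩, rfl⟩
                rw [hR.compat he hent hc (hcs s hs) hcR hr]
                simp only [Bool.true_and, Bool.and_eq_true, Bool.not_eq_true', beq_eq_false_iff_ne]
                refine ⟨hrd, ?_⟩
                simp only [isFull, List.all_eq_true, bne_iff_ne, ne_eq] at hfull ⊢
                intro t ht h0
                refine hfull t ht (Nat.eq_of_testBit_eq fun x => ?_)
                have h1 := congrArg (fun m => m.testBit x) h0
                simp only [Nat.testBit_and, Nat.zero_testBit] at h1 ⊢
                by_cases hx : M.testBit x = true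
                · have h2 := hMV2 x hx
                  rw [Nat.testBit_and] at h2
                  rw [h2, hMs s (hcs s hs) hr x hx] at h1
                  rw [hx]
                  simpa using h1
                · simp [hx]
          · right
            intro x hx
            rw [Nat.testBit_and, Bool.and_eq_true] at hx
            exact h x hx.1
      · refine ih _ _ _ hrun.1 hcs hch hMV hV fun r hr => ?_
        rcases hred r hr with ⟨s, hs, rfl⟩ | h
        · rcases List.mem_cons.1 hs with rfl | hs
          · exact absurd hr hcR
          · exact Or.inl ⟨s, hs, rfl⟩
        · exact Or.inr h

/-- The search certifies a property of the zero-one points of every normal form. -/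
theorem exists_mask_of_search (hR : IsUnimodularRows R) (he : ∀ i, Pi.single i 1 ∈ R)
    (hent : ∀ r ∈ R, ∀ i, -1 ≤ r i ∧ r i ≤ 1) (hlat : IsLatticePolytope (rowPolytope R))
    (hfacet : ∀ i, ∀ c : Fin d → ℤ,
      (∀ y ∈ rowPolytope R, y i = 0 → ∑ m, (c m : ℝ) * y m = 0) → ∀ m, m ≠ i → c m = 0)
    {good : ℕ → Bool} (hrun : runSearch d good = true) :
    ∃ M < 2 ^ 2 ^ d, rowPolytope R = maskHull d M ∧ good M = true := by
  classical
  set M := maskOf (fun x => decide (∀ r ∈ R,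
    0 ≤ ∑ i, r i * bitVec d x i ∧ ∑ i, r i * bitVec d x i ≤ 1)) (2 ^ d) with hMdef
  have hM : ∀ x, M.testBit x = true ↔ x < 2 ^ d ∧ ∀ r ∈ R,
      0 ≤ ∑ i, r i * bitVec d x i ∧ ∑ i, r i * bitVec d x i ≤ 1 := by
    intro x
    rw [hMdef, testBit_maskOf, Bool.and_eq_true, decide_eq_true_eq, decide_eq_true_eq]
  have hrow : ∀ z : Fin d → ℤ, latticePoint z ∈ rowPolytope R ↔
      ∀ r ∈ R, 0 ≤ ∑ i, r i * z i ∧ ∑ i, r i * z i ≤ 1 := by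
    intro z
    refine forall₂_congr fun r _ => ?_
    simp only [latticePoint]
    norm_cast
  have hunit : ∀ y ∈ rowPolytope R, ∀ i, 0 ≤ y i ∧ y i ≤ 1 := by
    intro y hy i
    have := hy _ (he i)
    simpa [Pi.single_apply] using this
  have hconv : Convex ℝ (rowPolytope R) := by
    obtain ⟨S, hS⟩ := hlat
    rw [hS]
    exact convex_convexHull ℝ _
  -- The unit rows put the polytope inside the unit cube, so the lattice points that span it are
  -- zero-one points.
  have hhull : rowPolytope R = maskHull d M := by
    refine subset_antisymm ?_ (convexHull_min ?_ hconv)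
    · obtain ⟨S, hS⟩ := hlat
      have hsub : ∀ s ∈ S, latticePoint s ∈ rowPolytope R := fun s hs => by
        rw [hS]
        exact subset_convexHull ℝ _ ⟨s, hs, rfl⟩
      rw [hS]
      refine convexHull_mono (Set.image_mono fun s hs => ?_)
      have h1 := hsub s hs
      obtain ⟨x, hx, rfl⟩ := exists_bitVec s fun i => by
        have := hunit _ h1 i
        simp only [latticePoint] at this
        norm_cast at this
        omega
      exact ⟨x, hx, (hM x).2 ⟨hx, (hrow _).1 h1⟩, rfl⟩
    · rintro _ ⟨_, ⟨x, -, hx, rfl⟩, rfl⟩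
      exact (hrow _).2 ((hM x).1 hx).2
  have hlt : M < 2 ^ 2 ^ d := by
    refine Nat.lt_pow_two_of_testBit _ fun i hi => ?_
    rw [hMdef, testBit_maskOf]
    simp [hi]
  -- If M missed a test, all its points with y_i = 0 would lie in the kernel of a nonzero row with
  -- i-th entry zero. By `hfacet` all other entries vanish as well, a contradiction.
  have hfull : isFull (facetTests d) M = true := by
    simp only [isFull, List.all_eq_true, bne_iff_ne, ne_eq]
    intro t ht h0
    simp only [facetTests, List.mem_flatMap, List.mem_map, List.mem_filter, Bool.and_eq_true,
      decide_eq_true_eq, Bool.not_eq_true'] at ht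
    obtain ⟨i, -, c, ⟨hc, ⟨-, hc1⟩, hc2⟩, rfl⟩ := ht
    have hzero : ∀ x, M.testBit x = true → bitVec d x i = 0 → dotBits d c.1 c.2 x = 0 := by
      intro x hx hxi
      by_contra hne
      have h1 := congrArg (fun m => m.testBit x) h0
      have h2 : x.testBit i = false := by
        by_contra h
        simp only [bitVec] at hxi
        rw [if_pos (by simpa using h)] at hxi
        exact one_ne_zero hxi
      simp [Nat.testBit_and, hx, testBit_maskOf, ((hM x).1 hx).1, h2, hne] at h1
    have hvan : ∀ m, m ≠ i → codeVec d c.1 c.2 m = 0 := by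
      refine hfacet i _ fun y hy hyi => ?_
      -- The property passes from the points of M to their hull because the set is convex: as y_i ≥
      -- 0, a convex combination with y_i = 0 involves only points with y_i = 0.
      have hsub : rowPolytope R ⊆ {y | 0 ≤ y i ∧ (y i = 0 →
          ∑ m, (codeVec d c.1 c.2 m : ℝ) * y m = 0)} := by
        rw [hhull]
        refine convexHull_min ?_ ?_
        · rintro _ ⟨_, ⟨x, -, hx, rfl⟩, rfl⟩
          refine ⟨?_, fun hxi => ?_⟩
          · rcases bitVec_mem d x i with h | h <;> simp [latticePoint, h]
          · have h1 : bitVec d x i = 0 := by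
              simp only [latticePoint] at hxi
              exact_mod_cast hxi
            have h2 := hzero x hx h1
            simp only [dotBits] at h2
            simp only [latticePoint]
            exact_mod_cast h2
        · rintro y ⟨hy, hy'⟩ w ⟨hw, hw'⟩ α β hα hβ hαβ
          refine ⟨?_, fun h0 => ?_⟩
          · simp only [Pi.add_apply, Pi.smul_apply, smul_eq_mul]
            positivity
          · simp only [Pi.add_apply, Pi.smul_apply, smul_eq_mul] at h0
            have h1 : α * y i = 0 := by nlinarith [mul_nonneg hα hy, mul_nonneg hβ hw]
            have h2 : β * w i = 0 := by nlinarith [mul_nonneg hα hy, mul_nonneg hβ hw]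
            have h3 : α * ∑ m, (codeVec d c.1 c.2 m : ℝ) * y m = 0 := by
              rcases mul_eq_zero.1 h1 with h | h
              · rw [h, zero_mul]
              · rw [hy' h, mul_zero]
            have h4 : β * ∑ m, (codeVec d c.1 c.2 m : ℝ) * w m = 0 := by
              rcases mul_eq_zero.1 h2 with h | h
              · rw [h, zero_mul]
              · rw [hw' h, mul_zero]
            rw [Finset.mul_sum] at h3 h4
            rw [← add_zero (0 : ℝ)]
            nth_rewrite 1 [← h3]
            rw [← h4, ← Finset.sum_add_distrib]
            refine Finset.sum_congr rfl fun m _ => ?_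
            simp only [Pi.add_apply, Pi.smul_apply, smul_eq_mul]
            ring
      exact (hsub hy).2 hyi
    obtain ⟨hcr, hc0⟩ := List.mem_filter.1 hc
    simp only [Bool.and_eq_true, beq_iff_eq, bne_iff_ne, ne_eq] at hc0
    refine hc0.2 (Nat.eq_of_testBit_eq fun k => ?_)
    obtain ⟨hl1, hl2⟩ := List.mem_product.1 hcr
    rw [Nat.testBit_or, Nat.zero_testBit]
    by_cases hk : k < d
    · by_cases hki : k = i
      · rw [hki, hc1, hc2]
        rfl
      · have h1 := hvan ⟨k, hk⟩ fun h => hki (congrArg Fin.val h)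
        have h2 := congrArg (fun m => m.testBit k) hc0.1
        simp only [codeVec, bitVec] at h1
        simp only [Nat.testBit_and, Nat.zero_testBit] at h2
        have key : ∀ a b : Bool, ((if a = true then (1 : ℤ) else 0) - (if b = true then 1 else 0) = 0) →
            (a && b) = false → (a || b) = false := by decide
        exact key _ _ h1 h2
    · have hle : 2 ^ d ≤ 2 ^ k := Nat.pow_le_pow_right (by norm_num) (by omega)
      rw [Nat.testBit_lt_two_pow ((List.mem_range.1 hl1).trans_le hle),
        Nat.testBit_lt_two_pow ((List.mem_range.1 hl2).trans_le hle)]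
      rfl
  refine ⟨M, hlt, hhull, ?_⟩
  have htop : ∀ x, (2 ^ 2 ^ d - 1).testBit x = true ↔ x < 2 ^ d := by
    intro x
    rw [Nat.testBit_two_pow_sub_one, decide_eq_true_eq]
  refine search_sound hR he hent hM hfull _ _ _ _ hrun
    (fun s hs => (List.mem_filter.1 hs).1) (by simp) (fun x hx => (htop x).2 ((hM x).1 hx).1)
    (fun x hx => (htop x).1 hx) fun r hr => ?_
  by_cases hr0 : r = 0
  · right
    intro x _
    simp [hr0]
  obtain ⟨s, hs, rfl⟩ := exists_slab r (hent r hr) hr0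
  have hsm : ∀ x, s.mask.testBit x = true ↔ x < 2 ^ d ∧
      (0 ≤ ∑ i, s.vec d i * bitVec d x i ∧ ∑ i, s.vec d i * bitVec d x i ≤ 1) := by
    intro x
    obtain ⟨c, -, rfl⟩ := List.mem_map.1 hs
    exact testBit_slabMask d c.1 c.2 x
  by_cases htriv : s.mask = 2 ^ 2 ^ d - 1
  · right
    intro x hx
    rw [← htriv] at hx
    exact ((hsm x).1 hx).2
  · left
    refine ⟨s, List.mem_filter.2 ⟨hs, ?_⟩, rfl⟩
    simp only [Bool.and_eq_true, Bool.not_eq_true', beq_eq_false_iff_ne]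
    refine ⟨htriv, ?_⟩
    simp only [isFull, List.all_eq_true, bne_iff_ne, ne_eq] at hfull ⊢
    intro t ht h0
    refine hfull t ht (Nat.eq_of_testBit_eq fun x => ?_)
    have h1 := congrArg (fun m => m.testBit x) h0
    simp only [Nat.testBit_and, Nat.zero_testBit] at h1 ⊢
    by_cases hx : M.testBit x = true
    · rw [(hsm x).2 ⟨((hM x).1 hx).1, ((hM x).1 hx).2 _ hr⟩] at h1
      rw [hx]
      simpa using h1
    · simp [hx]

/-! ### Integral affine maps -/

section intAffine

variable {ι κ : Type*} [Fintype ι] [DecidableEq ι]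

/-- The real affine map with integral coefficients. -/
noncomputable def intAffine (M : Matrix κ ι ℤ) (c : κ → ℤ) : (ι → ℝ) →ᵃ[ℝ] (κ → ℝ) :=
  (Matrix.toLin' (M.map (Int.cast : ℤ → ℝ))).toAffineMap +
    AffineMap.const ℝ (ι → ℝ) (latticePoint c)

theorem intAffine_apply (M : Matrix κ ι ℤ) (c : κ → ℤ) (x : ι → ℝ) (k : κ) :
    intAffine M c x k = ∑ i, (M k i : ℝ) * x i + c k := by
  simp [intAffine, latticePoint, Matrix.mulVec, dotProduct]

theorem intAffine_latticePoint (M : Matrix κ ι ℤ) (c : κ → ℤ) (z : ι → ℤ) :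
    intAffine M c (latticePoint z) = latticePoint fun k => ∑ i, M k i * z i + c k := by
  ext k
  rw [intAffine_apply]
  simp [latticePoint]

/-- An integral left inverse N suffices, with no need for M to be square: x ↦ N(x - c) is an
integral affine retraction. -/
theorem areEquivalent_intAffine [Fintype κ] [DecidableEq κ] {M : Matrix κ ι ℤ} {N : Matrix ι κ ℤ}
    (h : N * M = 1) (c : κ → ℤ) (P : Set (ι → ℝ)) : AreEquivalent P (intAffine M c '' P) := by
  refine areEquivalent_of_section (intAffine M c) (intAffine N fun i => -∑ k, N i k * c k)
    ?_ ?_ (fun x => ?_) P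
  · rintro _ ⟨z, rfl⟩
    rw [intAffine_latticePoint]
    exact latticePoint_mem _
  · rintro _ ⟨z, rfl⟩
    rw [intAffine_latticePoint]
    exact latticePoint_mem _
  · ext i
    rw [intAffine_apply]
    simp only [intAffine_apply]
    push_cast
    simp only [mul_add, Finset.sum_add_distrib, Finset.mul_sum]
    rw [add_neg_cancel_right, Finset.sum_comm]
    have h1 : ∀ m, ∑ k, (N i k : ℝ) * ((M k m : ℝ) * x m) = if i = m then x m else 0 := by
      intro m
      have h2 := congrFun (congrFun h i) m
      rw [Matrix.mul_apply, Matrix.one_apply] at h2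
      have h3 : ∑ k, (N i k : ℝ) * ((M k m : ℝ) * x m)
          = ((∑ k, N i k * M k m : ℤ) : ℝ) * x m := by
        push_cast
        rw [Finset.sum_mul]
        exact Finset.sum_congr rfl fun k _ => by ring
      rw [h3, h2]
      split_ifs <;> simp
    simp [h1]

end intAffine

theorem isLatticePolytope_maskHull (d V : ℕ) : IsLatticePolytope (maskHull d V) := by
  classical
  refine ⟨((Finset.range (2 ^ d)).filter fun x => V.testBit x = true).image (bitVec d), ?_⟩
  unfold maskHull
  congr 2
  ext z
  simp only [Set.mem_ofPred_eq, Finset.coe_image, Finset.coe_filter, Finset.mem_range,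
    Set.mem_image]
  constructor
  · rintro ⟨x, hx, hx', rfl⟩
    exact ⟨x, ⟨hx, hx'⟩, rfl⟩
  · rintro ⟨x, ⟨hx, hx'⟩, rfl⟩
    exact ⟨x, hx, hx', rfl⟩

/-! ### Coordinates on the polytopes of the table -/

namespace Row

/-- Arrows whose flows are coordinates on the flow space. -/
def basis : (r : Row) → Fin r.dim → Fin r.pair.numArrows
  | Ia3 => (![0, 1, 2] : Fin 3 → Fin 4)
  | IIc3 => (![0, 1, 2] : Fin 3 → Fin 5)
  | Ib3 => (![0, 1, 2] : Fin 3 → Fin 8)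
  | IIc4 => (![0, 1, 2, 3] : Fin 4 → Fin 5)
  | Id4 => (![0, 1, 2, 4] : Fin 4 → Fin 6)
  | IIf4 => (![0, 1, 2, 3] : Fin 4 → Fin 6)
  | IIId4 => (![0, 1, 3, 5] : Fin 4 → Fin 7)
  | Ia4 => (![0, 1, 3, 5] : Fin 4 → Fin 7)
  | Vb4 => (![0, 1, 3, 4] : Fin 4 → Fin 9)
  | VIc4 => (![0, 1, 3, 4] : Fin 4 → Fin 8)
  | VIIb4 => (![0, 1, 2, 3] : Fin 4 → Fin 9)
  | VIIIa4 => (![0, 2, 4, 8] : Fin 4 → Fin 12)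
  | IXa4 => (![0, 1, 2, 3] : Fin 4 → Fin 10)
  | Xa4 => (![0, 1, 2, 6] : Fin 4 → Fin 9)

/-- The flow on each arrow as an affine function of the coordinates: linear part. -/
def coeff : (r : Row) → Fin r.pair.numArrows → Fin r.dim → ℤ
  | Ia3 => ![![1, 0, 0], ![0, 1, 0], ![0, 0, 1], ![-1, -1, -1]]
  | IIc3 => ![![1, 0, 0], ![0, 1, 0], ![0, 0, 1], ![1, 1, -1], ![-1, -1, 0]]
  | Ib3 => ![![1, 0, 0], ![0, 1, 0], ![0, 0, 1], ![-1, -1, -1], ![-1, 0, 0], ![0, -1, 0],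
      ![0, 0, -1], ![1, 1, 1]]
  | IIc4 => ![![1, 0, 0, 0], ![0, 1, 0, 0], ![0, 0, 1, 0], ![0, 0, 0, 1], ![-1, -1, -1, -1]]
  | Id4 => ![![1, 0, 0, 0], ![0, 1, 0, 0], ![0, 0, 1, 0], ![1, 1, -1, 0], ![0, 0, 0, 1],
      ![-1, -1, 0, -1]]
  | IIf4 => ![![1, 0, 0, 0], ![0, 1, 0, 0], ![0, 0, 1, 0], ![0, 0, 0, 1], ![1, 1, -1, -1],
      ![-1, -1, 0, 0]]
  | IIId4 => ![![1, 0, 0, 0], ![0, 1, 0, 0], ![-1, -1, 0, 0], ![0, 0, 1, 0], ![0, -1, -1, 0],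
      ![0, 0, 0, 1], ![1, 1, 0, -1]]
  | Ia4 => ![![1, 0, 0, 0], ![0, 1, 0, 0], ![-1, -1, 0, 0], ![0, 0, 1, 0], ![-1, 0, -1, 0],
      ![0, 0, 0, 1], ![-1, 0, 0, -1]]
  | Vb4 => ![![1, 0, 0, 0], ![0, 1, 0, 0], ![-1, -1, 0, 0], ![0, 0, 1, 0], ![0, 0, 0, 1],
      ![0, 0, -1, -1], ![-1, 0, -1, 0], ![0, -1, 0, -1], ![1, 1, 1, 1]]
  | VIc4 => ![![1, 0, 0, 0], ![0, 1, 0, 0], ![-1, -1, 0, 0], ![0, 0, 1, 0], ![0, 0, 0, 1],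
      ![0, 0, -1, -1], ![0, -1, 0, -1], ![1, 1, 1, 1]]
  | VIIb4 => ![![1, 0, 0, 0], ![0, 1, 0, 0], ![0, 0, 1, 0], ![0, 0, 0, 1], ![0, -1, 0, 0],
      ![0, 0, -1, 0], ![1, 1, 1, 0], ![0, -1, -1, 1], ![-1, 0, 0, -1]]
  | VIIIa4 => ![![1, 0, 0, 0], ![-1, 0, 0, 0], ![0, 1, 0, 0], ![0, -1, 0, 0], ![0, 0, 1, 0],
      ![0, 0, -1, 0], ![-1, -1, -1, 0], ![1, 1, 1, 0], ![0, 0, 0, 1], ![0, 0, 0, -1],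
      ![1, 1, 0, -1], ![-1, -1, 0, 1]]
  | IXa4 => ![![1, 0, 0, 0], ![0, 1, 0, 0], ![0, 0, 1, 0], ![0, 0, 0, 1], ![-1, -1, -1, -1],
      ![-1, 0, 0, 0], ![0, -1, 0, 0], ![0, 0, -1, 0], ![0, 0, 0, -1], ![1, 1, 1, 1]]
  | Xa4 => ![![1, 0, 0, 0], ![0, 1, 0, 0], ![0, 0, 1, 0], ![-1, 0, 0, 0], ![0, -1, 0, 0],
      ![0, 0, -1, 0], ![0, 0, 0, 1], ![1, 1, 1, -1], ![-1, -1, -1, 0]]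

/-- The flow on each arrow as an affine function of the coordinates: constant part. -/
def offset : (r : Row) → Fin r.pair.numArrows → ℤ
  | Ia3 => ![0, 0, 0, 1]
  | IIc3 => ![0, 0, 0, 0, 1]
  | Ib3 => ![0, 0, 0, 2, 1, 1, 1, -1]
  | IIc4 => ![0, 0, 0, 0, 1]
  | Id4 => ![0, 0, 0, 0, 0, 1]
  | IIf4 => ![0, 0, 0, 0, 0, 1]
  | IIId4 => ![0, 0, 1, 0, 1, 0, 0]
  | Ia4 => ![0, 0, 1, 0, 1, 0, 1]
  | Vb4 => ![0, 0, 1, 0, 0, 1, 1, 1, -1]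
  | VIc4 => ![0, 0, 1, 0, 0, 1, 1, -1]
  | VIIb4 => ![0, 0, 0, 0, 1, 1, -1, 1, 1]
  | VIIIa4 => ![0, 1, 0, 1, 0, 1, 2, -1, 0, 1, 0, 1]
  | IXa4 => ![0, 0, 0, 0, 2, 1, 1, 1, 1, -1]
  | Xa4 => ![0, 0, 0, 1, 1, 1, 0, -1, 2]

/-- A vertex set, given by its bits, whose cut expresses the flow on an arrow by coordinates. -/
def cut : (r : Row) → Fin r.pair.numArrows → ℕ
  | Ia3 => ![0, 0, 0, 2]
  | IIc3 => ![0, 0, 0, 5, 6]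
  | Ib3 => ![0, 0, 0, 62, 4, 8, 16, 33]
  | IIc4 => ![0, 0, 0, 0, 2]
  | Id4 => ![0, 0, 0, 5, 0, 6]
  | IIf4 => ![0, 0, 0, 0, 5, 6]
  | IIId4 => ![0, 0, 14, 0, 4, 0, 9]
  | Ia4 => ![0, 0, 14, 0, 12, 0, 8]
  | Vb4 => ![0, 0, 62, 0, 0, 61, 8, 16, 35]
  | VIc4 => ![0, 0, 30, 0, 0, 29, 8, 19]
  | VIIb4 => ![0, 0, 0, 0, 16, 32, 1, 50, 8]
  | VIIIa4 => ![0, 8, 0, 16, 0, 32, 510, 65, 0, 128, 485, 282]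
  | IXa4 => ![0, 0, 0, 0, 126, 4, 8, 16, 32, 65]
  | Xa4 => ![0, 0, 0, 8, 16, 32, 0, 1, 58]

/-- A vertex set, given by its bits, whose cut bounds the flow on an arrow by one. -/
def upperCut : (r : Row) → Fin r.pair.numArrows → ℕ
  | Ia3 => ![2, 2, 2, 2]
  | IIc3 => ![6, 6, 4, 4, 4]
  | Ib3 => ![4, 8, 16, 32, 4, 8, 16, 32]
  | IIc4 => ![2, 2, 2, 2, 2]
  | Id4 => ![6, 6, 4, 4, 4, 4]
  | IIf4 => ![6, 6, 4, 4, 4, 4]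
  | IIId4 => ![14, 4, 8, 4, 4, 8, 8]
  | Ia4 => ![8, 14, 14, 12, 12, 8, 8]
  | Vb4 => ![8, 16, 32, 8, 16, 32, 8, 16, 32]
  | VIc4 => ![30, 8, 16, 29, 8, 16, 8, 16]
  | VIIb4 => ![8, 16, 32, 8, 16, 32, 59, 59, 8]
  | VIIIa4 => ![8, 8, 16, 16, 32, 32, 64, 64, 128, 128, 256, 256]
  | IXa4 => ![4, 8, 16, 32, 64, 4, 8, 16, 32, 64]
  | Xa4 => ![8, 16, 32, 8, 16, 32, 59, 59, 59]

/-- The coordinates of the vertices, as a set of zero-one vectors. -/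
def mask : Row → ℕ
  | Ia3 => 23
  | IIc3 => 103
  | Ib3 => 126
  | IIc4 => 279
  | Id4 => 359
  | IIf4 => 1639
  | IIId4 => 9783
  | Ia4 => 21847
  | Vb4 => 854
  | VIc4 => 886
  | VIIb4 => 21566
  | VIIIa4 => 28278
  | IXa4 => 6014
  | Xa4 => 26750

/-- The vertices of a unimodular simplex. -/
def simplex : (r : Row) → Fin (r.dim + 1) → ℕ
  | Ia3 => ![0, 4, 2, 1]
  | IIc3 => ![0, 2, 6, 1]
  | Ib3 => ![4, 2, 6, 1]
  | IIc4 => ![0, 8, 4, 2, 1]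
  | Id4 => ![0, 8, 2, 6, 1]
  | IIf4 => ![0, 2, 10, 6, 1]
  | IIId4 => ![0, 4, 2, 10, 1]
  | Ia4 => ![0, 8, 4, 2, 1]
  | Vb4 => ![8, 4, 2, 6, 1]
  | VIc4 => ![8, 4, 2, 6, 1]
  | VIIb4 => ![4, 12, 2, 14, 1]
  | VIIIa4 => ![4, 2, 10, 6, 1]
  | IXa4 => ![8, 4, 12, 2, 1]
  | Xa4 => ![4, 2, 6, 14, 1]

/-- The unit vectors as combinations of the edges of the simplex at its first vertex. -/
def simplexInv : (r : Row) → Fin r.dim → Fin r.dim → ℤ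
  | Ia3 => ![![0, 0, 1], ![0, 1, 0], ![1, 0, 0]]
  | IIc3 => ![![0, 0, 1], ![1, 0, 0], ![-1, 1, 0]]
  | Ib3 => ![![-1, 1, 1], ![0, 1, 0], ![-1, 1, 0]]
  | IIc4 => ![![0, 0, 0, 1], ![0, 0, 1, 0], ![0, 1, 0, 0], ![1, 0, 0, 0]]
  | Id4 => ![![0, 0, 0, 1], ![0, 1, 0, 0], ![0, -1, 1, 0], ![1, 0, 0, 0]]
  | IIf4 => ![![0, 0, 0, 1], ![1, 0, 0, 0], ![-1, 0, 1, 0], ![-1, 1, 0, 0]]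
  | IIId4 => ![![0, 0, 0, 1], ![0, 1, 0, 0], ![1, 0, 0, 0], ![0, -1, 1, 0]]
  | Ia4 => ![![0, 0, 0, 1], ![0, 0, 1, 0], ![0, 1, 0, 0], ![1, 0, 0, 0]]
  | Vb4 => ![![-1, -1, 1, 1], ![-1, 0, 1, 0], ![0, -1, 1, 0], ![-1, -1, 1, 0]]
  | VIc4 => ![![-1, -1, 1, 1], ![-1, 0, 1, 0], ![0, -1, 1, 0], ![-1, -1, 1, 0]]
  | VIIb4 => ![![-1, -1, 1, 1], ![-1, 0, 1, 0], ![-1, -1, 1, 0], ![1, 0, 0, 0]]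
  | VIIIa4 => ![![-1, 0, 1, 1], ![0, 0, 1, 0], ![-1, 0, 1, 0], ![-1, 1, 0, 0]]
  | IXa4 => ![![-1, 1, 0, 1], ![-1, 1, 1, 0], ![0, 1, 0, 0], ![-1, 1, 0, 0]]
  | Xa4 => ![![-1, 1, 0, 1], ![0, 1, 0, 0], ![-1, 1, 0, 0], ![0, -1, 1, 0]]
-- Finite checks of the tabulated data
theorem basis_coeff (r : Row) : ∀ i j, r.coeff (r.basis i) j = if i = j then 1 else 0 := by
  cases r <;> decide +kernel

theorem basis_offset (r : Row) : ∀ i, r.offset (r.basis i) = 0 := by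
  cases r <;> decide +kernel

/-- The indicator function of a vertex set given by its bits. -/
def indicator (r : Row) (s : ℕ) (v : Fin r.pair.numVertices) : ℤ := if s.testBit v then 1 else 0

/-- Adding the conservation laws over a vertex set gives the net flow into it. For the listed set
this reads: x_a minus its linear part in the basis flows equals the offset. -/
theorem cut_spec (r : Row) : ∀ a,
    (∀ b, r.indicator (r.cut a) (r.pair.head b) - r.indicator (r.cut a) (r.pair.tail b)
      = (if a = b then 1 else 0) - ∑ i, if r.basis i = b then r.coeff a i else 0) ∧
    ∑ v, r.indicator (r.cut a) v * r.pair.weight v = r.offset a := by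
  cases r <;> decide +kernel

/-- No arrow leaves the listed vertex set, a enters it, and its total weight is at most one. For
nonnegative flows this gives x_a ≤ 1. -/
theorem upperCut_spec (r : Row) : ∀ a,
    (∀ b, (if a = b then 1 else 0) ≤
      r.indicator (r.upperCut a) (r.pair.head b) - r.indicator (r.upperCut a) (r.pair.tail b)) ∧
    ∑ v, r.indicator (r.upperCut a) v * r.pair.weight v ≤ 1 := by
  cases r <;> decide +kernel

theorem incidence_coeff (r : Row) : ∀ v,
    (∀ i, ∑ a, r.pair.incidence v a * r.coeff a i = 0) ∧
    ∑ a, r.pair.incidence v a * r.offset a = r.pair.weight v := by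
  cases r <;> decide +kernel

/-- The flow on an arrow at the point with the binary digits of `x` as coordinates. -/
def flow (r : Row) (x : ℕ) (a : Fin r.pair.numArrows) : ℤ :=
  ∑ i, r.coeff a i * bitVec r.dim x i + r.offset a

theorem mask_spec (r : Row) : ∀ x < 2 ^ r.dim, r.mask.testBit x = true ↔ ∀ a, 0 ≤ r.flow x a := by
  cases r <;> decide +kernel

/-- Both values occur at lattice points, so the coordinate x_a is a primitive function on the
lattice of the affine span. -/
theorem exists_flow_eq (r : Row) : ∀ a,
    (∃ x < 2 ^ r.dim, r.mask.testBit x = true ∧ r.flow x a = 0) ∧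
    (∃ x < 2 ^ r.dim, r.mask.testBit x = true ∧ r.flow x a = 1) := by
  cases r <;> decide +kernel

theorem simplex_spec (r : Row) :
    (∀ j, r.simplex j < 2 ^ r.dim ∧ r.mask.testBit (r.simplex j) = true) ∧
    ∀ i k, ∑ j, r.simplexInv i j * (bitVec r.dim (r.simplex j.succ) k - bitVec r.dim (r.simplex 0) k)
      = if i = k then 1 else 0 := by
  cases r <;> decide +kernel

end Row

/-! ### The geometry of the polytopes of the table -/

theorem convex_maskHull (d V : ℕ) : Convex ℝ (maskHull d V) := convex_convexHull ℝ _

theorem latticePoint_bitVec_mem_maskHull {d V x : ℕ} (hx : x < 2 ^ d) (h : V.testBit x = true) :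
    latticePoint (bitVec d x) ∈ maskHull d V :=
  subset_convexHull ℝ _ ⟨_, ⟨x, hx, h, rfl⟩, rfl⟩

namespace Row

variable (r : Row)

/-- Summation by parts: the conservation laws are weighted by a potential p. Indicators of vertex
sets give the flows across cuts. -/
theorem sum_potential {x : Fin r.pair.numArrows → ℝ}
    (hx : x ∈ r.pair.toFlowQuiver.flowSpace r.pair.weight) (p : Fin r.pair.numVertices → ℤ) :
    ∑ b, ((p (r.pair.head b) - p (r.pair.tail b) : ℤ) : ℝ) * x b
      = ((∑ v, p v * r.pair.weight v : ℤ) : ℝ) := by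
  rw [FlowQuiver.mem_flowSpace_iff] at hx
  push_cast
  simp only [← hx, Finset.mul_sum]
  rw [Finset.sum_comm]
  refine Finset.sum_congr rfl fun b _ => ?_
  simp only [FlowQuiver.incidence, Int.cast_sub, Int.cast_ite, Int.cast_one, Int.cast_zero,
    sub_mul, mul_sub, ite_mul, mul_ite, one_mul, zero_mul, mul_zero, Finset.sum_sub_distrib,
    Finset.sum_ite_eq, Finset.mem_univ, if_true]

theorem le_one_of_mem {x : Fin r.pair.numArrows → ℝ} (hx : x ∈ r.polytope)
    (a : Fin r.pair.numArrows) : x a ≤ 1 := by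
  have h1 := r.sum_potential hx.1 (r.indicator (r.upperCut a))
  obtain ⟨h2, h3⟩ := r.upperCut_spec a
  have h4 : x a ≤ ∑ b, ((r.indicator (r.upperCut a) (r.pair.head b)
      - r.indicator (r.upperCut a) (r.pair.tail b) : ℤ) : ℝ) * x b := by
    calc x a = ∑ b, ((if a = b then 1 else 0 : ℤ) : ℝ) * x b := by simp
      _ ≤ _ := Finset.sum_le_sum fun b _ =>
        mul_le_mul_of_nonneg_right (by exact_mod_cast h2 b) (hx.2 b)
  rw [h1] at h4
  exact h4.trans (by exact_mod_cast h3)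

/-- The affine parametrization of the flow space by the coordinates. -/
noncomputable def param : (Fin r.dim → ℝ) →ᵃ[ℝ] (Fin r.pair.numArrows → ℝ) :=
  intAffine (Matrix.of r.coeff) r.offset

theorem param_apply (y : Fin r.dim → ℝ) (a : Fin r.pair.numArrows) :
    r.param y a = ∑ i, (r.coeff a i : ℝ) * y i + r.offset a := intAffine_apply _ _ _ _

theorem param_basis {x : Fin r.pair.numArrows → ℝ}
    (hx : x ∈ r.pair.toFlowQuiver.flowSpace r.pair.weight) :
    r.param (fun i => x (r.basis i)) = x := by
  ext a
  have h1 := r.sum_potential hx (r.indicator (r.cut a))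
  obtain ⟨h2, h3⟩ := r.cut_spec a
  simp only [h2, h3] at h1
  rw [param_apply, ← h1]
  have h4 : ∀ b, ((((if a = b then 1 else 0) - ∑ i, if r.basis i = b then r.coeff a i else 0 : ℤ)
      : ℝ)) * x b = (if a = b then x b else 0)
        - ∑ i, if r.basis i = b then (r.coeff a i : ℝ) * x b else 0 := by
    intro b
    push_cast
    rw [sub_mul, Finset.sum_mul]
    congr 1
    · split_ifs <;> simp
    · refine Finset.sum_congr rfl fun i _ => ?_
      split_ifs <;> simp
  simp only [h4, Finset.sum_sub_distrib]
  rw [Finset.sum_comm]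
  simp

theorem param_mem_flowSpace (y : Fin r.dim → ℝ) :
    r.param y ∈ r.pair.toFlowQuiver.flowSpace r.pair.weight := by
  rw [FlowQuiver.mem_flowSpace_iff]
  intro v
  obtain ⟨h1, h2⟩ := r.incidence_coeff v
  simp only [param_apply, mul_add, Finset.sum_add_distrib, Finset.mul_sum]
  rw [Finset.sum_comm]
  have h3 : ∀ i, ∑ a, (r.pair.incidence v a : ℝ) * ((r.coeff a i : ℝ) * y i) = 0 := by
    intro i
    simp only [← mul_assoc, ← Finset.sum_mul]
    have := h1 i
    have h4 : ∑ a, (r.pair.incidence v a : ℝ) * (r.coeff a i : ℝ) = 0 := by exact_mod_cast this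
    rw [h4, zero_mul]
  simp only [h3, Finset.sum_const_zero, zero_add]
  exact_mod_cast h2

theorem param_bitVec (x : ℕ) :
    r.param (latticePoint (bitVec r.dim x)) = latticePoint (r.flow x) := by
  rw [param, intAffine_latticePoint]
  rfl

theorem mem_polytope_iff (y : Fin r.dim → ℝ) :
    r.param y ∈ r.polytope ↔ ∀ a, 0 ≤ r.param y a :=
  ⟨fun h => h.2, fun h => ⟨r.param_mem_flowSpace y, h⟩⟩

theorem convex_polytope : Convex ℝ r.polytope := by
  have : r.polytope = r.pair.toFlowQuiver.flowSpace r.pair.weight ∩ Set.Ici 0 := by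
    ext x
    simp [polytope, FlowQuiver.nonnegFlows, Pi.le_def]
  rw [this]
  exact (FlowQuiver.convex_flowSpace _ _).inter (convex_Ici 0)

theorem polytope_eq_boundedFlows :
    r.polytope = r.pair.toFlowQuiver.boundedFlows r.pair.weight (fun _ => 0) (fun _ => 1) := by
  ext x
  refine ⟨fun hx => ⟨hx.1, fun a => ⟨by simpa using hx.2 a, by simpa using r.le_one_of_mem hx a⟩⟩,
    fun hx => ⟨hx.1, fun a => by simpa using (hx.2 a).1⟩⟩

theorem isFlowPolytope : IsFlowPolytope r.polytope :=
  ⟨r.pair.toFlowQuiver, r.pair.weight, fun _ => 0, fun _ => 1, by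
    rw [← polytope_eq_boundedFlows]
    exact AreEquivalent.refl _⟩

theorem isLatticePolytope : IsLatticePolytope r.polytope := by
  rw [polytope_eq_boundedFlows, FlowQuiver.boundedFlows_eq_integralFlows]
  exact FlowQuiver.isLatticePolytope_integralFlows _ _ _ _

/-- Both sides are hulls of lattice points. A lattice point of the polytope has flows in {0, 1}, so
its basis flows form a zero-one vector, and `mask_spec` says which vectors occur. -/
theorem param_image_maskHull : r.param '' maskHull r.dim r.mask = r.polytope := by
  apply subset_antisymm
  · unfold maskHull
    rw [AffineMap.image_convexHull]
    refine convexHull_min ?_ r.convex_polytope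
    rintro _ ⟨_, ⟨_, ⟨x, hx, hx', rfl⟩, rfl⟩, rfl⟩
    rw [mem_polytope_iff, param_bitVec]
    intro a
    have := (r.mask_spec x hx).1 hx' a
    simpa [latticePoint] using this
  · obtain ⟨S, hS⟩ := r.isLatticePolytope
    intro x hx
    rw [hS] at hx
    refine convexHull_min ?_ ((convex_maskHull _ _).affine_image r.param) hx
    rintro _ ⟨s, hs, rfl⟩
    have hs' : latticePoint s ∈ r.polytope := hS ▸ subset_convexHull ℝ _ ⟨s, hs, rfl⟩
    obtain ⟨n, hn, hn'⟩ := exists_bitVec (fun i => s (r.basis i)) fun i => by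
      have h1 := hs'.2 (r.basis i)
      have h2 := r.le_one_of_mem hs' (r.basis i)
      simp only [latticePoint] at h1 h2
      have h1' : 0 ≤ s (r.basis i) := by exact_mod_cast h1
      have h2' : s (r.basis i) ≤ 1 := by exact_mod_cast h2
      omega
    have h3 := r.param_basis hs'.1
    have h4 : (fun i => latticePoint s (r.basis i)) = latticePoint (bitVec r.dim n) := by
      rw [← hn']
      rfl
    rw [h4] at h3
    refine ⟨_, latticePoint_bitVec_mem_maskHull hn ?_, h3⟩
    rw [mask_spec r n hn]
    intro a
    rw [param_bitVec] at h3
    have h5 := hs'.2 a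
    rw [← h3] at h5
    simpa [latticePoint] using h5

theorem areEquivalent_maskHull : AreEquivalent (maskHull r.dim r.mask) r.polytope := by
  rw [← param_image_maskHull]
  refine areEquivalent_intAffine (N := Matrix.of fun i a => if a = r.basis i then 1 else 0) ?_ _ _
  ext i j
  rw [Matrix.mul_apply, Matrix.one_apply, ← r.basis_coeff]
  simp

theorem polytopeDim_maskHull : polytopeDim (maskHull r.dim r.mask) = r.dim := by
  obtain ⟨h1, h2⟩ := r.simplex_spec
  have h3 : vectorSpan ℝ (maskHull r.dim r.mask) = ⊤ := by
    rw [eq_top_iff, ← (Pi.basisFun ℝ (Fin r.dim)).span_eq, Submodule.span_le]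
    rintro _ ⟨i, rfl⟩
    have h4 : (Pi.basisFun ℝ (Fin r.dim)) i = ∑ j, (r.simplexInv i j : ℝ) •
        (latticePoint (bitVec r.dim (r.simplex j.succ))
          - latticePoint (bitVec r.dim (r.simplex 0))) := by
      ext k
      have h5 := h2 i k
      have h6 : ∑ j, (r.simplexInv i j : ℝ) * ((bitVec r.dim (r.simplex j.succ) k : ℝ)
          - bitVec r.dim (r.simplex 0) k) = if i = k then 1 else 0 := by exact_mod_cast h5
      simp [latticePoint, h6, Pi.single_apply, eq_comm]
    rw [h4]
    refine Submodule.sum_mem _ fun j _ => Submodule.smul_mem _ _ ?_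
    exact vsub_mem_vectorSpan ℝ (latticePoint_bitVec_mem_maskHull (h1 _).1 (h1 _).2)
      (latticePoint_bitVec_mem_maskHull (h1 _).1 (h1 _).2)
  rw [polytopeDim, h3, finrank_top, Module.finrank_fin_fun]

theorem polytopeDim_eq : polytopeDim r.polytope = r.dim := by
  rw [← r.areEquivalent_maskHull.polytopeDim_eq, polytopeDim_maskHull]

theorem flow_mem {x : ℕ} (hx : x < 2 ^ r.dim) (h : r.mask.testBit x = true) :
    latticePoint (r.flow x) ∈ r.polytope := by
  rw [← param_bitVec, ← param_image_maskHull]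
  exact ⟨_, latticePoint_bitVec_mem_maskHull hx h, rfl⟩

/-- Every facet lies in some hyperplane x_a = 0, and then x_a itself is the required function: it
has values in [0, 1], is integral on lattice points, and takes every integer value on the lattice of
the affine span. -/
theorem isCompressed : IsCompressed r.polytope := by
  refine ⟨r.isLatticePolytope, fun F hF => ?_⟩
  obtain ⟨hne, hexp, hdim⟩ := hF
  have hFc := hexp.convex r.convex_polytope
  obtain ⟨l, rfl⟩ := hexp hne
  set F := {x | x ∈ r.polytope ∧ ∀ y ∈ r.polytope, l y ≤ l x} with hFdef
  have hFP : F ⊆ r.polytope := fun x hx => hx.1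
  let proj : ∀ a : Fin r.pair.numArrows, (Fin r.pair.numArrows → ℝ) →ᵃ[ℝ] ℝ :=
    fun a => (LinearMap.proj a).toAffineMap
  have hproj : ∀ a x, proj a x = x a := fun a x => rfl
  obtain ⟨z, hz, hz'⟩ := exists_interior hFc hne proj fun a x hx => (hFP hx).2 a
  have hex : ∃ a, ∀ x ∈ F, x a = 0 := by
    by_contra hcon
    push Not at hcon
    have hpos : ∀ a, 0 < z a := fun a => by
      obtain ⟨x, hx, hxa⟩ := hcon a
      exact hz' a ⟨x, hx, lt_of_le_of_ne ((hFP hx).2 a) hxa.symm⟩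
    -- A point z of F with all flows positive allows the segment from p to be prolonged beyond z.
    -- Maximality of l at z then gives l z ≤ l p, so F is everything, against its dimension.
    have hPF : r.polytope ⊆ F := by
      intro p hp
      refine ⟨hp, fun y hy => (hz.2 y hy).trans ?_⟩
      obtain ⟨ε, hε, h1⟩ := exists_small_affine_step proj z (z - p)
        (fun a => (hpos a).le) (fun a _ => hpos a)
      have h2 : z + ε • (z - p) ∈ r.polytope :=
        ⟨FlowQuiver.flowSpace_add_smul _ hz.1.1 (FlowQuiver.flowSpace_sub _ hz.1.1 hp.1) ε,
          fun a => h1 ε (by rw [abs_of_pos hε]) a⟩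
      have h3 := hz.2 _ h2
      simp only [map_add, map_smul, map_sub, smul_eq_mul] at h3
      by_contra h4
      push Not at h4
      nlinarith [mul_pos hε (sub_pos.2 h4)]
    have := subset_antisymm hPF hFP
    rw [← this] at hdim
    omega
  obtain ⟨a, ha⟩ := hex
  refine ⟨proj a, ?_, ha, fun x hx => ⟨hx.2 a, r.le_one_of_mem hx a⟩⟩
  apply subset_antisymm
  · rintro _ ⟨x, ⟨-, w, rfl⟩, rfl⟩
    exact ⟨w a, rfl⟩
  · rintro _ ⟨n, rfl⟩
    obtain ⟨⟨p, hp, hp', hpa⟩, q, hq, hq', hqa⟩ := r.exists_flow_eq a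
    have h1 := r.flow_mem hp hp'
    have h2 := r.flow_mem hq hq'
    refine ⟨latticePoint (r.flow p) + (n : ℝ) •
      (latticePoint (r.flow q) - latticePoint (r.flow p)), ⟨?_, ?_⟩, ?_⟩
    · exact add_smul_mem_affineSpan (subset_affineSpan ℝ _ h1) (vsub_mem_vectorSpan ℝ h2 h1) _
    · exact latticePoints_add (latticePoint_mem _)
        (latticePoints_smul (latticePoints_sub (latticePoint_mem _) (latticePoint_mem _)) n)
    · simp [hproj, latticePoint, hpa, hqa]

end Row

/-! ### Classification of the masks that the search leaves -/

theorem areEquivalent_maskHull {d V W : ℕ} {M N : Matrix (Fin d) (Fin d) ℤ} {c : Fin d → ℤ}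
    (hNM : N * M = 1)
    (h : ∀ x < 2 ^ d, W.testBit x = true → ∃ y < 2 ^ d, V.testBit y = true ∧
      ∀ k, ∑ i, M k i * bitVec d x i + c k = bitVec d y k)
    (h' : ∀ y < 2 ^ d, V.testBit y = true → ∃ x < 2 ^ d, W.testBit x = true ∧
      ∀ k, ∑ i, M k i * bitVec d x i + c k = bitVec d y k) :
    AreEquivalent (maskHull d W) (maskHull d V) := by
  have h1 : intAffine M c '' maskHull d W = maskHull d V := by
    unfold maskHull
    rw [AffineMap.image_convexHull]
    congr 1
    ext p
    constructor
    · rintro ⟨_, ⟨_, ⟨x, hx, hx', rfl⟩, rfl⟩, rfl⟩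
      obtain ⟨y, hy, hy', hxy⟩ := h x hx hx'
      exact ⟨_, ⟨y, hy, hy', rfl⟩, by rw [intAffine_latticePoint, ← funext hxy]⟩
    · rintro ⟨_, ⟨y, hy, hy', rfl⟩, rfl⟩
      obtain ⟨x, hx, hx', hxy⟩ := h' y hy hy'
      exact ⟨_, ⟨_, ⟨x, hx, hx', rfl⟩, rfl⟩, by rw [intAffine_latticePoint, ← funext hxy]⟩
  rw [← h1]
  exact areEquivalent_intAffine hNM c _

/-- A unimodular affine map between two masks. -/
structure MaskCert (d : ℕ) where
  target : ℕ
  source : ℕ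
  linear : Fin d → Fin d → ℤ
  shift : Fin d → ℤ
  inverse : Fin d → Fin d → ℤ

/-- The point with the binary digits of `x` is mapped to that with the binary digits of `y`. -/
def MaskCert.Maps {d : ℕ} (C : MaskCert d) (x y : ℕ) : Prop :=
  ∀ k, ∑ i, C.linear k i * bitVec d x i + C.shift k = bitVec d y k

instance {d : ℕ} (C : MaskCert d) (x y : ℕ) : Decidable (C.Maps x y) :=
  inferInstanceAs (Decidable (∀ _, _))

/-- The map is invertible and maps the source onto the target. -/
def MaskCert.Valid {d : ℕ} (C : MaskCert d) : Prop :=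
  (∀ i j, ∑ k, C.inverse i k * C.linear k j = if i = j then 1 else 0) ∧
  (∀ x < 2 ^ d, C.source.testBit x = true → ∃ y < 2 ^ d, C.target.testBit y = true ∧ C.Maps x y) ∧
  ∀ y < 2 ^ d, C.target.testBit y = true → ∃ x < 2 ^ d, C.source.testBit x = true ∧ C.Maps x y

instance {d : ℕ} (C : MaskCert d) : Decidable C.Valid := inferInstanceAs (Decidable (_ ∧ _))

theorem MaskCert.Valid.areEquivalent {d : ℕ} {C : MaskCert d} (h : C.Valid) :
    AreEquivalent (maskHull d C.source) (maskHull d C.target) := by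
  refine areEquivalent_maskHull (M := Matrix.of C.linear) (N := Matrix.of C.inverse) ?_ h.2.1 h.2.2
  ext i j
  rw [Matrix.mul_apply, Matrix.one_apply, ← h.1]
  rfl

/-- Normal forms of the three-dimensional masks. -/
def maskCerts3 : List (MaskCert 3) :=
  [⟨23, 23, ![![1, 0, 0], ![0, 1, 0], ![0, 0, 1]], ![0, 0, 0],
     ![![1, 0, 0], ![0, 1, 0], ![0, 0, 1]]⟩,
   ⟨31, 103, ![![0, 1, 0], ![0, 0, 1], ![-1, -1, 0]], ![0, 0, 1],
     ![![-1, 0, -1], ![1, 0, 0], ![0, 1, 0]]⟩,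
   ⟨61, 103, ![![0, 0, 1], ![1, 0, 0], ![0, 1, 0]], ![0, 0, 0],
     ![![0, 1, 0], ![0, 0, 1], ![1, 0, 0]]⟩,
   ⟨63, 119, ![![0, 0, 1], ![1, 0, 0], ![0, 1, 0]], ![0, 0, 0],
     ![![0, 1, 0], ![0, 0, 1], ![1, 0, 0]]⟩,
   ⟨189, 126, ![![-1, 0, 0], ![0, 1, 0], ![0, 0, 1]], ![1, 0, 0],
     ![![-1, 0, 0], ![0, 1, 0], ![0, 0, 1]]⟩,
   ⟨255, 255, ![![1, 0, 0], ![0, 1, 0], ![0, 0, 1]], ![0, 0, 0],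
     ![![1, 0, 0], ![0, 1, 0], ![0, 0, 1]]⟩]

/-- Normal forms of the four-dimensional masks. -/
def maskCerts4 : List (MaskCert 4) :=
  [⟨279, 279, ![![1, 0, 0, 0], ![0, 1, 0, 0], ![0, 0, 1, 0], ![0, 0, 0, 1]], ![0, 0, 0, 0],
     ![![1, 0, 0, 0], ![0, 1, 0, 0], ![0, 0, 1, 0], ![0, 0, 0, 1]]⟩,
   ⟨287, 359, ![![0, 1, 0, 0], ![0, 0, 1, 0], ![-1, -1, 0, -1], ![0, 0, 0, 1]], ![0, 0, 1, 0],
     ![![-1, 0, -1, -1], ![1, 0, 0, 0], ![0, 1, 0, 0], ![0, 0, 0, 1]]⟩,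
   ⟨317, 359, ![![0, 0, 1, 0], ![1, 0, 0, 0], ![0, 1, 0, 0], ![0, 0, 0, 1]], ![0, 0, 0, 0],
     ![![0, 1, 0, 0], ![0, 0, 1, 0], ![1, 0, 0, 0], ![0, 0, 0, 1]]⟩,
   ⟨319, 1639, ![![0, 1, 0, 0], ![0, 0, 1, 0], ![0, 0, 0, 1], ![-1, -1, 0, 0]], ![0, 0, 0, 1],
     ![![-1, 0, 0, -1], ![1, 0, 0, 0], ![0, 1, 0, 0], ![0, 0, 1, 0]]⟩,
   ⟨511, 21847, ![![0, 1, 0, 0], ![0, 0, 1, 0], ![0, 0, 0, 1], ![1, 0, 0, 0]], ![0, 0, 0, 0],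
     ![![0, 0, 0, 1], ![1, 0, 0, 0], ![0, 1, 0, 0], ![0, 0, 1, 0]]⟩,
   ⟨829, 1639, ![![0, 1, 0, 0], ![1, 1, -1, -1], ![0, 0, 1, 0], ![0, 0, 0, 1]], ![0, 0, 0, 0],
     ![![-1, 1, 1, 1], ![1, 0, 0, 0], ![0, 0, 1, 0], ![0, 0, 0, 1]]⟩,
   ⟨831, 5911, ![![0, 0, 0, 1], ![1, 0, 0, 0], ![0, 1, 0, 0], ![0, 0, 1, 0]], ![0, 0, 0, 0],
     ![![0, 1, 0, 0], ![0, 0, 1, 0], ![0, 0, 0, 1], ![1, 0, 0, 0]]⟩,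
   ⟨855, 886, ![![0, 0, -1, -1], ![-1, -1, 0, 0], ![0, 0, 0, 1], ![0, 1, 0, 0]], ![1, 1, 0, 0],
     ![![0, -1, 0, -1], ![0, 0, 0, 1], ![-1, 0, -1, 0], ![0, 0, 1, 0]]⟩,
   ⟨857, 854, ![![-1, 0, -1, 0], ![0, 1, 0, 0], ![0, 0, 1, 0], ![0, 0, 0, 1]], ![1, 0, 0, 0],
     ![![-1, 0, -1, 0], ![0, 1, 0, 0], ![0, 0, 1, 0], ![0, 0, 0, 1]]⟩,
   ⟨859, 886, ![![0, 0, 1, 0], ![-1, -1, 0, 0], ![0, 0, 0, 1], ![0, 1, 0, 0]], ![0, 1, 0, 0],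
     ![![0, -1, 0, -1], ![0, 0, 0, 1], ![1, 0, 0, 0], ![0, 0, 1, 0]]⟩,
   ⟨861, 886, ![![-1, -1, 0, 0], ![0, 0, 1, 0], ![0, 1, 0, 0], ![0, 0, 0, 1]], ![1, 0, 0, 0],
     ![![-1, 0, -1, 0], ![0, 0, 1, 0], ![0, 1, 0, 0], ![0, 0, 0, 1]]⟩,
   ⟨863, 9783, ![![0, 0, 0, 1], ![0, 0, 1, 0], ![-1, -1, 0, 0], ![0, 1, 0, 0]], ![0, 0, 1, 0],
     ![![0, 0, -1, -1], ![0, 0, 0, 1], ![0, 1, 0, 0], ![1, 0, 0, 0]]⟩,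
   ⟨917, 854, ![![1, 1, 1, 1], ![0, 1, 0, 0], ![0, 0, 1, 0], ![0, 0, 0, 1]], ![-1, 0, 0, 0],
     ![![1, -1, -1, -1], ![0, 1, 0, 0], ![0, 0, 1, 0], ![0, 0, 0, 1]]⟩,
   ⟨925, 886, ![![1, 1, 1, 1], ![0, 0, 1, 0], ![0, 1, 0, 0], ![0, 0, 0, 1]], ![-1, 0, 0, 0],
     ![![1, -1, -1, -1], ![0, 0, 1, 0], ![0, 1, 0, 0], ![0, 0, 0, 1]]⟩,
   ⟨957, 21566, ![![0, 0, 1, 0], ![1, 1, 1, 0], ![0, 0, 0, 1], ![-1, 0, 0, -1]], ![0, -1, 0, 1],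
     ![![0, 0, -1, -1], ![-1, 1, 1, 1], ![1, 0, 0, 0], ![0, 0, 1, 0]]⟩,
   ⟨981, 886, ![![-1, -1, 0, 0], ![0, -1, 0, -1], ![0, 0, 1, 0], ![0, 0, 0, 1]], ![1, 1, 0, 0],
     ![![-1, 1, 0, 1], ![0, -1, 0, -1], ![0, 0, 1, 0], ![0, 0, 0, 1]]⟩,
   ⟨985, 886, ![![1, 0, 0, 0], ![0, -1, 0, -1], ![0, 0, 1, 0], ![0, 0, 0, 1]], ![0, 1, 0, 0],
     ![![1, 0, 0, 0], ![0, -1, 0, -1], ![0, 0, 1, 0], ![0, 0, 0, 1]]⟩,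
   ⟨987, 21566, ![![0, 0, 1, 0], ![0, 0, 0, 1], ![0, -1, -1, 1], ![-1, 0, 0, -1]], ![0, 0, 1, 1],
     ![![0, -1, 0, -1], ![-1, 1, -1, 0], ![1, 0, 0, 0], ![0, 1, 0, 0]]⟩,
   ⟨989, 9783, ![![0, 0, 0, 1], ![1, 0, 0, 0], ![0, 0, 1, 0], ![0, 1, 0, 0]], ![0, 0, 0, 0],
     ![![0, 1, 0, 0], ![0, 0, 0, 1], ![0, 0, 1, 0], ![1, 0, 0, 0]]⟩,
   ⟨1023, 26471, ![![0, 0, 0, 1], ![0, 1, 0, 0], ![0, 0, 1, 0], ![-1, -1, 0, 0]], ![0, 0, 0, 1],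
     ![![0, -1, 0, -1], ![0, 1, 0, 0], ![0, 0, 1, 0], ![1, 0, 0, 0]]⟩,
   ⟨1639, 1639, ![![1, 0, 0, 0], ![0, 1, 0, 0], ![0, 0, 1, 0], ![0, 0, 0, 1]], ![0, 0, 0, 0],
     ![![1, 0, 0, 0], ![0, 1, 0, 0], ![0, 0, 1, 0], ![0, 0, 0, 1]]⟩,
   ⟨1651, 886, ![![1, 0, 0, 0], ![-1, -1, 0, 0], ![0, 0, 1, 0], ![0, 0, 0, 1]], ![0, 1, 0, 0],
     ![![1, 0, 0, 0], ![-1, -1, 0, 0], ![0, 0, 1, 0], ![0, 0, 0, 1]]⟩,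
   ⟨1655, 9783, ![![1, 1, 0, -1], ![0, 0, 0, 1], ![0, 0, 1, 0], ![0, 1, 0, 0]], ![0, 0, 0, 0],
     ![![1, 1, 0, -1], ![0, 0, 0, 1], ![0, 0, 1, 0], ![0, 1, 0, 0]]⟩,
   ⟨1767, 21566, ![![0, 1, 0, 0], ![0, 0, 1, 0], ![0, 0, 0, 1], ![-1, 0, 0, -1]], ![0, 0, 0, 1],
     ![![0, 0, -1, -1], ![1, 0, 0, 0], ![0, 1, 0, 0], ![0, 0, 1, 0]]⟩,
   ⟨1905, 1639, ![![0, 0, 1, 0], ![0, 0, 0, 1], ![1, 0, 0, 0], ![0, 1, 0, 0]], ![0, 0, 0, 0],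
     ![![0, 0, 1, 0], ![0, 0, 0, 1], ![1, 0, 0, 0], ![0, 1, 0, 0]]⟩,
   ⟨1907, 9783, ![![0, 0, 1, 0], ![0, 1, 0, 0], ![1, 1, 0, -1], ![0, 0, 0, 1]], ![0, 0, 0, 0],
     ![![0, -1, 1, 1], ![0, 1, 0, 0], ![1, 0, 0, 0], ![0, 0, 0, 1]]⟩,
   ⟨1911, 1911, ![![1, 0, 0, 0], ![0, 1, 0, 0], ![0, 0, 1, 0], ![0, 0, 0, 1]], ![0, 0, 0, 0],
     ![![1, 0, 0, 0], ![0, 1, 0, 0], ![0, 0, 1, 0], ![0, 0, 0, 1]]⟩,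
   ⟨2019, 21566, ![![0, 0, 1, 0], ![0, -1, -1, 1], ![0, 0, 0, 1], ![1, 0, 0, 0]], ![0, 1, 0, 0],
     ![![0, 0, 0, 1], ![-1, -1, 1, 0], ![1, 0, 0, 0], ![0, 0, 1, 0]]⟩,
   ⟨2023, 26750, ![![0, -1, 0, 0], ![-1, 0, 0, 0], ![-1, -1, -1, 0], ![0, 0, 0, 1]], ![1, 1, 2, 0],
     ![![0, -1, 0, 0], ![-1, 0, 0, 0], ![1, 1, -1, 0], ![0, 0, 0, 1]]⟩,
   ⟨2485, 886, ![![1, 1, 1, 1], ![1, 0, 0, 0], ![0, 0, 1, 0], ![0, 0, 0, 1]], ![-1, 0, 0, 0],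
     ![![0, 1, 0, 0], ![1, -1, -1, -1], ![0, 0, 1, 0], ![0, 0, 0, 1]]⟩,
   ⟨2493, 21566, ![![0, 0, 1, 0], ![0, -1, 0, 0], ![0, 0, 0, 1], ![-1, 0, 0, -1]], ![0, 1, 0, 1],
     ![![0, 0, -1, -1], ![0, -1, 0, 0], ![1, 0, 0, 0], ![0, 0, 1, 0]]⟩,
   ⟨2997, 9783, ![![1, 0, 0, 0], ![0, 0, 1, 0], ![1, 1, 0, -1], ![0, 0, 0, 1]], ![0, 0, 0, 0],
     ![![1, 0, 0, 0], ![-1, 0, 1, 1], ![0, 1, 0, 0], ![0, 0, 0, 1]]⟩,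
   ⟨3005, 26750, ![![0, 0, 1, 0], ![-1, 0, 0, 0], ![1, 1, 1, -1], ![0, 0, 0, 1]], ![0, 1, -1, 0],
     ![![0, -1, 0, 0], ![-1, 1, 1, 1], ![1, 0, 0, 0], ![0, 0, 0, 1]]⟩,
   ⟨3027, 21566, ![![0, 0, 1, 0], ![1, 1, 1, 0], ![1, 0, 0, 0], ![0, 0, 0, 1]], ![0, -1, 0, 0],
     ![![0, 0, 1, 0], ![-1, 1, -1, 0], ![1, 0, 0, 0], ![0, 0, 0, 1]]⟩,
   ⟨3029, 21566, ![![1, 1, 1, 0], ![0, 0, 1, 0], ![0, 0, 0, 1], ![1, 0, 0, 0]], ![-1, 0, 0, 0],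
     ![![0, 0, 0, 1], ![1, -1, 0, -1], ![0, 1, 0, 0], ![0, 0, 1, 0]]⟩,
   ⟨3033, 21566, ![![0, 0, 1, 0], ![0, -1, 0, 0], ![1, 0, 0, 0], ![0, 0, 0, 1]], ![0, 1, 0, 0],
     ![![0, 0, 1, 0], ![0, -1, 0, 0], ![1, 0, 0, 0], ![0, 0, 0, 1]]⟩,
   ⟨3035, 26750, ![![0, 0, 1, 0], ![-1, 0, 0, 0], ![-1, -1, -1, 0], ![0, 0, 0, 1]], ![0, 1, 2, 0],
     ![![0, -1, 0, 0], ![-1, 1, -1, 0], ![1, 0, 0, 0], ![0, 0, 0, 1]]⟩,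
   ⟨3037, 26750, ![![-1, 0, 0, 0], ![0, 0, 1, 0], ![0, 0, 0, 1], ![-1, -1, -1, 0]], ![1, 0, 0, 2],
     ![![-1, 0, 0, 0], ![1, -1, 0, -1], ![0, 1, 0, 0], ![0, 0, 1, 0]]⟩,
   ⟨3815, 26750, ![![0, 1, 0, 0], ![0, 0, 1, 0], ![1, 1, 1, -1], ![0, 0, 0, 1]], ![0, 0, -1, 0],
     ![![-1, -1, 1, 1], ![1, 0, 0, 0], ![0, 1, 0, 0], ![0, 0, 0, 1]]⟩,
   ⟨4081, 21847, ![![0, 1, 0, 0], ![0, 0, 1, 0], ![-1, 0, 0, -1], ![0, 0, 0, 1]], ![0, 0, 1, 0],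
     ![![0, 0, -1, -1], ![1, 0, 0, 0], ![0, 1, 0, 0], ![0, 0, 0, 1]]⟩,
   ⟨4083, 26471, ![![0, 0, 0, 1], ![0, 0, 1, 0], ![1, 0, 0, 0], ![0, 1, 0, 0]], ![0, 0, 0, 0],
     ![![0, 0, 1, 0], ![0, 0, 0, 1], ![0, 1, 0, 0], ![1, 0, 0, 0]]⟩,
   ⟨4095, 30583, ![![0, 0, 1, 0], ![0, 0, 0, 1], ![1, 0, 0, 0], ![0, 1, 0, 0]], ![0, 0, 0, 0],
     ![![0, 0, 1, 0], ![0, 0, 0, 1], ![1, 0, 0, 0], ![0, 1, 0, 0]]⟩,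
   ⟨10653, 21566, ![![0, 0, 1, 0], ![0, -1, 0, 0], ![1, 1, 1, 0], ![0, 0, 0, 1]], ![0, 1, -1, 0],
     ![![-1, 1, 1, 0], ![0, -1, 0, 0], ![1, 0, 0, 0], ![0, 0, 0, 1]]⟩,
   ⟨10685, 26750, ![![0, 0, 1, 0], ![0, -1, 0, 0], ![-1, 0, 0, 0], ![0, 0, 0, 1]], ![0, 1, 1, 0],
     ![![0, 0, -1, 0], ![0, -1, 0, 0], ![1, 0, 0, 0], ![0, 0, 0, 1]]⟩,
   ⟨11197, 6014, ![![-1, 0, 0, 0], ![0, 1, 0, 0], ![0, 0, 1, 0], ![0, 0, 0, 1]], ![1, 0, 0, 0],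
     ![![-1, 0, 0, 0], ![0, 1, 0, 0], ![0, 0, 1, 0], ![0, 0, 0, 1]]⟩,
   ⟨34407, 21566, ![![0, 1, 0, 0], ![0, 0, 1, 0], ![1, 1, 1, 0], ![0, 0, 0, 1]], ![0, 0, -1, 0],
     ![![-1, -1, 1, 0], ![1, 0, 0, 0], ![0, 1, 0, 0], ![0, 0, 0, 1]]⟩,
   ⟨34535, 26750, ![![0, 1, 0, 0], ![0, 0, 1, 0], ![-1, 0, 0, 0], ![0, 0, 0, 1]], ![0, 0, 1, 0],
     ![![0, 0, -1, 0], ![1, 0, 0, 0], ![0, 1, 0, 0], ![0, 0, 0, 1]]⟩,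
   ⟨34673, 21566, ![![1, 1, 1, 0], ![0, 0, 0, 1], ![0, 1, 0, 0], ![0, 0, 1, 0]], ![-1, 0, 0, 0],
     ![![1, 0, -1, -1], ![0, 0, 1, 0], ![0, 0, 0, 1], ![0, 1, 0, 0]]⟩,
   ⟨36583, 6014, ![![0, -1, 0, 0], ![-1, 0, 0, 0], ![0, 0, 1, 0], ![0, 0, 0, 1]], ![1, 1, 0, 0],
     ![![0, -1, 0, 0], ![-1, 0, 0, 0], ![0, 0, 1, 0], ![0, 0, 0, 1]]⟩,
   ⟨36849, 28278, ![![0, 0, -1, 0], ![0, 0, 0, 1], ![1, 0, 0, 0], ![0, 1, 0, 0]], ![1, 0, 0, 0],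
     ![![0, 0, 1, 0], ![0, 0, 0, 1], ![-1, 0, 0, 0], ![0, 1, 0, 0]]⟩,
   ⟨39897, 28278, ![![0, 1, 0, 0], ![-1, 0, 0, 0], ![0, 0, 1, 0], ![0, 0, 0, 1]], ![0, 1, 0, 0],
     ![![0, -1, 0, 0], ![1, 0, 0, 0], ![0, 0, 1, 0], ![0, 0, 0, 1]]⟩,
   ⟨43989, 28278, ![![-1, 0, 0, 0], ![0, 0, 0, -1], ![0, 0, 1, 0], ![0, 1, 0, 0]], ![1, 1, 0, 0],
     ![![-1, 0, 0, 0], ![0, 0, 0, 1], ![0, 0, 1, 0], ![0, -1, 0, 0]]⟩,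
   ⟨45045, 32382, ![![1, 1, 1, 0], ![0, 0, 0, 1], ![0, 1, 0, 0], ![0, 0, 1, 0]], ![-1, 0, 0, 0],
     ![![1, 0, -1, -1], ![0, 0, 1, 0], ![0, 0, 0, 1], ![0, 1, 0, 0]]⟩,
   ⟨65535, 65535, ![![1, 0, 0, 0], ![0, 1, 0, 0], ![0, 0, 1, 0], ![0, 0, 0, 1]], ![0, 0, 0, 0],
     ![![1, 0, 0, 0], ![0, 1, 0, 0], ![0, 0, 1, 0], ![0, 0, 0, 1]]⟩]

theorem maskCerts3_valid : ∀ C ∈ maskCerts3, C.Valid := by decide +kernel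

theorem maskCerts4_valid : ∀ C ∈ maskCerts4, C.Valid := by decide +kernel

/-! ### Products of masks -/

/-- The product of two masks. -/
def prodMask (i j A B : ℕ) : ℕ :=
  maskOf (fun x => A.testBit (x % 2 ^ i) && B.testBit (x / 2 ^ i)) (2 ^ (i + j))

theorem bitVec_prod {i j x y : ℕ} (hx : x < 2 ^ i) :
    bitVec (i + j) (x + 2 ^ i * y) = Fin.append (bitVec i x) (bitVec j y) := by
  ext k
  refine Fin.addCases (fun k => ?_) (fun k => ?_) k
  · rw [Fin.append_left]
    simp [bitVec, add_comm x, Nat.testBit_two_pow_mul_add _ hx]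
  · rw [Fin.append_right]
    simp [bitVec, add_comm x, Nat.testBit_two_pow_mul_add _ hx]

/-- The low i binary digits of an index give the point of the first factor and the high j digits
that of the second; the hull of a product is the product of the hulls. The linear equivalence g
passes to pairs, where that fact applies. -/
theorem areEquivalent_prodMask (i j A B : ℕ) :
    AreEquivalent (maskHull (i + j) (prodMask i j A B))
      (polytopeProd (maskHull i A) (maskHull j B)) := by
  let e : (Fin (i + j) → ℝ) ≃ₗ[ℝ] (Fin i ⊕ Fin j → ℝ) :=
    LinearEquiv.funCongrLeft ℝ ℝ finSumFinEquiv
  let g : (Fin i ⊕ Fin j → ℝ) ≃ₗ[ℝ] (Fin i → ℝ) × (Fin j → ℝ) :=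
    LinearEquiv.sumArrowLequivProdArrow _ _ ℝ ℝ
  have h1 : e.toLinearMap.toAffineMap '' maskHull (i + j) (prodMask i j A B)
      = polytopeProd (maskHull i A) (maskHull j B) := by
    apply g.injective.image_injective
    have h2 : g '' polytopeProd (maskHull i A) (maskHull j B) = maskHull i A ×ˢ maskHull j B := by
      rw [LinearEquiv.image_eq_preimage_symm]
      ext p
      exact Iff.rfl
    rw [h2]
    unfold maskHull
    rw [← convexHull_prod, AffineMap.image_convexHull]
    rw [← g.coe_toLinearMap, LinearMap.image_convexHull]
    congr 1
    ext p
    constructor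
    · rintro ⟨_, ⟨_, ⟨_, ⟨x, hx, hx', rfl⟩, rfl⟩, rfl⟩, rfl⟩
      rw [prodMask, testBit_maskOf] at hx'
      simp only [hx, decide_true, Bool.true_and, Bool.and_eq_true] at hx'
      have h3 : x % 2 ^ i < 2 ^ i := Nat.mod_lt _ (by positivity)
      have h4 := bitVec_prod (j := j) (y := x / 2 ^ i) h3
      rw [Nat.mod_add_div] at h4
      refine ⟨⟨_, ⟨x % 2 ^ i, h3, hx'.1, rfl⟩, ?_⟩, ⟨_, ⟨x / 2 ^ i, ?_, hx'.2, rfl⟩, ?_⟩⟩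
      · ext k
        simp [g, e, h4, latticePoint, LinearEquiv.funCongrLeft]
      · exact Nat.div_lt_of_lt_mul (by rwa [← pow_add])
      · ext k
        simp [g, e, h4, latticePoint, LinearEquiv.funCongrLeft]
    · obtain ⟨p₁, p₂⟩ := p
      rintro ⟨⟨_, ⟨x, hx, hx', rfl⟩, rfl⟩, ⟨_, ⟨y, hy, hy', rfl⟩, rfl⟩⟩
      have h4 := bitVec_prod (j := j) (y := y) hx
      refine ⟨_, ⟨_, ⟨_, ⟨x + 2 ^ i * y, ?_, ?_, rfl⟩, rfl⟩, rfl⟩, ?_⟩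
      · calc x + 2 ^ i * y < 2 ^ i * 1 + 2 ^ i * y := by omega
          _ = 2 ^ i * (y + 1) := by ring
          _ ≤ 2 ^ i * 2 ^ j := Nat.mul_le_mul_left _ hy
          _ = 2 ^ (i + j) := (pow_add _ _ _).symm
      · rw [prodMask, testBit_maskOf]
        have h5 : x + 2 ^ i * y < 2 ^ (i + j) := by
          calc x + 2 ^ i * y < 2 ^ i * 1 + 2 ^ i * y := by omega
            _ = 2 ^ i * (y + 1) := by ring
            _ ≤ 2 ^ i * 2 ^ j := Nat.mul_le_mul_left _ hy
            _ = 2 ^ (i + j) := (pow_add _ _ _).symm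
        simp [h5, Nat.add_mul_mod_self_left, Nat.mod_eq_of_lt hx, hx', hy',
          Nat.add_mul_div_left, Nat.div_eq_of_lt hx]
      · ext k <;> simp [g, e, h4, latticePoint, LinearEquiv.funCongrLeft]
  rw [← h1]
  refine areEquivalent_of_section _ e.symm.toLinearMap.toAffineMap ?_ ?_ (by simp) _
  · rintro _ ⟨z, rfl⟩
    exact ⟨fun k => z (finSumFinEquiv k), rfl⟩
  · rintro _ ⟨z, rfl⟩
    exact ⟨fun k => z (finSumFinEquiv.symm k), rfl⟩

theorem polytopeDim_le (d : ℕ) (P : Set (Fin d → ℝ)) : polytopeDim P ≤ d := by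
  have := (vectorSpan ℝ P).finrank_le
  rwa [Module.finrank_fin_fun] at this

/-- `P` is equivalent to a polytope of the table of dimension `d` or to a product of polytopes of
smaller dimension. -/
def IsClassified {ι : Type*} (d : ℕ) (P : Set (ι → ℝ)) : Prop :=
  (∃ r : Row, r.dim = d ∧ AreEquivalent P r.polytope) ∨
  ∃ (m n : ℕ) (P₁ : Set (Fin m → ℝ)) (P₂ : Set (Fin n → ℝ)),
    IsLatticePolytope P₁ ∧ IsLatticePolytope P₂ ∧ polytopeDim P₁ < d ∧ polytopeDim P₂ < d ∧
    AreEquivalent P (polytopeProd P₁ P₂)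

theorem IsClassified.congr {ι κ : Type*} {d : ℕ} {P : Set (ι → ℝ)} {P' : Set (κ → ℝ)}
    (h : AreEquivalent P P') (hP' : IsClassified d P') : IsClassified d P := by
  rcases hP' with ⟨r, hr, h1⟩ | ⟨m, n, P₁, P₂, h1, h2, h3, h4, h5⟩
  · exact Or.inl ⟨r, hr, h.trans h1⟩
  · exact Or.inr ⟨m, n, P₁, P₂, h1, h2, h3, h4, h.trans h5⟩

theorem isClassified_mask {d : ℕ} {r : Row} (h : r.dim = d) :
    IsClassified d (maskHull d r.mask) := by
  subst h
  exact Or.inl ⟨r, rfl, r.areEquivalent_maskHull⟩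

theorem isClassified_prodMask {i j : ℕ} (hi : 0 < i) (hj : 0 < j) (A B : ℕ) :
    IsClassified (i + j) (maskHull (i + j) (prodMask i j A B)) :=
  Or.inr ⟨i, j, _, _, isLatticePolytope_maskHull i A, isLatticePolytope_maskHull j B,
    (polytopeDim_le _ _).trans_lt (by omega), (polytopeDim_le _ _).trans_lt (by omega),
    areEquivalent_prodMask i j A B⟩

theorem isClassified_source3 : ∀ C ∈ maskCerts3, IsClassified 3 (maskHull 3 C.source) := by
  suffices h : ∀ W ∈ maskCerts3.map MaskCert.source, IsClassified 3 (maskHull 3 W) from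
    fun C hC => h _ (List.mem_map_of_mem hC)
  -- In dimension one the mask 3 is the unit segment; in dimension two 7 is a triangle and 15 a
  -- square.
  have h : ∀ W ∈ maskCerts3.map MaskCert.source, W ∈ [Row.Ia3, Row.IIc3, Row.Ib3].map Row.mask ∨
      W ∈ [7, 15].map fun A => prodMask 2 1 A 3 := by decide +kernel
  intro W hW
  rcases h W hW with h | h
  · obtain ⟨r, hr, rfl⟩ := List.mem_map.1 h
    have hdim : ∀ r ∈ [Row.Ia3, Row.IIc3, Row.Ib3], r.dim = 3 := by simp [Row.dim]
    exact isClassified_mask (hdim r hr)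
  · obtain ⟨A, -, rfl⟩ := List.mem_map.1 h
    exact isClassified_prodMask (i := 2) (j := 1) (by norm_num) (by norm_num) A 3

theorem isClassified_source4 : ∀ C ∈ maskCerts4, IsClassified 4 (maskHull 4 C.source) := by
  suffices h : ∀ W ∈ maskCerts4.map MaskCert.source, IsClassified 4 (maskHull 4 W) from
    fun C hC => h _ (List.mem_map_of_mem hC)
  have h : ∀ W ∈ maskCerts4.map MaskCert.source,
      W ∈ [Row.IIc4, Row.Id4, Row.IIf4, Row.IIId4, Row.Ia4, Row.Vb4, Row.VIc4, Row.VIIb4,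
        Row.VIIIa4, Row.IXa4, Row.Xa4].map Row.mask ∨
      (W ∈ [23, 103, 126].map fun A => prodMask 3 1 A 3) ∨
      W ∈ [(7, 7), (7, 15), (15, 15)].map fun A => prodMask 2 2 A.1 A.2 := by decide +kernel
  intro W hW
  rcases h W hW with h | h | h
  · obtain ⟨r, hr, rfl⟩ := List.mem_map.1 h
    have hdim : ∀ r ∈ [Row.IIc4, Row.Id4, Row.IIf4, Row.IIId4, Row.Ia4, Row.Vb4, Row.VIc4,
        Row.VIIb4, Row.VIIIa4, Row.IXa4, Row.Xa4], r.dim = 4 := by simp [Row.dim]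
    exact isClassified_mask (hdim r hr)
  · obtain ⟨A, -, rfl⟩ := List.mem_map.1 h
    exact isClassified_prodMask (i := 3) (j := 1) (by norm_num) (by norm_num) A 3
  · obtain ⟨A, -, rfl⟩ := List.mem_map.1 h
    exact isClassified_prodMask (i := 2) (j := 2) (by norm_num) (by norm_num) A.1 A.2

/-! ### Permutations of the coordinates -/

/-- The mask moved by an exchange of coordinates: `s` holds the fixed bits, and the bits of `m`
are exchanged with those `h` places higher. -/
def swapMask (s m h V : ℕ) : ℕ := V &&& s ||| (V &&& m) <<< h ||| (V >>> h) &&& m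

/-- The index moved by the exchange of the binary digits `k` and `k + 1`. -/
def swapIndex (k x : ℕ) : ℕ := if x.testBit k = x.testBit (k + 1) then x else x ^^^ (3 <<< k)

/-- The three cases are that the bit stays, comes from h places below, or comes from h places above.
The side conditions switch off the other two terms of `swapMask`. -/
theorem testBit_swapMask {s m h x y : ℕ} (V : ℕ)
    (H : (y = x ∧ s.testBit x = true ∧ ¬(h ≤ x ∧ m.testBit (x - h) = true) ∧ m.testBit x = false) ∨
      (y + h = x ∧ s.testBit x = false ∧ m.testBit y = true ∧ m.testBit x = false) ∨
      (y = x + h ∧ s.testBit x = false ∧ ¬(h ≤ x ∧ m.testBit (x - h) = true) ∧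
        m.testBit x = true)) : (swapMask s m h V).testBit x = V.testBit y := by
  simp only [swapMask, Nat.testBit_or, Nat.testBit_and, Nat.testBit_shiftLeft,
    Nat.testBit_shiftRight]
  rcases H with ⟨rfl, h1, h2, h3⟩ | ⟨rfl, h1, h2, h3⟩ | ⟨rfl, h1, h2, h3⟩
  · by_cases h4 : h ≤ y
    · have : m.testBit (y - h) = false := by simpa [h4] using h2
      simp [h1, h3, this]
    · simp [h1, h3, h4]
  · simp [h1, h2, h3]
  · by_cases h4 : h ≤ x
    · have : m.testBit (x - h) = false := by simpa [h4] using h2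
      simp [h1, h3, this, add_comm h]
    · simp [h1, h3, h4, add_comm h]

theorem IsClassified.of_swap {d V W k : ℕ}
    (hd : (∀ x < 2 ^ d, swapIndex k x < 2 ^ d ∧ swapIndex k (swapIndex k x) = x) ∧
      ∃ M : Fin d → Fin d → ℤ,
        (∀ i j, ∑ k, M i k * M k j = if i = j then 1 else 0) ∧
        ∀ x < 2 ^ d, ∀ j, ∑ i, M j i * bitVec d x i + 0 = bitVec d (swapIndex k x) j)
    (hV : ∀ x < 2 ^ d, W.testBit x = V.testBit (swapIndex k x))
    (hW : IsClassified d (maskHull d W)) : IsClassified d (maskHull d V) := by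
  obtain ⟨h1, M, h2, h3⟩ := hd
  refine IsClassified.congr (areEquivalent_maskHull (M := Matrix.of M) (N := Matrix.of M) (c := 0)
    ?_ (fun x hx hx' => ?_) fun y hy hy' => ?_) hW
  · ext i j
    rw [Matrix.mul_apply, Matrix.one_apply, ← h2]
    rfl
  · exact ⟨swapIndex k x, (h1 x hx).1, by rwa [hV _ (h1 x hx).1, (h1 x hx).2], h3 x hx⟩
  · refine ⟨swapIndex k y, (h1 y hy).1, by rwa [← hV y hy], fun j => ?_⟩
    have := h3 _ (h1 y hy).1 j
    rwa [(h1 y hy).2] at this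

/-- The bits of 0x9999 mark the indices whose two lowest binary digits agree, and those of 0x2222
the indices with digits 01, which are exchanged with their successors. The constants of the other
two exchanges arise in the same way from the digits 1, 2 and 2, 3. -/
theorem isClassified_of_swap_zero {d V : ℕ} (hd : d = 3 ∨ d = 4)
    (h : IsClassified d (maskHull d (swapMask 0x9999 0x2222 1 V))) :
    IsClassified d (maskHull d V) := by
  rcases hd with rfl | rfl
  · refine IsClassified.of_swap (k := 0) ⟨by decide,
      ![![0, 1, 0], ![1, 0, 0], ![0, 0, 1]], by decide, by decide⟩ (fun x hx => testBit_swapMask V ?_) h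
    revert x
    decide
  · refine IsClassified.of_swap (k := 0) ⟨by decide,
      ![![0, 1, 0, 0], ![1, 0, 0, 0], ![0, 0, 1, 0], ![0, 0, 0, 1]], by decide, by decide⟩
      (fun x hx => testBit_swapMask V ?_) h
    revert x
    decide

theorem isClassified_of_swap_one {d V : ℕ} (hd : d = 3 ∨ d = 4)
    (h : IsClassified d (maskHull d (swapMask 0xC3C3 0x0C0C 2 V))) :
    IsClassified d (maskHull d V) := by
  rcases hd with rfl | rfl
  · refine IsClassified.of_swap (k := 1) ⟨by decide,
      ![![1, 0, 0], ![0, 0, 1], ![0, 1, 0]], by decide, by decide⟩ (fun x hx => testBit_swapMask V ?_) h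
    revert x
    decide
  · refine IsClassified.of_swap (k := 1) ⟨by decide,
      ![![1, 0, 0, 0], ![0, 0, 1, 0], ![0, 1, 0, 0], ![0, 0, 0, 1]], by decide, by decide⟩
      (fun x hx => testBit_swapMask V ?_) h
    revert x
    decide

theorem isClassified_of_swap_two {V : ℕ}
    (h : IsClassified 4 (maskHull 4 (swapMask 0xF00F 0x00F0 4 V))) :
    IsClassified 4 (maskHull 4 V) := by
  refine IsClassified.of_swap (k := 2) ⟨by decide,
    ![![1, 0, 0, 0], ![0, 1, 0, 0], ![0, 0, 0, 1], ![0, 0, 1, 0]], by decide, by decide⟩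
    (fun x hx => testBit_swapMask V ?_) h
  revert x
  decide

/-- Decreases a mask by exchanges of adjacent coordinates. -/
def descend (d : ℕ) : ℕ → ℕ → ℕ
  | 0, V => V
  | n + 1, V =>
    if swapMask 0x9999 0x2222 1 V < V then descend d n (swapMask 0x9999 0x2222 1 V) else
    if swapMask 0xC3C3 0x0C0C 2 V < V then descend d n (swapMask 0xC3C3 0x0C0C 2 V) else
    if d = 4 ∧ swapMask 0xF00F 0x00F0 4 V < V then descend d n (swapMask 0xF00F 0x00F0 4 V) else V

theorem isClassified_of_descend {d : ℕ} (hd : d = 3 ∨ d = 4) (n : ℕ) {V : ℕ}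
    (h : IsClassified d (maskHull d (descend d n V))) : IsClassified d (maskHull d V) := by
  induction n generalizing V with
  | zero => exact h
  | succ n ih =>
    rw [descend] at h
    split_ifs at h with h1 h2 h3
    · exact isClassified_of_swap_zero hd (ih h)
    · exact isClassified_of_swap_one hd (ih h)
    · obtain ⟨rfl, -⟩ := h3
      exact isClassified_of_swap_two (ih h)
    · exact h

/-- The mask descends to one with a known normal form. -/
def isKnownMask {d : ℕ} (certs : List (MaskCert d)) (V : ℕ) : Bool :=
  -- Ten exchanges are only a cap: every mask reached on the way is equivalent to V, so minimality
  -- of the last one plays no role.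
  (certs.map MaskCert.target).contains (descend d 10 V)

theorem isClassified_of_isKnownMask {d : ℕ} (hd : d = 3 ∨ d = 4) {certs : List (MaskCert d)}
    (hval : ∀ C ∈ certs, C.Valid) (hsrc : ∀ C ∈ certs, IsClassified d (maskHull d C.source))
    {V : ℕ} (h : isKnownMask certs V = true) : IsClassified d (maskHull d V) := by
  apply isClassified_of_descend hd 10
  rw [isKnownMask, List.contains_iff_mem, List.mem_map] at h
  obtain ⟨C, hC, h⟩ := h
  rw [← h]
  exact (hsrc C hC).congr (hval C hC).areEquivalent.symm

/-! ### Evaluation of the search -/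

set_option maxRecDepth 10000 in
theorem runSearch_three : runSearch 3 (isKnownMask maskCerts3) = true := by decide +kernel

set_option maxRecDepth 10000 in
theorem runSearch_four : runSearch 4 (isKnownMask maskCerts4) = true := by decide +kernel

theorem IsFlowPolytope.isClassified {ι : Type*} [Finite ι] {P : Set (ι → ℝ)}
    (hf : IsFlowPolytope P) (hc : IsCompressed P) (hd : polytopeDim P = 3 ∨ polytopeDim P = 4) :
    IsClassified (polytopeDim P) P := by
  have hne : P.Nonempty := by
    rw [Set.nonempty_iff_ne_empty]
    rintro rfl
    rw [polytopeDim, vectorSpan_empty, finrank_bot] at hd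
    omega
  obtain ⟨R, he, hent, hR, heq, hfacet⟩ := hf.exists_normalForm hc hne
  have hlat := heq.isLatticePolytope hc.1
  refine IsClassified.congr heq ?_
  generalize polytopeDim P = d at *
  rcases hd with rfl | rfl
  · obtain ⟨M, -, hM, hgood⟩ := exists_mask_of_search hR he hent hlat hfacet runSearch_three
    rw [hM]
    exact isClassified_of_isKnownMask (Or.inl rfl) maskCerts3_valid isClassified_source3 hgood
  · obtain ⟨M, -, hM, hgood⟩ := exists_mask_of_search hR he hent hlat hfacet runSearch_four
    rw [hM]
    exact isClassified_of_isKnownMask (Or.inr rfl) maskCerts4_valid isClassified_source4 hgood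

/-! ### The polytopes of the table are prime -/

theorem polytopeDim_prod_le {m n : ℕ} (P₁ : Set (Fin m → ℝ)) (P₂ : Set (Fin n → ℝ)) :
    polytopeDim (polytopeProd P₁ P₂) ≤ polytopeDim P₁ + polytopeDim P₂ := by
  let f : (Fin m ⊕ Fin n → ℝ) →ₗ[ℝ] (Fin m → ℝ) := LinearMap.funLeft ℝ ℝ Sum.inl
  let g : (Fin m ⊕ Fin n → ℝ) →ₗ[ℝ] (Fin n → ℝ) := LinearMap.funLeft ℝ ℝ Sum.inr
  have hf : ∀ x ∈ vectorSpan ℝ (polytopeProd P₁ P₂), f x ∈ vectorSpan ℝ P₁ := by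
    suffices vectorSpan ℝ (polytopeProd P₁ P₂) ≤ (vectorSpan ℝ P₁).comap f from this
    rw [vectorSpan_def, Submodule.span_le]
    rintro _ ⟨x, hx, y, hy, rfl⟩
    exact vsub_mem_vectorSpan ℝ hx.1 hy.1
  have hg : ∀ x ∈ vectorSpan ℝ (polytopeProd P₁ P₂), g x ∈ vectorSpan ℝ P₂ := by
    suffices vectorSpan ℝ (polytopeProd P₁ P₂) ≤ (vectorSpan ℝ P₂).comap g from this
    rw [vectorSpan_def, Submodule.span_le]
    rintro _ ⟨x, hx, y, hy, rfl⟩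
    exact vsub_mem_vectorSpan ℝ hx.2 hy.2
  unfold polytopeDim
  rw [← Module.finrank_prod]
  refine LinearMap.finrank_le_finrank_of_injective (f := (f.restrict hf).prod (g.restrict hg)) ?_
  rintro ⟨x, hx⟩ ⟨y, hy⟩ h
  have h2 := congrArg (fun p => (p.1 : Fin m → ℝ)) h
  have h3 := congrArg (fun p => (p.2 : Fin n → ℝ)) h
  refine Subtype.ext (funext fun i => ?_)
  rcases i with i | i
  · exact congrFun h2 i
  · exact congrFun h3 i

theorem IsLatticePolytope.subsingleton {ι : Type*} {P : Set (ι → ℝ)} (hP : IsLatticePolytope P)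
    (h : {z : ι → ℤ | latticePoint z ∈ P}.Subsingleton) : P.Subsingleton := by
  obtain ⟨S, rfl⟩ := hP
  have h1 : (latticePoint '' (S : Set (ι → ℤ))).Subsingleton := by
    rintro _ ⟨a, ha, rfl⟩ _ ⟨b, hb, rfl⟩
    rw [h (subset_convexHull ℝ _ ⟨a, ha, rfl⟩) (subset_convexHull ℝ _ ⟨b, hb, rfl⟩)]
  rcases h1.eq_empty_or_singleton with h2 | ⟨p, h2⟩ <;> rw [h2] <;> simp

/-- Digit by digit, x + y = u + v says that the parities and the carries agree. This makes the
fourth corner of a parallelogram computable from the other three. -/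
theorem eq_xor_of_bitVec_add_eq {d x y u v : ℕ} (hx : x < 2 ^ d) (hy : y < 2 ^ d) (hu : u < 2 ^ d)
    (hv : v < 2 ^ d) (h : bitVec d x + bitVec d y = bitVec d u + bitVec d v) :
    v = x ^^^ y ^^^ u ∧ x &&& y = u &&& v := by
  have hz : ∀ i, ¬ i < d → ∀ w < 2 ^ d, w.testBit i = false := fun i hi w hw =>
    Nat.testBit_lt_two_pow (hw.trans_le (Nat.pow_le_pow_right two_pos (not_lt.1 hi)))
  constructor <;> refine Nat.eq_of_testBit_eq fun i => ?_
  all_goals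
    simp only [Nat.testBit_xor, Nat.testBit_and]
    by_cases hi : i < d
    · have h1 := congrFun h ⟨i, hi⟩
      simp only [Pi.add_apply, bitVec] at h1
      revert h1
      cases x.testBit i <;> cases y.testBit i <;> cases u.testBit i <;> cases v.testBit i <;> simp
    · simp [hz i hi x hx, hz i hi y hy, hz i hi u hu, hz i hi v hv]

/-- The zero-one points listed by the bits of `V`. -/
def maskPoints (d V : ℕ) : Finset ℕ := (Finset.range (2 ^ d)).filter fun x => V.testBit x = true

/-- The points which are joined to `x` by a diagonal of a parallelogram. -/
def opposites (d V x : ℕ) : Finset ℕ := (maskPoints d V).filter fun y =>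
  y ≠ x ∧ ∃ u ∈ maskPoints d V, u ≠ x ∧ u ≠ y ∧ x ^^^ y ^^^ u ∈ maskPoints d V ∧
    x &&& y = u &&& (x ^^^ y ^^^ u)

/-- Lattice points of the product are pairs (a, b), and they correspond to the points of the mask.
If a' ≠ a and b' ≠ b, then (a, b) and (a', b') are opposite corners of the parallelogram completed
by (a, b') and (a', b), and affine maps preserve parallelograms. -/
theorem card_opposites_of_areEquivalent {d V m n : ℕ} {P₁ : Set (Fin m → ℝ)} {P₂ : Set (Fin n → ℝ)}
    (hV : ∀ z, latticePoint z ∈ maskHull d V → ∃ x ∈ maskPoints d V, z = bitVec d x)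
    (h : AreEquivalent (maskHull d V) (polytopeProd P₁ P₂)) :
    Nat.card {z : Fin m → ℤ | latticePoint z ∈ P₁} * Nat.card {z : Fin n → ℤ | latticePoint z ∈ P₂}
      = (maskPoints d V).card ∧
    ∀ x ∈ maskPoints d V, (Nat.card {z : Fin m → ℤ | latticePoint z ∈ P₁} - 1) *
      (Nat.card {z : Fin n → ℤ | latticePoint z ∈ P₂} - 1) ≤ (opposites d V x).card := by
  classical
  set A := {z : Fin m → ℤ | latticePoint z ∈ P₁} with hA
  set B := {z : Fin n → ℤ | latticePoint z ∈ P₂} with hB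
  obtain ⟨φ, ψ, h1, h2, h3, h4⟩ := areEquivalent_iff.1 h
  have hmem : ∀ p : A × B, latticePoint (Sum.elim p.1.1 p.2.1) ∈ polytopeProd P₁ P₂ :=
    fun p => ⟨p.1.2, p.2.2⟩
  have hF : ∀ p : A × B, ∃ x : maskPoints d V,
      ψ (latticePoint (Sum.elim p.1.1 p.2.1)) = latticePoint (bitVec d x) := by
    intro p
    obtain ⟨z, hz⟩ := h4 _ (subset_affineSpan ℝ _ (hmem p)) (latticePoint_mem _)
    have h5 := (h2 _ (hmem p)).1
    rw [← hz] at h5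
    obtain ⟨x, hx, rfl⟩ := hV z h5
    exact ⟨⟨x, hx⟩, hz.symm⟩
  choose F hF using hF
  have hFinj : Function.Injective F := by
    intro p q hpq
    have h5 := hF p
    rw [hpq, ← hF q] at h5
    have h6 := congrArg φ h5
    rw [(h2 _ (hmem p)).2, (h2 _ (hmem q)).2] at h6
    have h7 := latticePoint_injective h6
    refine Prod.ext (Subtype.ext ?_) (Subtype.ext ?_)
    · ext i
      exact congrFun h7 (Sum.inl i)
    · ext i
      exact congrFun h7 (Sum.inr i)
  have hFsurj : Function.Surjective F := by
    rintro ⟨x, hx⟩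
    have hx' := hx
    rw [maskPoints, Finset.mem_filter, Finset.mem_range] at hx'
    have h5 := latticePoint_bitVec_mem_maskHull hx'.1 hx'.2
    obtain ⟨z, hz⟩ := h3 _ (subset_affineSpan ℝ _ h5) (latticePoint_mem _)
    have h6 := (h1 _ h5).1
    rw [← hz] at h6
    refine ⟨(⟨fun i => z (Sum.inl i), h6.1⟩, ⟨fun i => z (Sum.inr i), h6.2⟩), Subtype.ext ?_⟩
    have h7 := hF (⟨fun i => z (Sum.inl i), h6.1⟩, ⟨fun i => z (Sum.inr i), h6.2⟩)
    have h8 : (Sum.elim (fun i => z (Sum.inl i)) fun i => z (Sum.inr i)) = z := by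
      ext (i | i) <;> rfl
    simp only [h8, hz, (h1 _ h5).2] at h7
    have h9 := latticePoint_injective h7
    have hy := Finset.mem_filter.1
      (F (⟨fun i => z (Sum.inl i), h6.1⟩, ⟨fun i => z (Sum.inr i), h6.2⟩)).2
    rw [Finset.mem_range] at hy
    refine Nat.eq_of_testBit_eq fun i => ?_
    by_cases hi : i < d
    · have := congrFun h9 ⟨i, hi⟩
      simp only [bitVec] at this
      revert this
      cases x.testBit i <;> cases Nat.testBit _ i <;> simp
    · rw [Nat.testBit_lt_two_pow (hy.1.trans_le (Nat.pow_le_pow_right two_pos (not_lt.1 hi))),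
        Nat.testBit_lt_two_pow (hx'.1.trans_le (Nat.pow_le_pow_right two_pos (not_lt.1 hi)))]
  have hcard : Nat.card A * Nat.card B = (maskPoints d V).card := by
    rw [← Nat.card_prod, Nat.card_eq_of_bijective F ⟨hFinj, hFsurj⟩]
    simp
  refine ⟨hcard, fun x hx => ?_⟩
  have hpos : 0 < (maskPoints d V).card := Finset.card_pos.2 ⟨x, hx⟩
  rw [← hcard] at hpos
  have hAf : Finite A := (Nat.card_pos_iff.1 (Nat.pos_of_mul_pos_right hpos)).2
  have hBf : Finite B := (Nat.card_pos_iff.1 (Nat.pos_of_mul_pos_left hpos)).2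
  have := Fintype.ofFinite A
  have := Fintype.ofFinite B
  obtain ⟨⟨a, b⟩, hab⟩ := hFsurj ⟨x, hx⟩
  have hc : (Nat.card A - 1) * (Nat.card B - 1)
      = ((Finset.univ.erase a) ×ˢ (Finset.univ.erase b)).card := by
    rw [Finset.card_product, Finset.card_erase_of_mem (Finset.mem_univ _),
      Finset.card_erase_of_mem (Finset.mem_univ _), Finset.card_univ, Finset.card_univ,
      Nat.card_eq_fintype_card, Nat.card_eq_fintype_card]
  rw [hc]
  refine Finset.card_le_card_of_injOn (fun p => (F p : ℕ)) ?_
    (fun p _ q _ h => hFinj (Subtype.ext h))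
  rintro ⟨a', b'⟩ hp
  simp only [Finset.coe_product, Finset.coe_erase, Finset.coe_univ, Set.mem_prod, Set.mem_sdiff,
    Set.mem_univ, Set.mem_singleton_iff, true_and] at hp
  have hne : ∀ p q : A × B, p ≠ q → (F p : ℕ) ≠ F q := fun p q h h' =>
    h (hFinj (Subtype.ext h'))
  have hadd : bitVec d (F (a, b)) + bitVec d (F (a', b'))
      = bitVec d (F (a, b')) + bitVec d (F (a', b)) := by
    apply latticePoint_injective
    have h5 : ∀ z w : Fin d → ℤ, latticePoint (z + w) = latticePoint z + latticePoint w := by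
      intro z w
      ext i
      simp [latticePoint]
    rw [h5, h5, ← hF, ← hF, ← hF, ← hF, ← sub_eq_sub_iff_add_eq_add,
      ← vsub_eq_sub, ← vsub_eq_sub, ← AffineMap.linearMap_vsub, ← AffineMap.linearMap_vsub]
    congr 1
    ext (i | i) <;> simp [latticePoint]
  have hlt : ∀ p, (F p : ℕ) < 2 ^ d := fun p =>
    Finset.mem_range.1 (Finset.mem_filter.1 (F p).2).1
  obtain ⟨h6, h7⟩ := eq_xor_of_bitVec_add_eq (hlt _) (hlt _) (hlt _) (hlt _) hadd
  have hx' : x = F (a, b) := by rw [hab]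
  rw [Finset.mem_coe, opposites, Finset.mem_filter, hx']
  refine ⟨(F (a', b')).2, hne _ _ ?_, F (a, b'), (F (a, b')).2, hne _ _ ?_, hne _ _ ?_, ?_, ?_⟩
  · exact fun h => hp.1 (Prod.ext_iff.1 h).1
  · exact fun h => hp.2 (Prod.ext_iff.1 h).2
  · exact fun h => hp.1 (Prod.ext_iff.1 h).1.symm
  · rw [← h6]
    exact (F (a', b)).2
  · rw [← h6]
    exact h7

namespace Row

variable (r : Row)

/-- This excludes every factorization of the number of lattice points into factors of at least two.
The range 17 suffices because the unit cube of dimension at most four has at most 16 vertices. -/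
theorem exists_card_opposites_lt : ∀ a < 17, ∀ b < 17, 2 ≤ a → 2 ≤ b →
    a * b = (maskPoints r.dim r.mask).card →
    ∃ x ∈ maskPoints r.dim r.mask, (opposites r.dim r.mask x).card < (a - 1) * (b - 1) := by
  cases r <;> decide +kernel

theorem latticePoint_mem_maskHull (z : Fin r.dim → ℤ)
    (hz : latticePoint z ∈ maskHull r.dim r.mask) :
    ∃ x ∈ maskPoints r.dim r.mask, z = bitVec r.dim x := by
  have h1 : r.param (latticePoint z) ∈ r.polytope := by
    rw [← param_image_maskHull]
    exact ⟨_, hz, rfl⟩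
  obtain ⟨x, hx, rfl⟩ := exists_bitVec z fun i => by
    have h2 := h1.2 (r.basis i)
    have h3 := r.le_one_of_mem h1 (r.basis i)
    simp only [param_apply, basis_coeff, basis_offset, Int.cast_ite, Int.cast_one, Int.cast_zero,
      ite_mul, one_mul, zero_mul, Finset.sum_ite_eq, Finset.mem_univ, if_true, add_zero,
      latticePoint] at h2 h3
    have h2' : 0 ≤ z i := by exact_mod_cast h2
    have h3' : z i ≤ 1 := by exact_mod_cast h3
    omega
  refine ⟨x, Finset.mem_filter.2 ⟨Finset.mem_range.2 hx, (r.mask_spec x hx).2 fun a => ?_⟩, rfl⟩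
  have h2 := h1.2 a
  rw [param_bitVec] at h2
  simpa [latticePoint] using h2

theorem dim_pos : 0 < r.dim := by cases r <;> decide

theorem isPrimePolytope : IsPrimePolytope r.polytope := by
  refine ⟨r.isLatticePolytope, by rw [polytopeDim_eq]; exact r.dim_pos, ?_⟩
  rintro ⟨m, n, P₁, P₂, hP₁, hP₂, hd₁, hd₂, h⟩
  have h' := r.areEquivalent_maskHull.trans h
  obtain ⟨hcard, hopp⟩ := card_opposites_of_areEquivalent r.latticePoint_mem_maskHull h'
  have hdim := h.polytopeDim_eq
  have hle := polytopeDim_prod_le P₁ P₂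
  -- A factor with a single lattice point has dimension zero, and then the other factor would have
  -- full dimension.
  have hzero : ∀ {k : ℕ} {P : Set (Fin k → ℝ)}, IsLatticePolytope P →
      Nat.card {z : Fin k → ℤ | latticePoint z ∈ P} = 1 → polytopeDim P = 0 := by
    intro k P hP hc
    have h1 := hP.subsingleton
      (Set.subsingleton_coe _ |>.1 (Nat.card_eq_one_iff_unique.1 hc).1)
    rw [polytopeDim, vectorSpan_of_subsingleton ℝ h1, finrank_bot]
  set a := Nat.card {z : Fin m → ℤ | latticePoint z ∈ P₁}
  set b := Nat.card {z : Fin n → ℤ | latticePoint z ∈ P₂}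
  have hpos : 0 < (maskPoints r.dim r.mask).card := by
    have h1 := r.simplex_spec.1 0
    exact Finset.card_pos.2 ⟨_, Finset.mem_filter.2 ⟨Finset.mem_range.2 h1.1, h1.2⟩⟩
  have hle16 : (maskPoints r.dim r.mask).card ≤ 16 := by
    refine (Finset.card_filter_le _ _).trans ?_
    rw [Finset.card_range]
    cases r <;> decide
  rw [← hcard] at hpos hle16
  have ha : 0 < a := Nat.pos_of_mul_pos_right hpos
  have hb : 0 < b := Nat.pos_of_mul_pos_left hpos
  have ha1 : a ≠ 1 := fun h1 => by
    have := hzero hP₁ h1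
    omega
  have hb1 : b ≠ 1 := fun h1 => by
    have := hzero hP₂ h1
    omega
  obtain ⟨x, hx, hlt⟩ := r.exists_card_opposites_lt a (by nlinarith) b (by nlinarith) (by omega)
    (by omega) hcard
  exact absurd (hopp x hx) (by omega)

end Row

/-! ### Counting lattice points by dissection into unimodular cones -/

/-- An integral affine inequality `0 ≤ form · z + const` on `ℤ^(d+1)`. -/
structure Halfspace (d : ℕ) where
  form : Fin (d + 1) → ℤ
  const : ℤ

/-- The value of a linear form. -/
def dotForm {d : ℕ} (f z : Fin (d + 1) → ℤ) : ℤ := ∑ k, f k * z k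

theorem dotForm_add {d : ℕ} (f g z : Fin (d + 1) → ℤ) :
    dotForm (f + g) z = dotForm f z + dotForm g z := by
  simp [dotForm, add_mul, Finset.sum_add_distrib]

theorem dotForm_neg {d : ℕ} (f z : Fin (d + 1) → ℤ) : dotForm (-f) z = -dotForm f z := by
  simp [dotForm]

theorem dotForm_sub {d : ℕ} (f g z : Fin (d + 1) → ℤ) :
    dotForm (f - g) z = dotForm f z - dotForm g z := by
  rw [sub_eq_add_neg, dotForm_add, dotForm_neg, sub_eq_add_neg]

theorem dotForm_sum {d : ℕ} {ι : Type*} (s : Finset ι) (f : Fin (d + 1) → ℤ) (c : ι → ℤ)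
    (v : ι → Fin (d + 1) → ℤ) :
    dotForm f (fun k => ∑ i ∈ s, c i * v i k) = ∑ i ∈ s, c i * dotForm f (v i) := by
  simp only [dotForm, Finset.mul_sum]
  rw [Finset.sum_comm]
  exact Finset.sum_congr rfl fun i _ => Finset.sum_congr rfl fun k _ => by ring

namespace Halfspace

variable {d : ℕ}

/-- The value of the inequality. -/
def eval (c : Halfspace d) (z : Fin (d + 1) → ℤ) : ℤ := dotForm c.form z + c.const

/-- The lattice points at height `n` that satisfy all inequalities. -/
def solutions (C : List (Halfspace d)) (n : ℕ) : Set (Fin d → ℤ) :=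
  {y | ∀ c ∈ C, 0 ≤ c.eval (Fin.snoc y (n : ℤ))}

theorem mem_solutions_cons {c : Halfspace d} {C : List (Halfspace d)} {n : ℕ} {y : Fin d → ℤ} :
    y ∈ solutions (c :: C) n ↔ 0 ≤ c.eval (Fin.snoc y (n : ℤ)) ∧ y ∈ solutions C n := by
  simp [solutions]

end Halfspace

/-- A dissection of a cone. A leaf lists the generators of a unimodular cone, by binary digits, and
the positions of the inequalities of its facets. -/
inductive CutTree (d : ℕ) where
  | leaf (vertex : Fin (d + 1) → ℕ) (face : Fin (d + 1) → ℕ)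
  | cut (f : Fin (d + 1) → ℤ) (s t : CutTree d)
  | cutThree (f g : Fin (d + 1) → ℤ) (s t u : CutTree d)

/-- The lattice point at height one with the binary digits of `x`. -/
def coneVec (d x : ℕ) : Fin (d + 1) → ℤ := Fin.snoc (bitVec d x) 1

namespace CutTree

variable {d : ℕ}

/-- The inequality at a position of a list. -/
def at' (C : List (Halfspace d)) (i : ℕ) : Halfspace d := C.getD i ⟨0, 0⟩

/-- The generators and the inequalities of a leaf are dual, and the half-open cone which they span
is given by the list of inequalities. -/
def LeafValid (C : List (Halfspace d)) (v i : Fin (d + 1) → ℕ) : Prop :=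
  (∀ k, i k < C.length ∧ ((at' C (i k)).const = 0 ∨ (at' C (i k)).const = -1)) ∧
  (∀ k j, dotForm (at' C (i k)).form (coneVec d (v j)) = if k = j then 1 else 0) ∧
  -- Each inequality is nonnegative on the generators and holds at the sum of the generators
  -- opposite to the open facets, which is the apex of the shifted cone. So it holds on all lattice
  -- points of the half-open cone.
  (∀ c ∈ C, (∀ j, 0 ≤ dotForm c.form (coneVec d (v j))) ∧
    0 ≤ ∑ j, -(at' C (i j)).const * dotForm c.form (coneVec d (v j)) + c.const)

instance (C : List (Halfspace d)) (v i : Fin (d + 1) → ℕ) : Decidable (LeafValid C v i) :=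
  inferInstanceAs (Decidable (_ ∧ _))

/-- The dissection starts from the given list of inequalities. -/
def check : CutTree d → List (Halfspace d) → Bool
  | leaf v i, C => decide (LeafValid C v i)
  | cut f s t, C => s.check (⟨f, 0⟩ :: C) && t.check (⟨-f, -1⟩ :: C)
  -- The three pieces are: f and g both nonnegative; f negative and f ≤ g; g negative and g < f.
  | cutThree f g s t u, C => s.check (⟨f, 0⟩ :: ⟨g, 0⟩ :: C) &&
      (t.check (⟨-f, -1⟩ :: ⟨g - f, 0⟩ :: C) && u.check (⟨-g, -1⟩ :: ⟨f - g, -1⟩ :: C))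

/-- The numbers of open facets of the cones. -/
def shifts : CutTree d → List (Halfspace d) → List ℕ
  | leaf _ i, C => [(∑ k, -(at' C (i k)).const).toNat]
  | cut f s t, C => s.shifts (⟨f, 0⟩ :: C) ++ t.shifts (⟨-f, -1⟩ :: C)
  | cutThree f g s t u, C => s.shifts (⟨f, 0⟩ :: ⟨g, 0⟩ :: C) ++
      (t.shifts (⟨-f, -1⟩ :: ⟨g - f, 0⟩ :: C) ++ u.shifts (⟨-g, -1⟩ :: ⟨f - g, -1⟩ :: C))

theorem at'_mem {C : List (Halfspace d)} {i : ℕ} (h : i < C.length) : at' C i ∈ C := by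
  rw [at', List.getD_eq_getElem _ _ h]
  exact List.getElem_mem h

/-- By duality the values of the selected inequalities are the coordinates of a lattice point in the
generators. The solutions are the sums of (w k + κ k) times the generators, with natural numbers w k
and κ k = 1 exactly on open facets. All generators have height one, so the w k add up to n - s, and
such w are counted by stars and bars. -/
theorem solutions_leaf {C : List (Halfspace d)} {v i : Fin (d + 1) → ℕ} (h : LeafValid C v i)
    (n : ℕ) : (Halfspace.solutions C n).Finite ∧ ((∑ k, -(at' C (i k)).const).toNat ≤ n →
      (Halfspace.solutions C n).ncard =
        (n - (∑ k, -(at' C (i k)).const).toNat + d).choose d) ∧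
    (n < (∑ k, -(at' C (i k)).const).toNat → (Halfspace.solutions C n).ncard = 0) := by
  classical
  obtain ⟨h1, h2, h3⟩ := h
  set κ : Fin (d + 1) → ℤ := fun k => -(at' C (i k)).const with hκ
  have hκ0 : ∀ k, 0 ≤ κ k := fun k => by
    rcases (h1 k).2 with h | h <;> simp [hκ, h]
  set s := (∑ k, κ k).toNat with hs
  have hs' : (s : ℤ) = ∑ k, κ k := Int.toNat_of_nonneg (Finset.sum_nonneg fun k _ => hκ0 k)
  -- A one-sided inverse of a square integral matrix is two-sided, so duality implies that the
  -- generators form a lattice basis.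
  have hexpand : ∀ z : Fin (d + 1) → ℤ,
      z = fun j => ∑ k, dotForm (at' C (i k)).form z * coneVec d (v k) j := by
    intro z
    have h4 : Matrix.of (fun k j => (at' C (i k)).form j) *
        Matrix.of (fun j k => coneVec d (v k) j) = 1 := by
      ext k j
      rw [Matrix.mul_apply, Matrix.one_apply, ← h2]
      rfl
    have h5 := mul_eq_one_comm.1 h4
    ext j
    have h6 := congrFun (congrArg (fun M => Matrix.mulVec M z) h5) j
    rw [← Matrix.mulVec_mulVec, Matrix.one_mulVec] at h6
    rw [← h6]
    simp only [Matrix.mulVec, dotProduct, Matrix.of_apply, dotForm]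
    exact Finset.sum_congr rfl fun k _ => mul_comm _ _
  have hlast : ∀ x, coneVec d x (Fin.last d) = 1 := fun x => by simp [coneVec]
  have hge : ∀ y ∈ Halfspace.solutions C n, ∀ k,
      κ k ≤ dotForm (at' C (i k)).form (Fin.snoc y (n : ℤ)) := by
    intro y hy k
    have := hy _ (at'_mem (h1 k).1)
    simp only [Halfspace.eval] at this
    simp only [hκ]
    omega
  have hsum : ∀ y : Fin d → ℤ, (n : ℤ) =
      ∑ k, dotForm (at' C (i k)).form (Fin.snoc y (n : ℤ)) := by
    intro y
    have := congrFun (hexpand (Fin.snoc y (n : ℤ))) (Fin.last d)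
    simpa [hlast] using this
  have hsn : ∀ y ∈ Halfspace.solutions C n, s ≤ n := by
    intro y hy
    have h4 := Finset.sum_le_sum fun k (_ : k ∈ Finset.univ) => hge y hy k
    rw [← hsum y, ← hs'] at h4
    exact_mod_cast h4
  set g : (Fin (d + 1) →₀ ℕ) → Fin d → ℤ := fun w j =>
    ∑ k, ((w k : ℤ) + κ k) * coneVec d (v k) j.castSucc with hg
  have hsnoc : s ≤ n → ∀ w ∈ Finset.univ.finsuppAntidiag (n - s),
      (Fin.snoc (g w) (n : ℤ) : Fin (d + 1) → ℤ)
        = fun j => ∑ k, ((w k : ℤ) + κ k) * coneVec d (v k) j := by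
    intro hle w hw
    rw [Finset.mem_finsuppAntidiag] at hw
    ext j
    refine Fin.lastCases ?_ (fun j => ?_) j
    · simp only [Fin.snoc_last, hlast, mul_one, Finset.sum_add_distrib]
      rw [← hs', ← Nat.cast_sum, hw.1]
      push_cast [hle]
      ring
    · simp [hg]
  have himage : s ≤ n → Halfspace.solutions C n
      = (Finset.univ.finsuppAntidiag (n - s)).image g := by
    intro hle
    ext y
    rw [Finset.coe_image]
    constructor
    · intro hy
      refine ⟨Finsupp.equivFunOnFinite.symm fun k =>
        (dotForm (at' C (i k)).form (Fin.snoc y (n : ℤ)) - κ k).toNat, ?_, ?_⟩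
      · rw [Finset.mem_coe, Finset.mem_finsuppAntidiag]
        refine ⟨?_, Finset.subset_univ _⟩
        have h4 : ((∑ k, (dotForm (at' C (i k)).form (Fin.snoc y (n : ℤ)) - κ k).toNat : ℕ) : ℤ)
            = n - s := by
          rw [Nat.cast_sum, hs']
          nth_rw 2 [hsum y]
          rw [← Finset.sum_sub_distrib]
          exact Finset.sum_congr rfl fun k _ => Int.toNat_of_nonneg (sub_nonneg.2 (hge y hy k))
        simp only [Finsupp.coe_equivFunOnFinite_symm]
        omega
      · ext j
        have h4 := congrFun (hexpand (Fin.snoc y (n : ℤ))) j.castSucc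
        rw [Fin.snoc_castSucc] at h4
        rw [h4]
        refine Finset.sum_congr rfl fun k _ => ?_
        simp only [Finsupp.coe_equivFunOnFinite_symm]
        rw [Int.toNat_of_nonneg (sub_nonneg.2 (hge y hy k)), sub_add_cancel]
    · rintro ⟨w, hw, rfl⟩ c hc
      rw [Halfspace.eval, hsnoc hle w hw, dotForm_sum]
      obtain ⟨h4, h5⟩ := h3 c hc
      refine h5.trans (add_le_add_left (Finset.sum_le_sum fun k _ => ?_) _)
      exact mul_le_mul_of_nonneg_right (le_add_of_nonneg_left (Int.natCast_nonneg _)) (h4 k)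
  have hempty : ¬ s ≤ n → Halfspace.solutions C n = ∅ := fun hle =>
    Set.eq_empty_of_forall_notMem fun y hy => hle (hsn y hy)
  by_cases hle : s ≤ n
  · rw [himage hle]
    refine ⟨Finset.finite_toSet _, fun _ => ?_, fun h => absurd hle (not_le.2 h)⟩
    rw [Set.ncard_coe_finset, Finset.card_image_of_injOn, Finset.card_finsuppAntidiag_nat_eq_choose]
    · rw [Finset.card_univ, Fintype.card_fin]
      have : d + 1 + (n - s) - 1 = (n - s) + d := by omega
      rw [this, Nat.choose_symm_add]
    · intro w hw w' hw' hww
      ext k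
      have h4 := congrArg (fun y => dotForm (at' C (i k)).form (Fin.snoc y (n : ℤ))) hww
      simp only [hsnoc hle w hw, hsnoc hle w' hw', dotForm_sum, h2] at h4
      simpa using h4
  · rw [hempty hle]
    exact ⟨Set.finite_empty, fun h => absurd h hle, fun _ => Set.ncard_empty _⟩

/-- Over the integers the complement of f ≥ 0 is -f - 1 ≥ 0, so each cut partitions the solutions
without overlap and the counts add. -/
theorem solutions_of_check (t : CutTree d) {C : List (Halfspace d)} (h : t.check C = true)
    (n : ℕ) : (Halfspace.solutions C n).Finite ∧ (Halfspace.solutions C n).ncard =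
      ((t.shifts C).map fun s => if s ≤ n then (n - s + d).choose d else 0).sum := by
  induction t generalizing C with
  | leaf v i =>
    obtain ⟨h1, h2, h3⟩ := solutions_leaf (of_decide_eq_true h) n
    refine ⟨h1, ?_⟩
    simp only [shifts, List.map_cons, List.map_nil, List.sum_cons, List.sum_nil, add_zero]
    split_ifs with hle
    · exact h2 hle
    · exact h3 (not_le.1 hle)
  | cut f s t ihs iht =>
    rw [check, Bool.and_eq_true] at h
    obtain ⟨h1, h2⟩ := ihs h.1
    obtain ⟨h3, h4⟩ := iht h.2
    have h5 : Halfspace.solutions C n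
        = Halfspace.solutions (⟨f, 0⟩ :: C) n ∪ Halfspace.solutions (⟨-f, -1⟩ :: C) n := by
      ext y
      simp only [Set.mem_union, Halfspace.mem_solutions_cons, Halfspace.eval, dotForm_neg]
      rw [← or_and_right, iff_and_self]
      intro
      omega
    have h6 : Disjoint (Halfspace.solutions (⟨f, 0⟩ :: C) n)
        (Halfspace.solutions (⟨-f, -1⟩ :: C) n) := by
      rw [Set.disjoint_left]
      intro y
      simp only [Halfspace.mem_solutions_cons, Halfspace.eval, dotForm_neg]
      omega
    rw [h5]
    refine ⟨h1.union h3, ?_⟩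
    rw [Set.ncard_union_eq h6 h1 h3, h2, h4, shifts, List.map_append, List.sum_append]
  | cutThree f g s t u ihs iht ihu =>
    rw [check, Bool.and_eq_true, Bool.and_eq_true] at h
    obtain ⟨h1, h2⟩ := ihs h.1
    obtain ⟨h3, h4⟩ := iht h.2.1
    obtain ⟨h5, h6⟩ := ihu h.2.2
    have h7 : Halfspace.solutions C n = Halfspace.solutions (⟨f, 0⟩ :: ⟨g, 0⟩ :: C) n ∪
        (Halfspace.solutions (⟨-f, -1⟩ :: ⟨g - f, 0⟩ :: C) n ∪
          Halfspace.solutions (⟨-g, -1⟩ :: ⟨f - g, -1⟩ :: C) n) := by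
      ext y
      simp only [Set.mem_union, Halfspace.mem_solutions_cons, Halfspace.eval, dotForm_neg,
        dotForm_sub, ← and_assoc]
      rw [← or_and_right, ← or_and_right, iff_and_self]
      intro
      omega
    have h8 : Disjoint (Halfspace.solutions (⟨-f, -1⟩ :: ⟨g - f, 0⟩ :: C) n)
        (Halfspace.solutions (⟨-g, -1⟩ :: ⟨f - g, -1⟩ :: C) n) := by
      rw [Set.disjoint_left]
      intro y
      simp only [Halfspace.mem_solutions_cons, Halfspace.eval, dotForm_neg, dotForm_sub]
      omega
    have h9 : Disjoint (Halfspace.solutions (⟨f, 0⟩ :: ⟨g, 0⟩ :: C) n)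
        (Halfspace.solutions (⟨-f, -1⟩ :: ⟨g - f, 0⟩ :: C) n ∪
          Halfspace.solutions (⟨-g, -1⟩ :: ⟨f - g, -1⟩ :: C) n) := by
      rw [Set.disjoint_left]
      intro y
      simp only [Set.mem_union, Halfspace.mem_solutions_cons, Halfspace.eval, dotForm_neg,
        dotForm_sub]
      omega
    rw [h7]
    refine ⟨h1.union (h3.union h5), ?_⟩
    rw [Set.ncard_union_eq h9 h1 (h3.union h5), Set.ncard_union_eq h8 h3 h5, h2, h4, h6, shifts,
      List.map_append, List.map_append, List.sum_append, List.sum_append]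

end CutTree

/-! ### Dissections for the table and the Ehrhart polynomials -/

namespace Row

/-- The inequalities of the cone over the polytope. -/
def halfspaces (r : Row) : List (Halfspace r.dim) :=
  List.ofFn fun a => ⟨Fin.snoc (r.coeff a) (r.offset a), 0⟩

/-- A dissection of the cone over the polytope into unimodular cones. -/
def cutTree : (r : Row) → CutTree r.dim
  | Ia3 =>
    .leaf ![0, 1, 2, 4] ![3, 0, 1, 2]
  | IIc3 =>
    .cut ![-1, 0, 1, 0]
      (.leaf ![0, 2, 5, 6] ![5, 4, 1, 0])
      (.leaf ![0, 1, 2, 5] ![5, 0, 2, 3])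
  | Ib3 =>
    .cut ![-1, -1, 0, 1]
      (.cut ![-1, 0, -1, 1]
         (.leaf ![1, 2, 4, 6] ![2, 0, 1, 9])
         (.leaf ![1, 4, 5, 6] ![8, 1, 0, 3]))
      (.cut ![-1, 0, -1, 1]
         (.leaf ![1, 2, 3, 6] ![7, 0, 1, 4])
         (.leaf ![1, 3, 5, 6] ![5, 1, 0, 6]))
  | IIc4 =>
    .leaf ![0, 1, 2, 4, 8] ![4, 0, 1, 2, 3]
  | Id4 =>
    .cut ![-1, 0, 1, 0, 0]
      (.leaf ![0, 2, 5, 6, 8] ![6, 4, 1, 0, 5])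
      (.leaf ![0, 1, 2, 5, 8] ![6, 0, 2, 3, 5])
  | IIf4 =>
    .cut ![-1, 0, 0, 1, 0]
      (.leaf ![0, 2, 6, 9, 10] ![6, 5, 3, 1, 0])
      (.cut ![0, 1, -1, 0, 0]
         (.leaf ![0, 1, 2, 6, 9] ![7, 1, 0, 4, 5])
         (.leaf ![0, 1, 5, 6, 9] ![7, 6, 0, 3, 5]))
  | IIId4 =>
    .cut ![-1, 0, 0, 1, 0]
      (.cut ![-1, 0, 1, 0, 0]
         (.leaf ![0, 2, 4, 10, 13] ![6, 8, 0, 1, 2])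
         (.leaf ![0, 2, 9, 10, 13] ![4, 8, 0, 1, 5]))
      (.cut ![-1, 0, 1, 0, 0]
         (.leaf ![0, 2, 4, 5, 13] ![6, 3, 0, 1, 7])
         (.cut ![0, 0, -1, 1, 0]
            (.leaf ![0, 1, 2, 9, 13] ![5, 2, 4, 0, 6])
            (.leaf ![0, 1, 2, 5, 13] ![5, 1, 4, 0, 8])))
  | Ia4 =>
    .cut ![0, -1, 0, 1, 0]
      (.cut ![0, -1, 1, 0, 0]
         (.cut ![0, 0, -1, 1, 0]
            (.leaf ![0, 1, 8, 12, 14] ![9, 3, 0, 1, 4])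
            (.leaf ![0, 1, 4, 12, 14] ![7, 3, 0, 2, 4]))
         (.leaf ![0, 1, 8, 10, 14] ![8, 2, 1, 0, 5]))
      (.cut ![0, -1, 1, 0, 0]
         (.leaf ![0, 1, 4, 6, 14] ![6, 2, 0, 1, 7])
         (.cut ![0, 0, -1, 1, 0]
            (.leaf ![0, 1, 2, 10, 14] ![5, 3, 2, 0, 6])
            (.leaf ![0, 1, 2, 6, 14] ![5, 3, 1, 0, 8])))
  | Vb4 =>
    .cutThree ![1, 0, 0, -1, 0] ![1, 1, 1, 0, -1]
      (.leaf ![1, 2, 4, 6, 9] ![0, 8, 4, 1, 6])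
      (.leaf ![2, 4, 6, 8, 9] ![7, 9, 1, 0, 2])
      (.leaf ![1, 2, 4, 8, 9] ![1, 3, 5, 0, 10])
  | VIc4 =>
    .cut ![-1, -1, 0, -1, 1]
      (.cut ![-1, 0, -1, -1, 1]
         (.leaf ![1, 2, 4, 6, 8] ![2, 0, 1, 9, 6])
         (.leaf ![1, 4, 5, 6, 8] ![7, 1, 0, 3, 6]))
      (.cut ![0, -1, 1, 0, 0]
         (.leaf ![1, 5, 6, 8, 9] ![7, 0, 3, 4, 1])
         (.leaf ![1, 2, 6, 8, 9] ![8, 0, 5, 4, 1]))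
  | VIIb4 =>
    .cut ![0, -1, -1, 0, 1]
      (.cut ![0, -1, 0, 1, 0]
         (.leaf ![1, 4, 5, 10, 12] ![1, 10, 8, 3, 0])
         (.cut ![-1, -1, 0, 0, 1]
            (.leaf ![1, 2, 4, 5, 10] ![2, 1, 0, 9, 6])
            (.leaf ![1, 2, 3, 5, 10] ![2, 11, 0, 5, 6])))
      (.cut ![0, -1, 0, 1, 0]
         (.leaf ![4, 5, 10, 12, 14] ![10, 2, 7, 0, 1])
         (.cut ![-1, -1, 0, 0, 1]
            (.leaf ![2, 4, 5, 10, 14] ![1, 0, 3, 10, 2])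
            (.leaf ![2, 3, 5, 10, 14] ![11, 0, 7, 10, 2])))
  | VIIIa4 =>
    .cut ![-1, 0, 0, 1, 0]
      (.cut ![-1, -1, 0, 0, 1]
         (.cut ![-1, 0, -1, 0, 1]
            (.cut ![0, 0, -1, -1, 1]
               (.leaf ![2, 4, 6, 9, 10] ![0, 2, 11, 4, 3])
               (.leaf ![4, 6, 9, 10, 14] ![2, 14, 4, 1, 0]))
            (.leaf ![4, 6, 9, 13, 14] ![1, 13, 8, 0, 2]))
         (.cut ![-1, 0, -1, 0, 1]
            (.cut ![-1, 0, -1, 1, 0]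
               (.leaf ![2, 9, 10, 11, 14] ![13, 7, 0, 2, 8])
               (.leaf ![2, 6, 9, 11, 14] ![1, 0, 7, 2, 3]))
            (.leaf ![6, 9, 11, 13, 14] ![12, 9, 1, 0, 2])))
      (.cut ![-1, -1, 0, 0, 1]
         (.cut ![-1, 0, -1, 0, 1]
            (.leaf ![1, 2, 4, 6, 9] ![2, 0, 1, 10, 11])
            (.cut ![0, 0, -1, -1, 1]
               (.leaf ![1, 4, 5, 6, 9] ![0, 2, 1, 6, 12])
               (.leaf ![4, 5, 6, 9, 13] ![2, 3, 6, 9, 0])))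
         (.cut ![-1, 0, -1, 0, 1]
            (.leaf ![1, 2, 6, 9, 11] ![2, 0, 7, 14, 1])
            (.cut ![0, 0, -1, -1, 1]
               (.leaf ![1, 5, 6, 9, 11] ![0, 1, 5, 15, 2])
               (.leaf ![5, 6, 9, 11, 13] ![3, 5, 10, 2, 0]))))
  | IXa4 =>
    .cut ![-1, -1, 0, 0, 1]
      (.cut ![0, 0, -1, -1, 1]
         (.cut ![-1, -1, -1, 0, 1]
            (.cut ![-1, 0, -1, -1, 1]
               (.leaf ![1, 2, 4, 8, 10] ![4, 0, 6, 1, 13])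
               (.leaf ![1, 4, 8, 9, 10] ![2, 6, 1, 0, 5]))
            (.cut ![-1, 0, 0, 1, 0]
               (.leaf ![2, 4, 6, 9, 10] ![2, 3, 1, 4, 0])
               (.cut ![-1, 0, -1, 0, 1]
                  (.leaf ![1, 2, 4, 6, 9] ![1, 0, 4, 2, 8])
                  (.leaf ![1, 4, 5, 6, 9] ![3, 4, 0, 6, 8]))))
         (.cut ![-1, 0, -1, 0, 1]
            (.cut ![0, -1, 0, -1, 1]
               (.leaf ![4, 6, 8, 9, 12] ![0, 5, 1, 4, 2])
               (.leaf ![6, 8, 9, 10, 12] ![12, 8, 4, 0, 2]))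
            (.leaf ![4, 5, 6, 9, 12] ![7, 0, 4, 10, 1])))
      (.cut ![-1, 0, -1, 0, 1]
         (.cut ![0, -1, 0, -1, 1]
            (.leaf ![1, 2, 3, 6, 9] ![0, 1, 2, 5, 6])
            (.leaf ![2, 3, 6, 9, 10] ![7, 2, 5, 9, 0]))
         (.leaf ![1, 3, 5, 6, 9] ![6, 1, 0, 7, 5]))
  | Xa4 =>
    .cut ![-1, -1, 0, 0, 1]
      (.cut ![-1, 0, 0, 1, 0]
         (.leaf ![2, 4, 6, 13, 14] ![7, 1, 9, 2, 0])
         (.cut ![0, 1, 1, 0, -1]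
            (.leaf ![2, 4, 5, 6, 13] ![8, 2, 1, 0, 9])
            (.leaf ![1, 2, 4, 5, 13] ![0, 4, 2, 10, 9])))
      (.cut ![0, 0, 1, -1, 0]
         (.cut ![-1, 0, -1, 0, 1]
            (.leaf ![1, 2, 3, 6, 14] ![7, 0, 2, 1, 9])
            (.cut ![-1, 0, 0, -1, 1]
               (.leaf ![1, 3, 5, 6, 14] ![12, 3, 1, 0, 10])
               (.leaf ![1, 3, 5, 13, 14] ![12, 3, 2, 0, 7])))
         (.cut ![-1, 0, -1, 0, 1]
            (.leaf ![1, 2, 3, 11, 14] ![7, 0, 10, 1, 5])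
            (.leaf ![1, 3, 11, 13, 14] ![11, 10, 1, 0, 6])))

theorem check_cutTree (r : Row) : r.cutTree.check r.halfspaces = true := by
  cases r <;> decide +kernel

/-- The `h*`-vector of the polytope, as the sorted list of the shifts. -/
def hStar : Row → List ℕ
  | Ia3 => [0]
  | IIc3 => [0, 1]
  | Ib3 => [0, 1, 1, 2]
  | IIc4 => [0]
  | Id4 => [0, 1]
  | IIf4 => [0, 1, 1]
  | IIId4 => [0, 1, 1, 1, 2]
  | Ia4 => [0, 1, 1, 1, 1, 2]
  | Vb4 => [0, 1, 2]
  | VIc4 => [0, 1, 1, 2]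
  | VIIb4 => [0, 1, 1, 1, 2, 2]
  | VIIIa4 => [0, 1, 1, 1, 1, 1, 2, 2, 2, 2, 2, 3]
  | IXa4 => [0, 1, 1, 1, 1, 1, 2, 2, 2, 2, 2]
  | Xa4 => [0, 1, 1, 1, 1, 2, 2, 2]

theorem shifts_perm_hStar (r : Row) : (r.cutTree.shifts r.halfspaces).Perm r.hStar := by
  cases r <;> decide +kernel

theorem sum_hStar (r : Row) (n : ℕ) :
    (r.hStar.map fun s => if s ≤ n then (n - s + r.dim).choose r.dim else 0).sum
      = r.binomialSum n := by
  -- For k > n the truncated difference n + d - k is smaller than d, so the binomial coefficient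
  -- vanishes and the case distinction disappears. Positivity of d is needed when the difference is
  -- truncated to zero.
  have h0 : ∀ d k, 0 < d → (if k ≤ n then (n - k + d).choose d else 0) = (n + d - k).choose d := by
    intro d k hd
    split_ifs with h
    · congr 1
      omega
    · exact (Nat.choose_eq_zero_of_lt (by omega)).symm
  simp only [h0 _ _ r.dim_pos]
  cases r <;> simp only [hStar, binomialSum, dim, List.map_cons, List.map_nil, List.sum_cons,
    List.sum_nil, Nat.sub_zero, Nat.reduceSubDiff] <;> ring_nf

theorem ncard_solutions (r : Row) (n : ℕ) :
    (Halfspace.solutions r.halfspaces n).Finite ∧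
      (Halfspace.solutions r.halfspaces n).ncard = r.binomialSum n := by
  obtain ⟨h1, h2⟩ := CutTree.solutions_of_check _ r.check_cutTree n
  refine ⟨h1, ?_⟩
  rw [h2, (r.shifts_perm_hStar.map _).sum_eq, sum_hStar r n]

theorem mem_maskHull_iff (r : Row) (y : Fin r.dim → ℝ) :
    y ∈ maskHull r.dim r.mask ↔ ∀ a, 0 ≤ r.param y a := by
  rw [← mem_polytope_iff, ← param_image_maskHull]
  constructor
  · exact fun h => ⟨y, h, rfl⟩
  · rintro ⟨z, hz, hzy⟩
    suffices h : z = y by rwa [← h]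
    ext i
    have := congrFun hzy (r.basis i)
    simpa [param_apply, basis_coeff, basis_offset] using this

theorem dilate_inter (r : Row) {n : ℕ} (hn : 0 < n) :
    (((fun x : Fin r.dim → ℝ => (n : ℝ) • x) '' maskHull r.dim r.mask) ∩ latticePoints (Fin r.dim))
      = latticePoint '' Halfspace.solutions r.halfspaces n := by
  have hn' : (0 : ℝ) < n := by exact_mod_cast hn
  have key : ∀ (y : Fin r.dim → ℝ) (z : Fin r.dim → ℤ), (n : ℝ) • y = latticePoint z →
      (y ∈ maskHull r.dim r.mask ↔ z ∈ Halfspace.solutions r.halfspaces n) := by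
    intro y z hyz
    rw [mem_maskHull_iff]
    simp only [Halfspace.solutions, halfspaces, Set.mem_ofPred_eq, List.mem_ofFn,
      forall_exists_index, forall_apply_eq_imp_iff]
    refine forall_congr' fun a => ?_
    -- Multiplying by n homogenizes the inequality: the offset becomes the coefficient of the height
    -- n.
    have h1 : (n : ℝ) * r.param y a = (((Halfspace.eval
        ⟨Fin.snoc (r.coeff a) (r.offset a), 0⟩ (Fin.snoc z (n : ℤ)) : ℤ)) : ℝ) := by
      simp only [Halfspace.eval, dotForm, Fin.sum_univ_castSucc, Fin.snoc_castSucc, Fin.snoc_last,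
        add_zero, param_apply, mul_add, Finset.mul_sum]
      push_cast
      congr 1
      · refine Finset.sum_congr rfl fun i _ => ?_
        have := congrFun hyz i
        simp only [Pi.smul_apply, smul_eq_mul, latticePoint] at this
        rw [← this]
        ring
      · ring
    rw [← mul_nonneg_iff_of_pos_left hn', h1]
    exact Int.cast_nonneg_iff
  ext x
  constructor
  · rintro ⟨⟨y, hy, hyx⟩, z, rfl⟩
    exact ⟨z, (key y z hyx).1 hy, rfl⟩
  · rintro ⟨z, hz, rfl⟩
    have h1 : (n : ℝ) • ((n : ℝ)⁻¹ • latticePoint z) = latticePoint z :=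
      smul_inv_smul₀ hn'.ne' _
    exact ⟨⟨_, (key _ z h1).2 hz, h1⟩, latticePoint_mem z⟩

theorem eval_ehrhart (r : Row) (n : ℕ) : r.ehrhart.eval (n : ℚ) = (r.binomialSum n : ℚ) := by
  have h3 : ∀ k : ℕ, ((k + 3).choose 3 : ℚ) = (k + 1) * (k + 2) * (k + 3) / 6 := by
    intro k
    rw [Nat.cast_choose_eq_ascPochhammer_div]
    simp [ascPochhammer_succ_eval, Nat.factorial]
    ring
  have h4 : ∀ k : ℕ, ((k + 4).choose 4 : ℚ) = (k + 1) * (k + 2) * (k + 3) * (k + 4) / 24 := by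
    intro k
    rw [Nat.cast_choose_eq_ascPochhammer_div]
    simp [ascPochhammer_succ_eval, Nat.factorial]
    ring
  -- The falling product also vanishes at 0, 1 and 2, where the binomial coefficient is zero, so the
  -- formula needs no lower bound on k.
  have h3' : ∀ j k : ℕ, j < 3 → ((k + j).choose 3 : ℚ)
      = ((k : ℚ) + j) * (k + j - 1) * (k + j - 2) / 6 := by
    intro j k hj
    rcases Nat.lt_or_ge (k + j) 3 with h | h
    · have hk : k < 3 := by omega
      clear h
      interval_cases j <;> interval_cases k <;> norm_num [Nat.choose]
    · obtain ⟨m, hm⟩ := Nat.exists_eq_add_of_le' h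
      rw [hm, h3]
      have : (k : ℚ) + j = m + 3 := by exact_mod_cast hm
      rw [this]
      ring
  have h4' : ∀ j k : ℕ, j < 4 → ((k + j).choose 4 : ℚ)
      = ((k : ℚ) + j) * (k + j - 1) * (k + j - 2) * (k + j - 3) / 24 := by
    intro j k hj
    rcases Nat.lt_or_ge (k + j) 4 with h | h
    · have hk : k < 4 := by omega
      clear h
      interval_cases j <;> interval_cases k <;> norm_num [Nat.choose]
    · obtain ⟨m, hm⟩ := Nat.exists_eq_add_of_le' h
      rw [hm, h4]
      have : (k : ℚ) + j = m + 4 := by exact_mod_cast hm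
      rw [this]
      ring
  cases r <;>
  · simp only [ehrhart, binomialSum, Polynomial.eval_mul, Polynomial.eval_add, Polynomial.eval_pow,
      Polynomial.eval_C, Polynomial.eval_X, Polynomial.eval_ofNat, Nat.cast_add, Nat.cast_mul,
      Nat.cast_ofNat, h3, h4, h3' 2 n (by norm_num), h3' 1 n (by norm_num), h4' 3 n (by norm_num),
      h4' 2 n (by norm_num), h4' 1 n (by norm_num)]
    push_cast
    ring

theorem isEhrhartPolynomial_maskHull (r : Row) :
    IsEhrhartPolynomial (maskHull r.dim r.mask) r.ehrhart := by
  intro n hn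
  rw [dilate_inter r hn]
  obtain ⟨h1, h2⟩ := r.ncard_solutions n
  refine ⟨h1.image _, ?_⟩
  rw [Set.ncard_image_of_injective _ latticePoint_injective, h2, eval_ehrhart]

theorem isEhrhartPolynomial (r : Row) {ι : Type*} {P : Set (ι → ℝ)}
    (h : AreEquivalent P r.polytope) : IsEhrhartPolynomial P r.ehrhart :=
  (h.trans r.areEquivalent_maskHull.symm).isEhrhartPolynomial (isLatticePolytope_maskHull _ _)
    r.isEhrhartPolynomial_maskHull

theorem eq_of_areEquivalent {r s : Row} (hdim : r.dim = s.dim) {ι : Type*} {P : Set (ι → ℝ)}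
    (hr : AreEquivalent P r.polytope) (hs : AreEquivalent P s.polytope) : r = s := by
  have h : ∀ n, 0 < n → r.binomialSum n = s.binomialSum n := by
    intro n hn
    have h1 := (r.isEhrhartPolynomial hr n hn).2
    rw [(s.isEhrhartPolynomial hs n hn).2, eval_ehrhart, eval_ehrhart] at h1
    exact_mod_cast h1.symm
  -- Within one dimension the rows are already separated by the numbers of lattice points in the
  -- first three dilates.
  have h' : r.dim = s.dim ∧ r.binomialSum 1 = s.binomialSum 1 ∧
      r.binomialSum 2 = s.binomialSum 2 ∧ r.binomialSum 3 = s.binomialSum 3 :=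
    ⟨hdim, h 1 one_pos, h 2 two_pos, h 3 three_pos⟩
  clear h hr hs hdim
  cases r <;> cases s <;> first | rfl | exact absurd h' (by decide +kernel)

end Row

theorem mainTheorem6 :
    -- every row of the table is a prime compressed flow polytope of the stated dimension
    (∀ r : Row, IsFlowPolytope r.polytope ∧ IsCompressed r.polytope ∧
      IsPrimePolytope r.polytope ∧ polytopeDim r.polytope = r.dim) ∧
    -- every prime compressed flow polytope of dimension three or four is, up to equivalence,
    -- in exactly one row of the table
    (∀ (m : ℕ) (P : Set (Fin m → ℝ)), IsFlowPolytope P → IsCompressed P → IsPrimePolytope P →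
      (polytopeDim P = 3 ∨ polytopeDim P = 4) →
      ∃! r : Row, r.dim = polytopeDim P ∧ AreEquivalent P r.polytope) ∧
    -- the Ehrhart polynomials
    (∀ (r : Row) (m : ℕ) (P : Set (Fin m → ℝ)), AreEquivalent P r.polytope →
      IsEhrhartPolynomial P r.ehrhart) ∧
    -- the two forms given in each row agree
    (∀ (r : Row) (n : ℕ), r.ehrhart.eval (n : ℚ) = (r.binomialSum n : ℚ)) := by
  refine ⟨fun r => ⟨r.isFlowPolytope, r.isCompressed, r.isPrimePolytope, r.polytopeDim_eq⟩,
    fun m P hf hc hp hd => ?_, fun r m P h => r.isEhrhartPolynomial h, Row.eval_ehrhart⟩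
  -- The second alternative is a product decomposition of exactly the kind that primeness excludes.
  rcases hf.isClassified hc hd with ⟨r, hr, h⟩ | h
  · exact ⟨r, ⟨hr, h⟩, fun s hs => Row.eq_of_areEquivalent (hs.1.trans hr.symm) hs.2 h⟩
  · exact absurd h hp.2.2
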